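/- Let $n\ge 1$, $d=n+1$, $m>0$. Write $x\cdot y=x^0y^0-\sum_{i=1}^n x^iy^i$ on $\mathbb R^d$ and $\omega_{\mathbf p}=\sqrt{m^2+\mathbf p^2}$; for $\mathbf p\in\mathbb R^n$ let $p=(\omega_{\mathbf p},\mathbf p)$. Let $\mathscr H_1=L^2(\mathbb R^n,d\mu)$ with $d\mu(\mathbf p)=(2\omega_{\mathbf p})^{-1}d^n\mathbf p$, let $\mathscr H$ be the Bose Fock space over $\mathscr H_1$ with vacuum $\Omega$, $\mathcal D\subset\mathscr H$ the subspace of vectors of finite particle number, and $\Gamma(T)=\bigoplus_k T^{\otimes k}$ the second quantization of a unitary or antiunitary operator $T$ on $\mathscr H_1$. The free field of $f\in\mathscr S(\mathbb R^d)$ is the operator $\phi(f)=a(\overline{f^-})+a^*(f^+)$ on $\mathcal D$, where $f^\pm(\mathbf p)=\int f(x)e^{\pm ip\cdot x}\,dx$. For $x\in\mathbb R^d$ and $\Lambda$ in the proper orthochronous Lorentz group $\mathcal L_+^\uparrow$ let $U(x,\Lambda)$ be the second quantization of $g(\mathbf p)\mapsto e^{ip\cdot x}g(\Lambda^{-1}p)$,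 and for the reflection $jx=-x$ let $U(0,j)$ be the (antiunitary) second quantization of $g\mapsto\overline g$. Let $P_\mu$ be the self-adjoint generators of the translations, $U(y,1)=e^{iy^\mu P_\mu}$. Let $V$ be a unitary operator on $\mathscr H_1$ and $X_\mu=\Gamma(V^{-1})P_\mu\Gamma(V)$. For operators $X'_\mu$ which generate a strongly continuous unitary representation $V_{X'}(y)=e^{iy^\mu X'_\mu}$ of $\mathbb R^d$, and for a real $d\times d$ matrix $\theta$ which is skew-symmetric with respect to the Lorentzian scalar product, the deformed field $\phi_{\theta,X'}(f)$ is the operator $$\phi_{\theta,X'}(f)\Psi=(2\pi)^{-d}\lim_{\epsilon\to0}\iint dx\,dy\,e^{-ix\cdot y}\chi(\epsilon x,\epsilon y)\,V_{X'}(\theta x)\phi(f)V_{X'}(\theta x)^{-1}V_{X'}(y)\Psi,$$ with domain all $\Psi\in\mathcal D$ for which the integrals exist and converge, for every $\chi\in\mathscr S(\mathbb R^d\times\mathbb R^d)$ with $\chi(0,0)=1$, to a limit independent of $\chi$. For a Lorentz matrix $\Lambda$ put $\gamma_\Lambda(\theta)=\Lambda\theta\Lambda^T$ if $\Lambda$ is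 orthochronous and $\gamma_\Lambda(\theta)=-\Lambda\theta\Lambda^T$ otherwise, with $T$ the transpose with respect to the Lorentzian scalar product. All equalities of operators below include the equality of their domains. The operators $X_\mu$ generate a strongly continuous unitary representation of $\mathbb R^d$, the domain of $\phi_{\theta,X}(f)$ is $\mathcal D$ for all $f\in\mathscr S(\mathbb R^d)$ and all skew-symmetric $\theta$, and the following holds. 1. For all $x\in\mathbb R^d$, $\Lambda\in\mathcal L_+^\uparrow$, $f\in\mathscr S(\mathbb R^d)$ and skew-symmetric $\theta$, $$U(x,\Lambda)\phi_{\theta,X}(f)U(x,\Lambda)^{-1}=\phi_{\theta,\,U(x,\Lambda)XU(x,\Lambda)^{-1}}\big(f\circ(x,\Lambda)^{-1}\big).$$ 2. Suppose that $X$ is covariant under $\mathcal L_+^\uparrow$, that is $U(0,\Lambda)e^{iy\cdot X}U(0,\Lambda)^{-1}=e^{i(\Lambda y)\cdot X}$ for all $y\in\mathbb R^d$ and $\Lambda\in\mathcal L_+^\uparrow$. Then for all $\Lambda\in\mathcal L_+^\uparrow$, $f\in\mathscr S(\mathbb R^d)$ and skew-symmetric $\theta$, $$U(0,\Lambda)\phi_{\theta,X}(f)U(0,\Lambda)^{-1}=\phi_{\gamma_\Lambda(\theta),X}\big(f\circ(0,\Lambda)^{-1}\big).$$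 3. Suppose that $X$ is covariant under the proper orthochronous Poincaré group and the reflection, that is $U(x,\Lambda)e^{iy\cdot X}U(x,\Lambda)^{-1}=e^{i(\Lambda y)\cdot X}$ and $U(0,j)e^{iy\cdot X}U(0,j)^{-1}=e^{i(jy)\cdot X}$ for all $x,y\in\mathbb R^d$ and $\Lambda\in\mathcal L_+^\uparrow$. Let $\theta$ be admissible: $\theta_{01}=\theta_{10}=\lambda\ge0$, in addition $\theta_{23}=-\theta_{32}=\eta\in\mathbb R$ if $d=4$, and all other entries are $0$. Let $W_1=\{x: x_1>|x_0|\}$, let $\mathcal W_0$ be the set of the wedges $MW_1$ with $M\in\mathcal L_+^\uparrow\cup j\mathcal L_+^\uparrow$ (for $d\ge3$ this is $\mathcal L_+^\uparrow W_1$), let $Q(MW_1)=\gamma_M(\theta)$, and $\phi_W(f)=\phi_{Q(W),X}(f)$. Then $Q$ is well defined on $\mathcal W_0$, and $\{\phi_W:W\in\mathcal W_0\}$ is a wedge-covariant field: for all $W\in\mathcal W_0$, $f\in\mathscr S(\mathbb R^d)$, $(x,\Lambda)$ in the proper orthochronous Poincaré group, $$U(x,\Lambda)\phi_W(f)U(x,\Lambda)^{-1}=\phi_{\Lambda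 W}\big(f\circ(x,\Lambda)^{-1}\big),\qquad U(0,j)\phi_W(f)U(0,j)^{-1}=\phi_{jW}\big(\overline f\circ(0,j)^{-1}\big),$$ and the domain and continuity assumptions of the Wightman axioms hold: $\mathcal D$ is dense, contains $\Omega$, is contained in the domain of every $\phi_W(f)$, and is mapped into itself by all $U(x,\Lambda)$, $U(0,j)$ and $\phi_W(f)$; $\langle\Phi,\phi_W(f)\Psi\rangle=\langle\phi_W(\overline f)\Phi,\Psi\rangle$ for $\Phi,\Psi\in\mathcal D$; and $f\mapsto\phi_W(f)\Psi$ is linear and continuous on $\mathscr S(\mathbb R^d)$ for every $\Psi\in\mathcal D$. -/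

import Mathlib

noncomputable section

namespace WarpedField

open MeasureTheory Filter Topology
open scoped InnerProductSpace SchwartzMap ComplexConjugate ComplexOrder

section TensorPower

variable {H : Type*} [NormedAddCommGroup H] [InnerProductSpace ℂ H]

/-- Formal finite linear combinations of `k`-tuples of vectors, the tuple `x` standing for the
elementary tensor `x 0 ⊗ ⋯ ⊗ x (k - 1)`. -/
def TensorPre (H : Type*) (k : ℕ) : Type _ := (Fin k → H) →₀ ℂ

instance (k : ℕ) : AddCommGroup (TensorPre H k) :=
  inferInstanceAs (AddCommGroup ((Fin k → H) →₀ ℂ))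

instance (k : ℕ) : Module ℂ (TensorPre H k) :=
  inferInstanceAs (Module ℂ ((Fin k → H) →₀ ℂ))

/-- The multiple `c • x 0 ⊗ ⋯ ⊗ x (k - 1)` as a formal combination. -/
def TensorPre.single {k : ℕ} (x : Fin k → H) (c : ℂ) : TensorPre H k := Finsupp.single x c

/-- The inner product `∏ ⟪x i, y i⟫` of two elementary tensors. -/
def tensorKernel {k : ℕ} (x y : Fin k → H) : ℂ := ∏ i, ⟪x i, y i⟫_ℂ

theorem tensorKernel_conj {k : ℕ} (x y : Fin k → H) :
    conj (tensorKernel x y) = tensorKernel y x := by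
  simp [tensorKernel, map_prod]

theorem tensorKernel_posSemidef {k : ℕ} {ι : Type*} [Finite ι] (v : ι → Fin k → H) :
    (Matrix.of fun i j => tensorKernel (v i) (v j)).PosSemidef := by
  have key : ∀ s : Finset (Fin k),
      (Matrix.of fun i j => ∏ l ∈ s, ⟪v i l, v j l⟫_ℂ : Matrix ι ι ℂ).PosSemidef := by
    intro s
    induction s using Finset.induction_on with
    | empty =>
      have e : (Matrix.of fun i j => ∏ l ∈ (∅ : Finset (Fin k)), ⟪v i l, v j l⟫_ℂ : Matrix ι ι ℂ)
          = Matrix.gram ℂ (fun _ : ι => (1 : ℂ)) := by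
        ext i j
        simp [Matrix.gram]
      rw [e]
      exact Matrix.posSemidef_gram ℂ _
    | insert a s ha ih =>
      have e : (Matrix.of fun i j => ∏ l ∈ insert a s, ⟪v i l, v j l⟫_ℂ : Matrix ι ι ℂ)
          = (Matrix.gram ℂ (fun i : ι => v i a)).hadamard
            (Matrix.of fun i j => ∏ l ∈ s, ⟪v i l, v j l⟫_ℂ) := by
        ext i j
        simp [Matrix.gram, Matrix.hadamard, Finset.prod_insert ha]
      rw [e]
      exact (Matrix.posSemidef_gram ℂ _).hadamard ih
  exact key Finset.univ

/-- The sesquilinear form on formal combinations extending `tensorKernel`. -/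
def tensorForm {k : ℕ} (a b : TensorPre H k) : ℂ :=
  Finsupp.sum a fun x c => Finsupp.sum b fun y e => conj c * e * tensorKernel x y

theorem tensorForm_eq {k : ℕ} (a b : TensorPre H k) {s : Finset (Fin k → H)}
    (ha : Finsupp.support a ⊆ s) (hb : Finsupp.support b ⊆ s) :
    tensorForm a b = ∑ x ∈ s, ∑ y ∈ s,
      conj (DFunLike.coe (F := (Fin k → H) →₀ ℂ) a x) *
        (DFunLike.coe (F := (Fin k → H) →₀ ℂ) b y) * tensorKernel x y := by
  unfold tensorForm
  rw [Finsupp.sum_of_support_subset _ ha _ (by intro i _; simp [Finsupp.sum])]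
  refine Finset.sum_congr rfl fun x _ => ?_
  rw [Finsupp.sum_of_support_subset _ hb _ (by intro i _; simp)]

theorem tensorForm_nonneg {k : ℕ} (a : TensorPre H k) : 0 ≤ RCLike.re (tensorForm a a) := by
  classical
  rw [tensorForm_eq a a (s := Finsupp.support a) subset_rfl subset_rfl]
  have h := (tensorKernel_posSemidef
    (fun x : Finsupp.support (a : (Fin k → H) →₀ ℂ) => (x : Fin k → H))).re_dotProduct_nonneg
    (fun x => DFunLike.coe (F := (Fin k → H) →₀ ℂ) a (x : Fin k → H))
  convert h using 2
  rw [← Finset.sum_coe_sort]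
  simp only [dotProduct, Matrix.mulVec]
  refine Finset.sum_congr rfl fun x _ => ?_
  rw [Finset.mul_sum, ← Finset.sum_coe_sort (Finsupp.support (a : (Fin k → H) →₀ ℂ))]
  refine Finset.sum_congr rfl fun y _ => ?_
  simp
  ring

instance tensorCore (k : ℕ) : PreInnerProductSpace.Core ℂ (TensorPre H k) where
  inner := tensorForm
  conj_inner_symm a b := by
    classical
    have hb : Finsupp.support b ⊆ Finsupp.support a ∪ Finsupp.support b :=
      Finset.subset_union_right
    rw [tensorForm_eq b a hb Finset.subset_union_left,
      tensorForm_eq a b Finset.subset_union_left hb, map_sum, Finset.sum_comm]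
    refine (Finset.sum_congr rfl fun x _ => ?_)
    simp only [map_sum, map_mul, Complex.conj_conj, tensorKernel_conj]
    refine Finset.sum_congr rfl fun y _ => ?_
    ring
  re_inner_nonneg := tensorForm_nonneg
  add_left a b c := by
    unfold tensorForm
    refine Finsupp.sum_add_index' (f := (a : (Fin k → H) →₀ ℂ)) (g := b) (by simp [Finsupp.sum]) ?_
    intro x u v
    simp only [map_add, add_mul]
    exact Finsupp.sum_add
  smul_left a b r := by
    unfold tensorForm
    refine (Finsupp.sum_smul_index' (g := (a : (Fin k → H) →₀ ℂ)) (by simp [Finsupp.sum])).trans ?_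
    simp only [Finsupp.sum, Finset.mul_sum, smul_eq_mul, map_mul, mul_assoc]

instance (k : ℕ) : SeminormedAddCommGroup (TensorPre H k) :=
  InnerProductSpace.Core.toSeminormedAddCommGroup (𝕜 := ℂ)

instance (k : ℕ) : InnerProductSpace ℂ (TensorPre H k) :=
  InnerProductSpace.ofCore (tensorCore k)

/-- The `k`-fold Hilbert tensor power of `H`: the Hilbert space completion of the span of the
elementary tensors `x 0 ⊗ ⋯ ⊗ x (k - 1)` with respect to
`⟪x 0 ⊗ ⋯, y 0 ⊗ ⋯⟫ = ∏ ⟪x i, y i⟫` (passing to the completion divides out the null vectors,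
which makes the elementary tensors multilinear). -/
abbrev TensorPow (H : Type*) [NormedAddCommGroup H] [InnerProductSpace ℂ H] (k : ℕ) : Type _ :=
  UniformSpace.Completion (TensorPre H k)

/-- The elementary tensor `x 0 ⊗ ⋯ ⊗ x (k - 1)`. -/
def tensor {k : ℕ} (x : Fin k → H) : TensorPow H k :=
  UniformSpace.Completion.coe' (TensorPre.single x 1)

theorem inner_tensor {k : ℕ} (x y : Fin k → H) :
    ⟪tensor x, tensor y⟫_ℂ = ∏ i, ⟪x i, y i⟫_ℂ := by
  unfold tensor
  rw [UniformSpace.Completion.inner_coe]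
  change tensorForm _ _ = _
  simp [tensorForm, TensorPre.single, tensorKernel]

theorem span_tensor_dense (k : ℕ) :
    (Submodule.span ℂ (Set.range (tensor : (Fin k → H) → TensorPow H k))).topologicalClosure
      = ⊤ := by
  rw [← Submodule.dense_iff_topologicalClosure_eq_top]
  refine (UniformSpace.Completion.denseRange_coe (α := TensorPre H k)).mono ?_
  rintro _ ⟨a, rfl⟩
  induction a using Finsupp.induction_linear with
  | zero => exact Submodule.zero_mem _
  | add a b ha hb =>
    have := UniformSpace.Completion.coe_add (α := TensorPre H k) a b
    exact this ▸ Submodule.add_mem _ ha hb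
  | single x c =>
    have h : (Finsupp.single x c : (Fin k → H) →₀ ℂ) = c • Finsupp.single x 1 := by simp
    have := UniformSpace.Completion.coe_smul c (TensorPre.single x 1)
    rw [h]
    exact this ▸ Submodule.smul_mem _ _ (Submodule.subset_span ⟨x, rfl⟩)


theorem ext_tensor {k : ℕ} {u v : TensorPow H k}
    (h : ∀ x : Fin k → H, ⟪tensor x, u⟫_ℂ = ⟪tensor x, v⟫_ℂ) : u = v := by
  have h2 : u - v ∈ (Submodule.span ℂ
      (Set.range (tensor : (Fin k → H) → TensorPow H k)))ᗮ := by
    rw [Submodule.mem_orthogonal]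
    intro w hw
    induction hw using Submodule.span_induction with
    | mem w hw =>
      obtain ⟨x, rfl⟩ := hw
      rw [inner_sub_right, h x, sub_self]
    | zero => simp
    | add a b _ _ ha hb => rw [inner_add_left, ha, hb, add_zero]
    | smul c a _ ha => rw [inner_smul_left, ha, mul_zero]
  rw [← Submodule.orthogonal_closure, span_tensor_dense, Submodule.top_orthogonal_eq_bot,
    Submodule.mem_bot] at h2
  exact sub_eq_zero.mp h2

/-- The elementary tensors are additive in every factor. -/
theorem tensor_update_add {k : ℕ} (x : Fin k → H) (i : Fin k) (u v : H) :
    tensor (Function.update x i (u + v))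
      = tensor (Function.update x i u) + tensor (Function.update x i v) := by
  refine ext_tensor fun y => ?_
  rw [inner_add_right]
  simp only [inner_tensor]
  rw [← Finset.mul_prod_erase _ _ (Finset.mem_univ i),
    ← Finset.mul_prod_erase _ _ (Finset.mem_univ i),
    ← Finset.mul_prod_erase _ _ (Finset.mem_univ i)]
  simp only [Function.update_self, inner_add_right, add_mul]
  congr 1 <;> congr 1 <;>
  exact Finset.prod_congr rfl fun j hj => by
    simp [Function.update_of_ne (Finset.ne_of_mem_erase hj)]

/-- The elementary tensors are homogeneous in every factor. -/
theorem tensor_update_smul {k : ℕ} (x : Fin k → H) (i : Fin k) (c : ℂ) (u : H) :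
    tensor (Function.update x i (c • u)) = c • tensor (Function.update x i u) := by
  refine ext_tensor fun y => ?_
  rw [inner_smul_right]
  simp only [inner_tensor]
  rw [← Finset.mul_prod_erase _ _ (Finset.mem_univ i),
    ← Finset.mul_prod_erase _ _ (Finset.mem_univ i)]
  simp only [Function.update_self, inner_smul_right, mul_assoc]
  congr 2
  exact Finset.prod_congr rfl fun j hj => by
    simp [Function.update_of_ne (Finset.ne_of_mem_erase hj)]

/-- The scalar automorphisms of unitary and of antiunitary operators: the identity of `ℂ` and
complex conjugation. -/
class UnitaryScalar (σ : ℂ →+* ℂ) : Prop where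
  eq_or_eq : σ = RingHom.id ℂ ∨ σ = starRingEnd ℂ

instance : UnitaryScalar (RingHom.id ℂ) := ⟨Or.inl rfl⟩
instance : UnitaryScalar (starRingEnd ℂ) := ⟨Or.inr rfl⟩

theorem UnitaryScalar.conj_apply (σ : ℂ →+* ℂ) [h : UnitaryScalar σ] (z : ℂ) :
    conj (σ z) = σ (conj z) := by
  rcases h.eq_or_eq with rfl | rfl <;> simp

theorem UnitaryScalar.re_apply (σ : ℂ →+* ℂ) [h : UnitaryScalar σ] (z : ℂ) :
    (σ z).re = z.re := by
  rcases h.eq_or_eq with rfl | rfl <;> simp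

/-- Unitary operators preserve the inner product, antiunitary ones conjugate it. -/
theorem UnitaryScalar.inner_map {σ : ℂ →+* ℂ} [h : UnitaryScalar σ] (T : H →ₛₗᵢ[σ] H)
    (x y : H) : ⟪T x, T y⟫_ℂ = σ ⟪x, y⟫_ℂ := by
  have hre : ∀ x y : H, RCLike.re ⟪T x, T y⟫_ℂ = RCLike.re ⟪x, y⟫_ℂ := by
    intro x y
    rw [re_inner_eq_norm_add_mul_self_sub_norm_mul_self_sub_norm_mul_self_div_two,
      re_inner_eq_norm_add_mul_self_sub_norm_mul_self_sub_norm_mul_self_div_two, ← map_add]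
    simp only [LinearIsometry.norm_map]
  have hI := hre x (Complex.I • y)
  have hR := hre x y
  rw [map_smulₛₗ, inner_smul_right, inner_smul_right] at hI
  simp only [RCLike.re_eq_complex_re] at hI hR
  rcases h.eq_or_eq with rfl | rfl
  · apply Complex.ext
    · exact hR
    · simp
  · apply Complex.ext
    · rw [Complex.conj_re]
      exact hR
    · rw [Complex.conj_im]
      simpa using hI

section Lift

variable {E : Type*} [NormedAddCommGroup E] [InnerProductSpace ℂ E]
variable (σ : ℂ →+* ℂ)

/-- The semilinear extension of a map on elementary tensors to formal combinations. -/
def preLift {k : ℕ} (ψ : (Fin k → H) → E) : TensorPre H k →ₛₗ[σ] E where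
  toFun a := Finsupp.sum a fun x c => σ c • ψ x
  map_add' a b := Finsupp.sum_add_index' (f := (a : (Fin k → H) →₀ ℂ)) (g := b) (by simp)
    (by intro x u v; rw [map_add, add_smul])
  map_smul' r a := by
    refine (Finsupp.sum_smul_index' (g := (a : (Fin k → H) →₀ ℂ)) (by simp)).trans ?_
    simp only [Finsupp.sum, Finset.smul_sum, smul_eq_mul, map_mul, mul_smul]

theorem preLift_norm [UnitaryScalar σ] {k : ℕ} (ψ : (Fin k → H) → E) {C : ℝ} (hC : 0 ≤ C)
    (hψ : ∀ x y, ⟪ψ x, ψ y⟫_ℂ = (C : ℂ) ^ 2 * σ (tensorKernel x y)) (a : TensorPre H k) :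
    ‖preLift σ ψ a‖ = C * ‖a‖ := by
  have h1 : ⟪preLift σ ψ a, preLift σ ψ a⟫_ℂ = (C : ℂ) ^ 2 * σ (tensorForm a a) := by
    change ⟪Finsupp.sum a fun x c => σ c • ψ x, Finsupp.sum a fun x c => σ c • ψ x⟫_ℂ = _
    simp only [tensorForm, Finsupp.sum, sum_inner, inner_sum, inner_smul_left, inner_smul_right,
      hψ, map_sum, map_mul, Finset.mul_sum, UnitaryScalar.conj_apply]
    rw [Finset.sum_comm]
    refine Finset.sum_congr rfl fun x _ => Finset.sum_congr rfl fun y _ => ?_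
    ring
  have h2 : ‖preLift σ ψ a‖ ^ 2 = (C * ‖a‖) ^ 2 := by
    rw [mul_pow, @norm_sq_eq_re_inner ℂ, @norm_sq_eq_re_inner ℂ _ _ _ _ a, h1]
    have h3 : ⟪a, a⟫_ℂ = tensorForm a a := rfl
    rw [h3]
    have h4 : ((C : ℂ) ^ 2 * σ (tensorForm a a)) = ((C ^ 2 : ℝ) : ℂ) * σ (tensorForm a a) := by
      push_cast
      rfl
    rw [h4]
    simp only [RCLike.re_eq_complex_re, Complex.re_ofReal_mul, UnitaryScalar.re_apply]
  exact (sq_eq_sq₀ (norm_nonneg _) (mul_nonneg hC (norm_nonneg _))).mp h2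

variable [CompleteSpace E]

/-- The continuous semilinear map on the tensor power which is `ψ` on elementary tensors, for `ψ`
compatible with the inner products up to the factor `C ^ 2`. -/
def tensorLift [UnitaryScalar σ] {k : ℕ} (ψ : (Fin k → H) → E) {C : ℝ} (hC : 0 ≤ C)
    (hψ : ∀ x y, ⟪ψ x, ψ y⟫_ℂ = (C : ℂ) ^ 2 * σ (tensorKernel x y)) : TensorPow H k →SL[σ] E :=
  ((preLift σ ψ).mkContinuous C fun a => (preLift_norm σ ψ hC hψ a).le).extend
    (UniformSpace.Completion.toComplL (𝕜 := ℂ) (E := TensorPre H k))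

theorem tensorLift_coe [UnitaryScalar σ] {k : ℕ} (ψ : (Fin k → H) → E) {C : ℝ} (hC : 0 ≤ C)
    (hψ : ∀ x y, ⟪ψ x, ψ y⟫_ℂ = (C : ℂ) ^ 2 * σ (tensorKernel x y)) (a : TensorPre H k) :
    tensorLift σ ψ hC hψ (UniformSpace.Completion.coe' a) = preLift σ ψ a :=
  ContinuousLinearMap.extend_eq _ (UniformSpace.Completion.denseRange_coe)
    (UniformSpace.Completion.isUniformInducing_coe _) a

theorem tensorLift_tensor [UnitaryScalar σ] {k : ℕ} (ψ : (Fin k → H) → E) {C : ℝ} (hC : 0 ≤ C)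
    (hψ : ∀ x y, ⟪ψ x, ψ y⟫_ℂ = (C : ℂ) ^ 2 * σ (tensorKernel x y)) (x : Fin k → H) :
    tensorLift σ ψ hC hψ (tensor x) = ψ x := by
  refine (tensorLift_coe σ ψ hC hψ _).trans ?_
  refine (Finsupp.sum_single_index (h := fun x c => σ c • ψ x) (by simp)).trans ?_
  rw [map_one, one_smul]

theorem tensorLift_norm [UnitaryScalar σ] {k : ℕ} (ψ : (Fin k → H) → E) {C : ℝ} (hC : 0 ≤ C)
    (hψ : ∀ x y, ⟪ψ x, ψ y⟫_ℂ = (C : ℂ) ^ 2 * σ (tensorKernel x y)) (u : TensorPow H k) :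
    ‖tensorLift σ ψ hC hψ u‖ = C * ‖u‖ := by
  induction u using UniformSpace.Completion.induction_on with
  | hp => exact isClosed_eq (tensorLift σ ψ hC hψ).continuous.norm (continuous_norm.const_mul C)
  | ih a => rw [tensorLift_coe, preLift_norm σ ψ hC hψ, UniformSpace.Completion.norm_coe]

end Lift

/-- Continuous semilinear maps on the tensor power agree if they agree on elementary tensors. -/
theorem tensor_hom_ext {E : Type*} [NormedAddCommGroup E] [NormedSpace ℂ E] {σ : ℂ →+* ℂ} {k : ℕ}
    {S T : TensorPow H k →SL[σ] E} (h : ∀ x, S (tensor x) = T (tensor x)) : S = T := by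
  have hd : Dense ((Submodule.span ℂ
      (Set.range (tensor : (Fin k → H) → TensorPow H k))) : Set (TensorPow H k)) :=
    Submodule.dense_iff_topologicalClosure_eq_top.mpr (span_tensor_dense k)
  refine ContinuousLinearMap.ext_on hd ?_
  rintro _ ⟨x, rfl⟩
  exact h x

/-- The `k`-fold tensor power `T ⊗ ⋯ ⊗ T` of a unitary or antiunitary operator. -/
def tensorMap {σ : ℂ →+* ℂ} [UnitaryScalar σ] (T : H →ₛₗᵢ[σ] H) (k : ℕ) :
    TensorPow H k →SL[σ] TensorPow H k :=
  tensorLift σ (fun x => tensor fun i => T (x i)) zero_le_one (by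
    intro x y
    simp [inner_tensor, tensorKernel, UnitaryScalar.inner_map, map_prod])

theorem tensorMap_tensor {σ : ℂ →+* ℂ} [UnitaryScalar σ] (T : H →ₛₗᵢ[σ] H) {k : ℕ}
    (x : Fin k → H) : tensorMap T k (tensor x) = tensor fun i => T (x i) :=
  tensorLift_tensor ..

theorem tensorMap_norm {σ : ℂ →+* ℂ} [UnitaryScalar σ] (T : H →ₛₗᵢ[σ] H) {k : ℕ}
    (u : TensorPow H k) : ‖tensorMap T k u‖ = ‖u‖ :=
  (tensorLift_norm ..).trans (one_mul _)

/-- The unitary operator permuting the tensor factors by `π`. -/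
def tensorPerm {k : ℕ} (π : Equiv.Perm (Fin k)) : TensorPow H k →L[ℂ] TensorPow H k :=
  tensorLift (RingHom.id ℂ) (fun x => tensor (x ∘ π)) zero_le_one (by
    intro x y
    simp [inner_tensor, tensorKernel, Equiv.prod_comp π fun i => ⟪x i, y i⟫_ℂ])

theorem tensorPerm_tensor {k : ℕ} (π : Equiv.Perm (Fin k)) (x : Fin k → H) :
    tensorPerm π (tensor x) = tensor (x ∘ π) :=
  tensorLift_tensor ..

/-- The operator `u ↦ h ⊗ u`. -/
def tensorCons (h : H) (k : ℕ) : TensorPow H k →L[ℂ] TensorPow H (k + 1) :=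
  tensorLift (RingHom.id ℂ) (fun x => tensor (Fin.cons h x)) (norm_nonneg h) (by
    intro x y
    simp [inner_tensor, tensorKernel, Fin.prod_univ_succ])

theorem tensorCons_tensor (h : H) {k : ℕ} (x : Fin k → H) :
    tensorCons h k (tensor x) = tensor (Fin.cons h x) :=
  tensorLift_tensor ..

/-- The `k`-particle Bose space: the vectors of the tensor power which are invariant under all
permutations of the factors. -/
def symPow (H : Type*) [NormedAddCommGroup H] [InnerProductSpace ℂ H] (k : ℕ) :
    Submodule ℂ (TensorPow H k) :=
  ⨅ π : Equiv.Perm (Fin k), LinearMap.ker ((tensorPerm π - ContinuousLinearMap.id ℂ (TensorPow H k)).toLinearMap)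

theorem mem_symPow {k : ℕ} {u : TensorPow H k} : u ∈ symPow H k ↔ ∀ π, tensorPerm π u = u := by
  simp [symPow, Submodule.mem_iInf, sub_eq_zero]

theorem isClosed_symPow (k : ℕ) : IsClosed (symPow H k : Set (TensorPow H k)) := by
  have : (symPow H k : Set (TensorPow H k))
      = ⋂ π : Equiv.Perm (Fin k), {u | tensorPerm π u = u} := by
    ext u
    simp [mem_symPow]
  rw [this]
  exact isClosed_iInter fun π => isClosed_eq (tensorPerm π).continuous continuous_id

instance (k : ℕ) : CompleteSpace (symPow H k) :=
  (isClosed_symPow k).completeSpace_coe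

theorem tensorMap_mem_symPow {σ : ℂ →+* ℂ} [UnitaryScalar σ] (T : H →ₛₗᵢ[σ] H) {k : ℕ}
    {u : TensorPow H k} (hu : u ∈ symPow H k) : tensorMap T k u ∈ symPow H k := by
  rw [mem_symPow] at hu ⊢
  intro π
  have h : (tensorPerm π).comp (tensorMap T k) = (tensorMap T k).comp (tensorPerm π) :=
    tensor_hom_ext fun x => by
      simp only [ContinuousLinearMap.comp_apply, tensorMap_tensor, tensorPerm_tensor]
      rfl
  have := congrArg (fun S => S u) h
  simpa [hu π] using this

end TensorPower

section FockSpace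

variable {H : Type*} [NormedAddCommGroup H] [InnerProductSpace ℂ H]

/-- The Bose Fock space over `H`, the Hilbert direct sum of the `k`-particle Bose spaces. -/
abbrev Fock (H : Type*) [NormedAddCommGroup H] [InnerProductSpace ℂ H] : Type _ :=
  lp (fun k : ℕ => symPow H k) 2

/-- The second quantization `⨁ k, T ⊗ ⋯ ⊗ T` of a unitary (`σ` the identity) or antiunitary (`σ`
the conjugation) operator, as a map. -/
def fockMap {σ : ℂ →+* ℂ} [UnitaryScalar σ] (T : H →ₛₗᵢ[σ] H) (Ψ : Fock H) : Fock H :=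
  ⟨fun k => ⟨tensorMap T k (Ψ k : TensorPow H k), tensorMap_mem_symPow T (Ψ k).2⟩,
    (lp.memℓp Ψ).mono' fun k => (tensorMap_norm T (Ψ k : TensorPow H k)).le⟩

theorem fockMap_apply {σ : ℂ →+* ℂ} [UnitaryScalar σ] (T : H →ₛₗᵢ[σ] H) (Ψ : Fock H) (k : ℕ) :
    ((fockMap T Ψ) k : TensorPow H k) = tensorMap T k (Ψ k : TensorPow H k) := rfl

theorem fock_ext {Ψ Φ : Fock H} (h : ∀ k, (Ψ k : TensorPow H k) = Φ k) : Ψ = Φ :=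
  lp.ext (funext fun k => Subtype.ext (h k))

theorem fockMap_fockMap {σ : ℂ →+* ℂ} [UnitaryScalar σ] [RingHomInvPair σ σ]
    {S T : H →ₛₗᵢ[σ] H} (h : ∀ x, S (T x) = x) (Ψ : Fock H) : fockMap S (fockMap T Ψ) = Ψ := by
  refine fock_ext fun k => ?_
  rw [fockMap_apply, fockMap_apply]
  have : (tensorMap S k).comp (tensorMap T k) = ContinuousLinearMap.id ℂ (TensorPow H k) :=
    tensor_hom_ext fun x => by
      simp [tensorMap_tensor, h]
  exact congrArg (fun A => A (Ψ k : TensorPow H k)) this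

/-- The second quantization `Γ(T) = ⨁ k, T ⊗ ⋯ ⊗ T` of a unitary or antiunitary operator. -/
def secondQuant {σ : ℂ →+* ℂ} [UnitaryScalar σ] [RingHomInvPair σ σ] (T : H ≃ₛₗᵢ[σ] H) :
    Fock H ≃ₛₗᵢ[σ] Fock H where
  toFun := fockMap T.toLinearIsometry
  map_add' Ψ Φ := fock_ext fun k => map_add (tensorMap T.toLinearIsometry k) _ _
  map_smul' c Ψ := fock_ext fun k => map_smulₛₗ (tensorMap T.toLinearIsometry k) _ _
  invFun := fockMap T.symm.toLinearIsometry
  left_inv := fockMap_fockMap fun x => T.symm_apply_apply x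
  right_inv := fockMap_fockMap fun x => T.apply_symm_apply x
  norm_map' Ψ := by
    have hp : 0 < (2 : ENNReal).toReal := by simp
    rw [lp.norm_eq_tsum_rpow hp, lp.norm_eq_tsum_rpow hp]
    congr 1
    refine tsum_congr fun k => ?_
    congr 1
    exact tensorMap_norm T.toLinearIsometry (Ψ k : TensorPow H k)

/-- The subspace of vectors of finite particle number. -/
def finiteParticle (H : Type*) [NormedAddCommGroup H] [InnerProductSpace ℂ H] :
    Submodule ℂ (Fock H) where
  carrier := {Ψ | ∃ N : ℕ, ∀ k, N ≤ k → Ψ k = 0}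
  zero_mem' := ⟨0, fun _ _ => rfl⟩
  add_mem' := by
    rintro Ψ Φ ⟨N, hN⟩ ⟨M, hM⟩
    refine ⟨max N M, fun k hk => ?_⟩
    rw [lp.coeFn_add, Pi.add_apply, hN k (le_of_max_le_left hk), hM k (le_of_max_le_right hk),
      add_zero]
  smul_mem' := by
    rintro c Ψ ⟨N, hN⟩
    refine ⟨N, fun k hk => ?_⟩
    rw [lp.coeFn_smul, Pi.smul_apply, hN k hk, smul_zero]

/-- The vacuum vector. -/
def vacuum (H : Type*) [NormedAddCommGroup H] [InnerProductSpace ℂ H] : Fock H :=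
  lp.single 2 0 ⟨tensor Fin.elim0, mem_symPow.mpr fun π => by
    rw [tensorPerm_tensor]
    congr 1⟩

/-- Creation of a particle in the state `h`, `Ψ ↦ √(k + 1) • S (h ⊗ Ψ)` from `k` to `k + 1`
particles, with `S` the orthogonal projection onto the symmetric tensors. -/
def creationPart (h : H) (k : ℕ) : symPow H k →L[ℂ] symPow H (k + 1) :=
  ((Real.sqrt (k + 1) : ℝ) : ℂ) •
    ((symPow H (k + 1)).orthogonalProjectionOnto.comp ((tensorCons h k).comp (symPow H k).subtypeL))

/-- Annihilation of a particle in the state `h`, from `k + 1` to `k` particles: the adjoint of the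
creation of `h`. -/
def annihilationPart (h : H) (k : ℕ) : symPow H (k + 1) →L[ℂ] symPow H k :=
  ContinuousLinearMap.adjoint (creationPart h k)

/-- The components of `a*(h) Ψ`. -/
def creationComponent (h : H) (Ψ : Fock H) : (k : ℕ) → symPow H k
  | 0 => 0
  | k + 1 => creationPart h k (Ψ k)

/-- The components of `a(h) Ψ`. -/
def annihilationComponent (h : H) (Ψ : Fock H) (k : ℕ) : symPow H k :=
  annihilationPart h k (Ψ (k + 1))

theorem memℓp_of_finite {Ψ : (k : ℕ) → symPow H k} {N : ℕ} (h : ∀ k, N ≤ k → Ψ k = 0) :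
    Memℓp Ψ 2 := by
  refine (memℓp_zero ((Set.finite_lt_nat N).subset fun k hk => ?_)).of_exponent_ge zero_le
  by_contra hkN
  exact hk (h k (not_lt.mp hkN))

/-- The creation operator `a*(h)` on the vectors of finite particle number. -/
def creation (h : H) : finiteParticle H →ₗ[ℂ] Fock H where
  toFun Ψ := ⟨creationComponent h Ψ, by
    obtain ⟨N, hN⟩ := Ψ.2
    refine memℓp_of_finite (N := N + 1) fun k hk => ?_
    obtain ⟨j, rfl⟩ : ∃ j, k = j + 1 := ⟨k - 1, by omega⟩
    simp [creationComponent, hN j (by omega)]⟩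
  map_add' Ψ Φ := by
    refine fock_ext fun k => congrArg Subtype.val ?_
    cases k with
    | zero => exact (add_zero _).symm
    | succ k => exact map_add (creationPart h k) _ _
  map_smul' c Ψ := by
    refine fock_ext fun k => congrArg Subtype.val ?_
    cases k with
    | zero => exact (smul_zero c).symm
    | succ k => exact map_smul (creationPart h k) _ _

/-- The annihilation operator `a(h)` on the vectors of finite particle number. -/
def annihilation (h : H) : finiteParticle H →ₗ[ℂ] Fock H where
  toFun Ψ := ⟨annihilationComponent h Ψ, by
    obtain ⟨N, hN⟩ := Ψ.2
    refine memℓp_of_finite (N := N) fun k hk => ?_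
    simp [annihilationComponent, hN (k + 1) (by omega)]⟩
  map_add' Ψ Φ := fock_ext fun k => congrArg Subtype.val (map_add (annihilationPart h k) _ _)
  map_smul' c Ψ := fock_ext fun k => congrArg Subtype.val (map_smul (annihilationPart h k) _ _)

end FockSpace

section Lorentz

/-- Vectors of `d`-dimensional Minkowski space, `d = n + 1`, the component `0` being time. -/
abbrev Spacetime (n : ℕ) : Type := Fin (n + 1) → ℝ

/-- The Lorentzian scalar product, with signature `(+, -, …, -)`. -/
def mink {n : ℕ} (x y : Spacetime n) : ℝ := x 0 * y 0 - ∑ i : Fin n, x i.succ * y i.succ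

/-- The matrix of the Lorentzian scalar product. -/
def metric (n : ℕ) : Matrix (Fin (n + 1)) (Fin (n + 1)) ℝ :=
  Matrix.diagonal (Fin.cons 1 fun _ => -1)

/-- The transpose of a matrix with respect to the Lorentzian scalar product. -/
def minkTranspose {n : ℕ} (M : Matrix (Fin (n + 1)) (Fin (n + 1)) ℝ) :
    Matrix (Fin (n + 1)) (Fin (n + 1)) ℝ :=
  metric n * M.transpose * metric n

/-- Lorentz transformations: the matrices which preserve the Lorentzian scalar product. -/
def IsLorentz {n : ℕ} (M : Matrix (Fin (n + 1)) (Fin (n + 1)) ℝ) : Prop :=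
  M.transpose * metric n * M = metric n

/-- The proper orthochronous Lorentz group. -/
structure ProperOrthochronous (n : ℕ) where
  mat : Matrix (Fin (n + 1)) (Fin (n + 1)) ℝ
  isLorentz : IsLorentz mat
  det_eq_one : mat.det = 1
  orthochronous : 0 < mat 0 0

theorem metric_mul_self (n : ℕ) : metric n * metric n = 1 := by
  rw [metric, Matrix.diagonal_mul_diagonal, ← Matrix.diagonal_one]
  congr 1
  ext i
  refine Fin.cases ?_ (fun j => ?_) i <;> simp

theorem mink_eq {n : ℕ} (x y : Spacetime n) : mink x y = x ⬝ᵥ (metric n).mulVec y := by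
  simp [mink, metric, Matrix.mulVec_diagonal, dotProduct, Fin.sum_univ_succ, sub_eq_add_neg]

theorem mink_mulVec {n : ℕ} (M : Matrix (Fin (n + 1)) (Fin (n + 1)) ℝ) (x y : Spacetime n) :
    mink (M.mulVec x) y = mink x ((minkTranspose M).mulVec y) := by
  rw [mink_eq, mink_eq, minkTranspose, Matrix.mulVec_mulVec, ← mul_assoc, ← mul_assoc,
    metric_mul_self, one_mul, ← Matrix.mulVec_mulVec, Matrix.dotProduct_mulVec x,
    Matrix.vecMul_transpose]

theorem IsLorentz.transpose_mul {n : ℕ} {M : Matrix (Fin (n + 1)) (Fin (n + 1)) ℝ}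
    (h : IsLorentz M) : minkTranspose M * M = 1 := by
  rw [minkTranspose, mul_assoc, mul_assoc, ← mul_assoc M.transpose, h, metric_mul_self]

theorem IsLorentz.mul_transpose {n : ℕ} {M : Matrix (Fin (n + 1)) (Fin (n + 1)) ℝ}
    (h : IsLorentz M) : M * minkTranspose M = 1 :=
  mul_eq_one_comm.mp h.transpose_mul

theorem IsLorentz.mink_map {n : ℕ} {M : Matrix (Fin (n + 1)) (Fin (n + 1)) ℝ}
    (h : IsLorentz M) (x y : Spacetime n) : mink (M.mulVec x) (M.mulVec y) = mink x y := by
  rw [mink_mulVec, Matrix.mulVec_mulVec, h.transpose_mul, Matrix.one_mulVec]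

theorem minkTranspose_transpose {n : ℕ} (M : Matrix (Fin (n + 1)) (Fin (n + 1)) ℝ) :
    minkTranspose (minkTranspose M) = M := by
  have ht : (metric n).transpose = metric n := Matrix.diagonal_transpose _
  simp only [minkTranspose, Matrix.transpose_mul, Matrix.transpose_transpose, ht]
  rw [← mul_assoc, ← mul_assoc, metric_mul_self, one_mul, mul_assoc, metric_mul_self, mul_one]

theorem IsLorentz.minkTranspose {n : ℕ} {M : Matrix (Fin (n + 1)) (Fin (n + 1)) ℝ}
    (h : IsLorentz M) : IsLorentz (minkTranspose M) := by
  have h1 : WarpedField.minkTranspose (WarpedField.minkTranspose M) * WarpedField.minkTranspose M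
      = 1 := by
    rw [minkTranspose_transpose, h.mul_transpose]
  have h2 := congrArg (fun A => metric n * A) h1
  rw [WarpedField.minkTranspose] at h2
  simp only [← mul_assoc, metric_mul_self, one_mul, mul_one] at h2
  exact h2

namespace ProperOrthochronous

/-- The inverse Lorentz transformation. -/
def inv {n : ℕ} (Λ : ProperOrthochronous n) : ProperOrthochronous n where
  mat := minkTranspose Λ.mat
  isLorentz := Λ.isLorentz.minkTranspose
  det_eq_one := by
    have h := congrArg Matrix.det Λ.isLorentz.transpose_mul
    rwa [Matrix.det_mul, Λ.det_eq_one, mul_one, Matrix.det_one] at h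
  orthochronous := by
    simpa [minkTranspose, metric, Matrix.diagonal_mul, Matrix.mul_diagonal] using Λ.orthochronous

theorem mat_mul_inv {n : ℕ} (Λ : ProperOrthochronous n) : Λ.mat * Λ.inv.mat = 1 :=
  Λ.isLorentz.mul_transpose

theorem inv_mul_mat {n : ℕ} (Λ : ProperOrthochronous n) : Λ.inv.mat * Λ.mat = 1 :=
  Λ.isLorentz.transpose_mul

end ProperOrthochronous

end Lorentz

section OneParticleSpace

/-- The energy `ω_p = √(m² + p²)`. -/
def energy {n : ℕ} (m : ℝ) (p : Fin n → ℝ) : ℝ := Real.sqrt (m ^ 2 + ∑ i, p i ^ 2)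

/-- The point `(ω_p, p)` of the upper mass shell. -/
def shellPoint {n : ℕ} (m : ℝ) (p : Fin n → ℝ) : Spacetime n := Fin.cons (energy m p) p

/-- The measure `dμ(p) = (2 ω_p)⁻¹ dp`. -/
def shellMeasure (n : ℕ) (m : ℝ) : Measure (Fin n → ℝ) :=
  volume.withDensity fun p => ENNReal.ofReal (2 * energy m p)⁻¹

/-- The one-particle space `L²(ℝⁿ, dμ)`. -/
abbrev OneParticle (n : ℕ) (m : ℝ) : Type := Lp ℂ 2 (shellMeasure n m)

/-- The action `p ↦ Λp` of a matrix on spatial momenta through the mass shell. -/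
def shellMap {n : ℕ} (m : ℝ) (M : Matrix (Fin (n + 1)) (Fin (n + 1)) ℝ) (p : Fin n → ℝ) :
    Fin n → ℝ :=
  fun i => M.mulVec (shellPoint m p) i.succ

variable {n : ℕ} {m : ℝ}

theorem energy_pos [hm : Fact (0 < m)] (p : Fin n → ℝ) : 0 < energy m p := by
  have := hm.out
  unfold energy
  positivity

theorem energy_sq (p : Fin n → ℝ) : energy m p ^ 2 = m ^ 2 + ∑ i, p i ^ 2 :=
  Real.sq_sqrt (by positivity)

theorem continuous_energy : Continuous (energy m : (Fin n → ℝ) → ℝ) := by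
  unfold energy
  fun_prop

theorem continuous_shellPoint : Continuous (shellPoint m : (Fin n → ℝ) → Spacetime n) := by
  refine continuous_pi fun i => ?_
  refine Fin.cases ?_ (fun j => ?_) i
  · exact continuous_energy
  · exact continuous_apply j

theorem continuous_shellMap (M : Matrix (Fin (n + 1)) (Fin (n + 1)) ℝ) :
    Continuous (shellMap m M : (Fin n → ℝ) → Fin n → ℝ) := by
  refine continuous_pi fun i => ?_
  have h : Continuous fun p : Fin n → ℝ => M.mulVec (shellPoint m p) :=
    continuous_const.matrix_mulVec continuous_shellPoint
  exact (continuous_apply i.succ).comp h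

theorem mink_shellPoint (p : Fin n → ℝ) : mink (shellPoint m p) (shellPoint m p) = m ^ 2 := by
  have h := energy_sq (m := m) p
  simp only [mink, shellPoint, Fin.cons_zero, Fin.cons_succ, ← pow_two]
  linarith

theorem time_mulVec_pos [Fact (0 < m)] (Λ : ProperOrthochronous n) (p : Fin n → ℝ) :
    0 < Λ.mat.mulVec (shellPoint m p) 0 := by
  have h1 : (Λ.mat 0 0) ^ 2 = 1 + ∑ i : Fin n, (Λ.mat 0 i.succ) ^ 2 := by
    have h := congrFun (congrFun Λ.isLorentz.mul_transpose 0) 0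
    simp only [minkTranspose, metric, ← mul_assoc] at h
    rw [Matrix.mul_diagonal, Matrix.mul_apply, Fin.sum_univ_succ] at h
    simp [Matrix.mul_diagonal] at h
    have h2 : ∑ i : Fin n, (Λ.mat 0 i.succ) ^ 2 = ∑ i : Fin n, Λ.mat 0 i.succ * Λ.mat 0 i.succ :=
      Finset.sum_congr rfl fun i _ => pow_two _
    rw [h2]
    nlinarith
  have h2 := Finset.sum_mul_sq_le_sq_mul_sq Finset.univ (fun i : Fin n => Λ.mat 0 i.succ) p
  have h3 := energy_sq (m := m) p
  have h4 := energy_pos (m := m) p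
  have h5 := Λ.orthochronous
  have hm : 0 < m := Fact.out
  have h6 : Λ.mat.mulVec (shellPoint m p) 0
      = Λ.mat 0 0 * energy m p + ∑ i : Fin n, Λ.mat 0 i.succ * p i := by
    simp [Matrix.mulVec, dotProduct, Fin.sum_univ_succ, shellPoint]
  rw [h6]
  have hs1 : 0 ≤ ∑ i : Fin n, (Λ.mat 0 i.succ) ^ 2 := Finset.sum_nonneg fun i _ => sq_nonneg _
  have hs2 : 0 ≤ ∑ i : Fin n, p i ^ 2 := Finset.sum_nonneg fun i _ => sq_nonneg _
  have h7 : (∑ i : Fin n, Λ.mat 0 i.succ * p i) ^ 2 < (Λ.mat 0 0 * energy m p) ^ 2 := by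
    rw [mul_pow, h1, h3]
    have : 0 < m ^ 2 := by positivity
    nlinarith [mul_nonneg hs1 this.le]
  have h8 := abs_lt_of_sq_lt_sq h7 (by positivity)
  linarith [(abs_lt.mp h8).1]

theorem mulVec_shellPoint [Fact (0 < m)] (Λ : ProperOrthochronous n) (p : Fin n → ℝ) :
    Λ.mat.mulVec (shellPoint m p) = shellPoint m (shellMap m Λ.mat p) := by
  have h1 := Λ.isLorentz.mink_map (shellPoint m p) (shellPoint m p)
  rw [mink_shellPoint] at h1
  ext i
  refine Fin.cases ?_ (fun j => rfl) i
  have h2 : (Λ.mat.mulVec (shellPoint m p) 0) ^ 2 = energy m (shellMap m Λ.mat p) ^ 2 := by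
    rw [energy_sq, ← h1]
    simp only [mink, shellMap, pow_two]
    ring
  exact (sq_eq_sq₀ (time_mulVec_pos Λ p).le (energy_pos _).le).mp h2

theorem shellMap_shellMap [Fact (0 < m)] (M : Matrix (Fin (n + 1)) (Fin (n + 1)) ℝ)
    (Λ : ProperOrthochronous n) (p : Fin n → ℝ) :
    shellMap m M (shellMap m Λ.mat p) = shellMap m (M * Λ.mat) p := by
  ext i
  simp only [shellMap]
  rw [← Matrix.mulVec_mulVec, mulVec_shellPoint]

theorem shellMap_one (p : Fin n → ℝ) : shellMap m 1 p = p := by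
  ext i
  simp [shellMap, shellPoint]

/-- The matrix with the blocks `a`, `r`, `c`, `D`. -/
def bordered (a : ℝ) (r c : Fin n → ℝ) (D : Matrix (Fin n) (Fin n) ℝ) :
    Matrix (Fin (n + 1)) (Fin (n + 1)) ℝ :=
  Matrix.of (Fin.cons (Fin.cons a r) fun i => Fin.cons (c i) (D i))

theorem det_bordered_reindex (a : ℝ) (r c : Fin n → ℝ) (D : Matrix (Fin n) (Fin n) ℝ) :
    (bordered a r c D).det = (Matrix.fromBlocks D (Matrix.of fun i (_ : Unit) => c i)
      (Matrix.of fun (_ : Unit) j => r j) (Matrix.of fun _ _ => a)).det := by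
  rw [← Matrix.det_submatrix_equiv_self
    (((finSuccEquiv n).trans (Equiv.optionEquivSumPUnit (Fin n))).symm) (bordered a r c D)]
  congr 1
  ext i j
  rcases i with i | i <;> rcases j with j | j <;>
    simp [bordered, finSuccEquiv_symm_some, finSuccEquiv_symm_none]

theorem det_bordered_one (a : ℝ) (r c : Fin n → ℝ) :
    (bordered a r c 1).det = a - ∑ i, r i * c i := by
  rw [det_bordered_reindex, Matrix.det_fromBlocks_one₁₁, Matrix.det_unique]
  simp [Matrix.mul_apply]

theorem det_bordered_zero (D : Matrix (Fin n) (Fin n) ℝ) :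
    (bordered 1 0 0 D).det = D.det := by
  rw [det_bordered_reindex]
  have h : (Matrix.of fun (i : Fin n) (_ : Unit) => (0 : Fin n → ℝ) i) = 0 := rfl
  rw [h, Matrix.det_fromBlocks_zero₁₂, Matrix.det_unique (n := Unit)]
  simp

/-- The Jacobian matrix of `p ↦ Λp`. -/
def shellJacobian (m : ℝ) (M : Matrix (Fin (n + 1)) (Fin (n + 1)) ℝ) (p : Fin n → ℝ) :
    Matrix (Fin n) (Fin n) ℝ :=
  Matrix.of fun i j => M i.succ 0 * (p j / energy m p) + M i.succ j.succ

theorem hasFDerivAt_shellMap [Fact (0 < m)] (M : Matrix (Fin (n + 1)) (Fin (n + 1)) ℝ)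
    (p : Fin n → ℝ) :
    HasFDerivAt (shellMap m M) (Matrix.toLin' (shellJacobian m M p)).toContinuousLinearMap p := by
  have hm : 0 < m := Fact.out
  have hω : HasFDerivAt (energy m : (Fin n → ℝ) → ℝ)
      (∑ j, (p j / energy m p) • (ContinuousLinearMap.proj j : (Fin n → ℝ) →L[ℝ] ℝ)) p := by
    have h1 : HasFDerivAt (fun q : Fin n → ℝ => m ^ 2 + ∑ i, q i ^ 2)
        (∑ j, (2 * p j) • (ContinuousLinearMap.proj j : (Fin n → ℝ) →L[ℝ] ℝ)) p := by
      refine HasFDerivAt.const_add _ (HasFDerivAt.fun_sum fun j _ => ?_)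
      have := ((ContinuousLinearMap.proj (R := ℝ) (φ := fun _ : Fin n => ℝ) j).hasFDerivAt
        (x := p)).pow 2
      refine this.congr_fderiv ?_
      ext v
      simp
    have h2 := h1.sqrt (by positivity)
    refine h2.congr_fderiv ?_
    rw [Finset.smul_sum]
    refine Finset.sum_congr rfl fun j _ => ?_
    rw [smul_smul]
    congr 1
    have := energy_pos (m := m) p
    unfold energy at this ⊢
    field_simp
  rw [hasFDerivAt_pi']
  intro i
  have h3 : (fun q => shellMap m M q i)
      = fun q => M i.succ 0 * energy m q + ∑ j : Fin n, M i.succ j.succ * q j := by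
    ext q
    simp [shellMap, Matrix.mulVec, dotProduct, Fin.sum_univ_succ, shellPoint]
  rw [h3]
  have h4 : HasFDerivAt (fun q : Fin n → ℝ => ∑ j : Fin n, M i.succ j.succ * q j)
      (∑ j, M i.succ j.succ • (ContinuousLinearMap.proj j : (Fin n → ℝ) →L[ℝ] ℝ)) p :=
    HasFDerivAt.fun_sum fun j _ =>
      ((ContinuousLinearMap.proj (R := ℝ) (φ := fun _ : Fin n => ℝ) j).hasFDerivAt).const_mul _
  refine ((hω.const_mul (M i.succ 0)).add h4).congr_fderiv ?_
  ext v
  simp [shellJacobian, Matrix.mulVec, dotProduct, add_mul, Finset.sum_add_distrib, Finset.mul_sum,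
    mul_assoc]

theorem det_shellJacobian [Fact (0 < m)] (Λ : ProperOrthochronous n) (p : Fin n → ℝ) :
    (shellJacobian m Λ.mat p).det = energy m (shellMap m Λ.mat p) / energy m p := by
  have hm : 0 < m := Fact.out
  set q := shellMap m Λ.mat p with hq
  have hp0 := energy_pos (m := m) p
  have hq0 := energy_pos (m := m) q
  have hdet : ∀ k : Fin n → ℝ, (bordered (energy m k) (fun j => k j / energy m k) k 1).det
      = m ^ 2 / energy m k := by
    intro k
    have hk0 := energy_pos (m := m) k
    have hk := energy_sq (m := m) k
    rw [det_bordered_one]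
    have : ∑ i, k i / energy m k * k i = (∑ i, k i ^ 2) / energy m k := by
      rw [Finset.sum_div]
      exact Finset.sum_congr rfl fun i _ => by ring
    rw [this, eq_div_iff hk0.ne', sub_mul, div_mul_cancel₀ _ hk0.ne']
    nlinarith
  have hmul : Λ.mat * bordered (energy m p) (fun j => p j / energy m p) p 1
      = bordered (energy m q) (fun j => q j / energy m q) q 1
        * bordered 1 0 0 (shellJacobian m Λ.mat p) := by
    have hcol : ∀ i : Fin (n + 1), ∀ j : Fin n,
        (Λ.mat * bordered (energy m p) (fun j => p j / energy m p) p 1) i j.succ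
          = Λ.mat i 0 * (p j / energy m p) + Λ.mat i j.succ := by
      intro i j
      simp [Matrix.mul_apply, Fin.sum_univ_succ, bordered, Matrix.one_apply]
    have hrow : ∀ j : Fin n, energy m q * (Λ.mat 0 0 * (p j / energy m p) + Λ.mat 0 j.succ)
        = ∑ k, q k * shellJacobian m Λ.mat p k j := by
      intro j
      have h1 := Λ.isLorentz.mink_map (shellPoint m p)
        (Fin.cons (p j / energy m p) (Pi.single j 1))
      rw [mulVec_shellPoint, ← hq] at h1
      have h2 : mink (shellPoint m p) (Fin.cons (p j / energy m p) (Pi.single j 1)) = 0 := by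
        simp [mink, shellPoint, Pi.single_apply]
        field_simp
        ring
      rw [h2] at h1
      have h3 : ∀ i, Λ.mat.mulVec (Fin.cons (p j / energy m p) (Pi.single j 1)) i
          = Λ.mat i 0 * (p j / energy m p) + Λ.mat i j.succ := by
        intro i
        simp [Matrix.mulVec, dotProduct, Fin.sum_univ_succ, Pi.single_apply]
      simp only [mink, h3, shellPoint, Fin.cons_zero, Fin.cons_succ] at h1
      simp only [shellJacobian, Matrix.of_apply]
      linarith
    ext i j
    refine Fin.cases ?_ (fun j => ?_) j
    · have h0 := congrFun (mulVec_shellPoint (m := m) Λ p) i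
      rw [← hq] at h0
      have hl : (Λ.mat * bordered (energy m p) (fun j => p j / energy m p) p 1) i 0
          = Λ.mat.mulVec (shellPoint m p) i := by
        simp [Matrix.mul_apply, Matrix.mulVec, dotProduct, Fin.sum_univ_succ, bordered, shellPoint]
      rw [hl, h0]
      refine Fin.cases ?_ (fun i => ?_) i <;>
        simp [Matrix.mul_apply, Fin.sum_univ_succ, bordered, shellPoint]
    · rw [hcol]
      refine Fin.cases ?_ (fun i => ?_) i
      · have h := hrow j
        have h5 : (bordered (energy m q) (fun j => q j / energy m q) q 1
            * bordered 1 0 0 (shellJacobian m Λ.mat p)) 0 j.succ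
            = (∑ k, q k * shellJacobian m Λ.mat p k j) / energy m q := by
          simp [Matrix.mul_apply, Fin.sum_univ_succ, bordered, Finset.sum_div, div_mul_eq_mul_div]
        rw [h5, ← h]
        field_simp
      · simp [Matrix.mul_apply, Fin.sum_univ_succ, bordered, Matrix.one_apply, shellJacobian]
  have h := congrArg Matrix.det hmul
  rw [Matrix.det_mul, Matrix.det_mul, hdet, hdet, det_bordered_zero, Λ.det_eq_one] at h
  rw [eq_div_iff hp0.ne']
  field_simp at h
  linarith

/-- The measure `dμ` is Lorentz invariant. -/
theorem measurePreserving_shellMap [Fact (0 < m)] (Λ : ProperOrthochronous n) :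
    MeasurePreserving (shellMap m Λ.mat) (shellMeasure n m) (shellMeasure n m) := by
  have hmeas : Measurable (shellMap m Λ.mat : (Fin n → ℝ) → Fin n → ℝ) :=
    (continuous_shellMap _).measurable
  refine ⟨hmeas, ?_⟩
  have hinj : Function.Injective (shellMap m Λ.mat : (Fin n → ℝ) → Fin n → ℝ) := by
    refine Function.LeftInverse.injective (g := shellMap m Λ.inv.mat) fun p => ?_
    rw [shellMap_shellMap, Λ.inv_mul_mat, shellMap_one]
  have hsurj : Function.Surjective (shellMap m Λ.mat : (Fin n → ℝ) → Fin n → ℝ) := by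
    refine Function.RightInverse.surjective (g := shellMap m Λ.inv.mat) fun p => ?_
    rw [shellMap_shellMap, Λ.mat_mul_inv, shellMap_one]
  ext A hA
  rw [Measure.map_apply hmeas hA, shellMeasure, withDensity_apply _ (hmeas hA),
    withDensity_apply _ hA, ← lintegral_indicator (hmeas hA), ← lintegral_indicator hA]
  have h := lintegral_image_eq_lintegral_abs_det_fderiv_mul volume MeasurableSet.univ
    (fun p _ => (hasFDerivAt_shellMap (m := m) Λ.mat p).hasFDerivWithinAt) hinj.injOn
    (A.indicator fun p : Fin n → ℝ => ENNReal.ofReal (2 * energy m p)⁻¹)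
  rw [Set.image_univ, hsurj.range_eq, Measure.restrict_univ] at h
  rw [h]
  refine lintegral_congr fun p => ?_
  have hd : (Matrix.toLin' (shellJacobian m Λ.mat p)).toContinuousLinearMap.det
      = energy m (shellMap m Λ.mat p) / energy m p := by
    rw [← det_shellJacobian]
    exact LinearMap.det_toLin' _
  have hp0 := energy_pos (m := m) p
  have hq0 := energy_pos (m := m) (shellMap m Λ.mat p)
  rw [hd]
  by_cases hp : shellMap m Λ.mat p ∈ A
  · rw [Set.indicator_of_mem (show p ∈ shellMap m Λ.mat ⁻¹' A from hp),
      Set.indicator_of_mem hp, ← ENNReal.ofReal_mul (abs_nonneg _)]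
    congr 1
    rw [abs_of_pos (by positivity)]
    field_simp
  · rw [Set.indicator_of_notMem (show p ∉ shellMap m Λ.mat ⁻¹' A from hp),
      Set.indicator_of_notMem hp, mul_zero]

end OneParticleSpace

section OneParticleOperators

variable {n : ℕ} {m : ℝ}

/-- For `s = 1` and `s = -1` the functions `f⁺` and `f⁻` of spatial momenta,
`f^±(p) = ∫ f(x) exp(± i p·x) dx` with `p` on the upper mass shell. -/
def shellTransform (m s : ℝ) (f : 𝓢(Spacetime n, ℂ)) (p : Fin n → ℝ) : ℂ :=
  ∫ x, f x * Complex.exp (Complex.I * ((s * mink (shellPoint m p) x : ℝ) : ℂ))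

/-- A Schwartz function on Minkowski space, read on Euclidean space. -/
def toEuclidean (f : 𝓢(Spacetime n, ℂ)) : 𝓢(EuclideanSpace ℝ (Fin (n + 1)), ℂ) :=
  SchwartzMap.compCLMOfContinuousLinearEquiv ℂ (EuclideanSpace.equiv (Fin (n + 1)) ℝ) f

/-- The Fourier variable which belongs to a point of the mass shell. -/
def shellFreq (m s : ℝ) (p : Fin n → ℝ) : EuclideanSpace ℝ (Fin (n + 1)) :=
  WithLp.toLp 2 ((-(s / (2 * Real.pi))) • (metric n).mulVec (shellPoint m p))

theorem shellTransform_eq (s : ℝ) (f : 𝓢(Spacetime n, ℂ)) (p : Fin n → ℝ) :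
    shellTransform m s f p
      = FourierTransform.fourier (toEuclidean f) (shellFreq m s p) := by
  rw [SchwartzMap.fourier_coe, Real.fourier_eq', shellTransform,
    ← (PiLp.volume_preserving_ofLp (Fin (n + 1))).integral_comp
      (MeasurableEquiv.toLp 2 (Fin (n + 1) → ℝ)).symm.measurableEmbedding]
  refine integral_congr_ae (Eventually.of_forall fun x => ?_)
  have h1 : -2 * Real.pi * ⟪x, shellFreq m s p⟫_ℝ = s * mink (shellPoint m p) (WithLp.ofLp x) := by
    have : mink (shellPoint m p) (WithLp.ofLp x)
        = ∑ i, (metric n).mulVec (shellPoint m p) i * x i := by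
      simp [mink, metric, Matrix.mulVec_diagonal, Fin.sum_univ_succ, sub_eq_add_neg]
    rw [this]
    simp only [PiLp.inner_apply, shellFreq, Pi.smul_apply, smul_eq_mul, RCLike.inner_apply,
      conj_trivial, Finset.mul_sum]
    refine Finset.sum_congr rfl fun i _ => ?_
    field_simp
  simp only [h1, smul_eq_mul]
  rw [mul_comm, mul_comm Complex.I]
  rfl

theorem continuous_shellTransform (s : ℝ) (f : 𝓢(Spacetime n, ℂ)) :
    Continuous (shellTransform m s f) := by
  have h : shellTransform m s f
      = fun p => FourierTransform.fourier (toEuclidean f) (shellFreq m s p) :=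
    funext (shellTransform_eq s f)
  rw [h]
  refine (SchwartzMap.continuous _).comp ((PiLp.continuous_toLp 2 _).comp ?_)
  have h2 : Continuous fun p : Fin n → ℝ => (metric n).mulVec (shellPoint m p) :=
    continuous_const.matrix_mulVec continuous_shellPoint
  exact h2.const_smul (-(s / (2 * Real.pi)))

theorem norm_le_shellFreq {s : ℝ} (hs : |s| = 1) (p : Fin n → ℝ) :
    ‖p‖ ≤ 2 * Real.pi * ‖shellFreq m s p‖ := by
  refine (pi_norm_le_iff_of_nonneg (by positivity)).mpr fun i => ?_
  have h := PiLp.norm_apply_le (shellFreq m s p) i.succ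
  have h2 : ‖shellFreq m s p i.succ‖ = (2 * Real.pi)⁻¹ * ‖p i‖ := by
    simp [shellFreq, metric, Matrix.mulVec_diagonal, shellPoint, hs,
      abs_of_pos Real.pi_pos]
  rw [h2] at h
  have := mul_le_mul_of_nonneg_left h (show 0 ≤ 2 * Real.pi by positivity)
  rwa [← mul_assoc, mul_inv_cancel₀ (by positivity), one_mul] at this

theorem memLp_shellTransform [Fact (0 < m)] {s : ℝ} (hs : |s| = 1) (f : 𝓢(Spacetime n, ℂ)) :
    MemLp (shellTransform m s f) 2 (shellMeasure n m) := by
  have hm : 0 < m := Fact.out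
  have hvol : MemLp (shellTransform m s f) 2 volume := by
    rw [memLp_two_iff_integrable_sq_norm (continuous_shellTransform s f).aestronglyMeasurable]
    set g := FourierTransform.fourier (toEuclidean f) with hg
    obtain ⟨C, hC⟩ : ∃ C, ∀ ξ, (1 + ‖ξ‖) ^ (n + 1) * ‖g ξ‖ ≤ C := by
      have h := SchwartzMap.one_add_le_sup_seminorm_apply (𝕜 := ℝ) (m := (n + 1, 0))
        (k := n + 1) (n := 0) le_rfl le_rfl g
      simp only [norm_iteratedFDeriv_zero] at h
      exact ⟨_, h⟩
    have hC0 : 0 ≤ C := le_trans (by positivity) (hC 0)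
    have hint := (integrable_one_add_norm (E := Fin n → ℝ) (μ := volume) (r := (n : ℝ) + 1)
      (by simp)).const_mul (((2 * Real.pi) ^ (n + 1) * C) * C)
    refine hint.mono' ((continuous_shellTransform s f).norm.pow 2).aestronglyMeasurable
      (Eventually.of_forall fun p => ?_)
    rw [shellTransform_eq, ← hg, Real.norm_of_nonneg (by positivity)]
    set ξ := shellFreq m s p with hξ
    have hp := norm_le_shellFreq (m := m) hs p
    rw [← hξ] at hp
    have h2pi : 1 ≤ 2 * Real.pi := by linarith [Real.pi_gt_three]
    have h1 : ‖g ξ‖ ≤ C := by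
      refine le_trans ?_ (hC ξ)
      exact le_mul_of_one_le_left (norm_nonneg _)
        (one_le_pow₀ (by linarith [norm_nonneg ξ]))
    have h2 : (1 + ‖p‖) ^ (n + 1) * ‖g ξ‖ ≤ (2 * Real.pi) ^ (n + 1) * C := by
      have h3 : (1 + ‖p‖) ^ (n + 1) ≤ (2 * Real.pi * (1 + ‖ξ‖)) ^ (n + 1) :=
        pow_le_pow_left₀ (by positivity) (by linarith) _
      calc (1 + ‖p‖) ^ (n + 1) * ‖g ξ‖
          ≤ (2 * Real.pi * (1 + ‖ξ‖)) ^ (n + 1) * ‖g ξ‖ := by gcongr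
        _ = (2 * Real.pi) ^ (n + 1) * ((1 + ‖ξ‖) ^ (n + 1) * ‖g ξ‖) := by
          rw [mul_pow]
          ring
        _ ≤ _ := by
          gcongr
          exact hC ξ
    have h4 : (1 + ‖p‖) ^ (-((n : ℝ) + 1)) = ((1 + ‖p‖) ^ (n + 1))⁻¹ := by
      rw [Real.rpow_neg (by positivity)]
      norm_cast
    rw [h4, ← div_eq_mul_inv, le_div_iff₀ (by positivity)]
    calc ‖g ξ‖ ^ 2 * (1 + ‖p‖) ^ (n + 1) = ((1 + ‖p‖) ^ (n + 1) * ‖g ξ‖) * ‖g ξ‖ := by ring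
      _ ≤ _ := by gcongr
  have hle : shellMeasure n m ≤ ENNReal.ofReal (2 * m)⁻¹ • volume := by
    rw [← withDensity_const]
    refine withDensity_mono (Eventually.of_forall fun p => ENNReal.ofReal_le_ofReal ?_)
    have : m ≤ energy m p := by
      refine Real.le_sqrt_of_sq_le ?_
      have : 0 ≤ ∑ i, p i ^ 2 := Finset.sum_nonneg fun i _ => sq_nonneg _
      linarith
    gcongr
  exact (hvol.smul_measure ENNReal.ofReal_ne_top).mono_measure hle

/-- `f⁺` as a one-particle vector. -/
def plusVec (m : ℝ) [Fact (0 < m)] (f : 𝓢(Spacetime n, ℂ)) : OneParticle n m :=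
  (memLp_shellTransform (s := 1) (by simp) f).toLp _

/-- `f⁻` as a one-particle vector. -/
def minusVec (m : ℝ) [Fact (0 < m)] (f : 𝓢(Spacetime n, ℂ)) : OneParticle n m :=
  (memLp_shellTransform (s := -1) (by simp) f).toLp _

theorem norm_phase (t : ℝ) : ‖Complex.exp (Complex.I * (t : ℂ))‖ = 1 := by
  rw [mul_comm]
  exact Complex.norm_exp_ofReal_mul_I t

theorem memLp_phase {u : (Fin n → ℝ) → ℝ} (hu : Continuous u) (g : OneParticle n m) :
    MemLp (fun p => Complex.exp (Complex.I * (u p : ℂ)) * g p) 2 (shellMeasure n m) := by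
  have hc : Continuous fun p => Complex.exp (Complex.I * (u p : ℂ)) := by fun_prop
  refine (Lp.memLp g).of_le (hc.aestronglyMeasurable.mul (Lp.aestronglyMeasurable g))
    (Eventually.of_forall fun p => ?_)
  rw [norm_mul, norm_phase, one_mul]

/-- Multiplication by the phase `exp (i u(p))`, as a map. -/
def phaseFun {u : (Fin n → ℝ) → ℝ} (hu : Continuous u) (g : OneParticle n m) : OneParticle n m :=
  (memLp_phase hu g).toLp _

theorem phaseFun_coe {u : (Fin n → ℝ) → ℝ} (hu : Continuous u) (g : OneParticle n m) :
    phaseFun hu g =ᵐ[shellMeasure n m] fun p => Complex.exp (Complex.I * (u p : ℂ)) * g p :=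
  MemLp.coeFn_toLp _

theorem phaseFun_phaseFun {u v : (Fin n → ℝ) → ℝ} (hu : Continuous u) (hv : Continuous v)
    (h : ∀ p, u p + v p = 0) (g : OneParticle n m) : phaseFun hu (phaseFun hv g) = g := by
  refine Lp.ext ?_
  filter_upwards [phaseFun_coe hu (phaseFun hv g), phaseFun_coe hv g] with p h1 h2
  rw [h1, h2, ← mul_assoc, ← Complex.exp_add, ← mul_add, ← Complex.ofReal_add, h]
  simp

/-- Multiplication by the phase `exp (i u(p))`, as a unitary operator. -/
def phase {u : (Fin n → ℝ) → ℝ} (hu : Continuous u) : OneParticle n m ≃ₗᵢ[ℂ] OneParticle n m where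
  toFun := phaseFun hu
  map_add' g h := by
    refine Lp.ext ?_
    filter_upwards [phaseFun_coe hu (g + h), phaseFun_coe hu g, phaseFun_coe hu h,
      Lp.coeFn_add g h, Lp.coeFn_add (phaseFun hu g) (phaseFun hu h)] with p h1 h2 h3 h4 h5
    rw [h1, h5, Pi.add_apply, h2, h3, h4, Pi.add_apply, mul_add]
  map_smul' c g := by
    refine Lp.ext ?_
    filter_upwards [phaseFun_coe hu (c • g), phaseFun_coe hu g,
      Lp.coeFn_smul c g, Lp.coeFn_smul c (phaseFun hu g)] with p h1 h2 h3 h4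
    rw [h1, h3]
    simp only [RingHom.id_apply]
    rw [h4, Pi.smul_apply, Pi.smul_apply, h2, smul_eq_mul, smul_eq_mul]
    ring
  invFun := phaseFun hu.neg
  left_inv := phaseFun_phaseFun hu.neg hu (by simp)
  right_inv := phaseFun_phaseFun hu hu.neg (by simp)
  norm_map' g := by
    have h : ∀ᵐ p ∂shellMeasure n m, ‖phaseFun hu g p‖ = ‖g p‖ := by
      filter_upwards [phaseFun_coe hu g] with p h1
      rw [h1, norm_mul, norm_phase, one_mul]
    exact le_antisymm (Lp.norm_le_norm_of_ae_le (h.mono fun p hp => hp.le))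
      (Lp.norm_le_norm_of_ae_le (h.mono fun p hp => hp.ge))

theorem continuous_mink_shellPoint (y : Spacetime n) :
    Continuous fun p : Fin n → ℝ => mink (shellPoint m p) y := by
  have h := continuous_shellPoint (n := n) (m := m)
  have h' : ∀ i, Continuous fun p : Fin n → ℝ => shellPoint m p i :=
    fun i => (continuous_apply i).comp h
  unfold mink
  fun_prop

/-- The translations on the one-particle space, `g(p) ↦ exp(i p·y) g(p)`. -/
def translation₁ (m : ℝ) (y : Spacetime n) : OneParticle n m ≃ₗᵢ[ℂ] OneParticle n m :=
  phase (continuous_mink_shellPoint (m := m) y)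

/-- The Lorentz transformations on the one-particle space, `g(p) ↦ g(Λ⁻¹p)`. -/
def lorentz₁ (m : ℝ) [Fact (0 < m)] (Λ : ProperOrthochronous n) :
    OneParticle n m ≃ₗᵢ[ℂ] OneParticle n m :=
  LinearIsometryEquiv.ofSurjective
    (Lp.compMeasurePreservingₗᵢ ℂ (shellMap m Λ.inv.mat) (measurePreserving_shellMap Λ.inv))
    fun g => by
      refine ⟨Lp.compMeasurePreserving (shellMap m Λ.mat) (measurePreserving_shellMap Λ) g, ?_⟩
      refine Lp.ext ?_
      have h1 := Lp.coeFn_compMeasurePreserving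
        (Lp.compMeasurePreserving (shellMap m Λ.mat) (measurePreserving_shellMap Λ) g)
        (measurePreserving_shellMap Λ.inv)
      have h2 := (measurePreserving_shellMap (m := m) Λ.inv).quasiMeasurePreserving.ae
        (Lp.coeFn_compMeasurePreserving g (measurePreserving_shellMap Λ))
      filter_upwards [h1, h2] with p h1 h2
      refine h1.trans (h2.trans ?_)
      rw [Function.comp_apply, shellMap_shellMap, Λ.mat_mul_inv, shellMap_one]

/-- The space-time reflection on the one-particle space, the antiunitary operator of complex
conjugation `g ↦ conj g`. -/
def reflection₁ (n : ℕ) (m : ℝ) : OneParticle n m ≃ₛₗᵢ[starRingEnd ℂ] OneParticle n m where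
  toFun := star
  map_add' g h := by
    refine Lp.ext ?_
    filter_upwards [Lp.coeFn_star (g + h), Lp.coeFn_star g, Lp.coeFn_star h,
      Lp.coeFn_add g h, Lp.coeFn_add (star g) (star h)] with p h1 h2 h3 h4 h5
    rw [h1, h5, Pi.add_apply, h2, h3]
    simp only [Pi.star_apply]
    rw [h4, Pi.add_apply, star_add]
  map_smul' c g := by
    refine Lp.ext ?_
    filter_upwards [Lp.coeFn_star (c • g), Lp.coeFn_star g,
      Lp.coeFn_smul c g, Lp.coeFn_smul (conj c) (star g)] with p h1 h2 h3 h4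
    rw [h1, h4, Pi.smul_apply, h2]
    simp only [Pi.star_apply]
    rw [h3, Pi.smul_apply, star_smul]
    rfl
  invFun := star
  left_inv := star_star
  right_inv := star_star
  norm_map' g := by
    refine le_antisymm (Lp.norm_le_norm_of_ae_le ?_) (Lp.norm_le_norm_of_ae_le ?_)
    · filter_upwards [Lp.coeFn_star g] with p h1
      exact (congrArg norm h1).le.trans (norm_star _).le
    · filter_upwards [Lp.coeFn_star g] with p h1
      exact (norm_star _).ge.trans (congrArg norm h1).ge

end OneParticleOperators

section TestFunctions

variable {n : ℕ}

/-- A proper orthochronous Lorentz transformation as a linear automorphism of Minkowski space. -/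
def lorentzEquiv (Λ : ProperOrthochronous n) : Spacetime n ≃L[ℝ] Spacetime n :=
  (LinearEquiv.ofLinearMap (Matrix.mulVecLin Λ.mat) (Matrix.mulVecLin Λ.inv.mat)
    (by rw [← Matrix.mulVecLin_mul, Λ.mat_mul_inv, Matrix.mulVecLin_one])
    (by rw [← Matrix.mulVecLin_mul, Λ.inv_mul_mat, Matrix.mulVecLin_one])).toContinuousLinearEquiv

theorem lorentzEquiv_apply (Λ : ProperOrthochronous n) (z : Spacetime n) :
    lorentzEquiv Λ z = Λ.mat.mulVec z := rfl

/-- The test function `f ∘ (x, Λ)⁻¹`. -/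
def poincareTest (x : Spacetime n) (Λ : ProperOrthochronous n) (f : 𝓢(Spacetime n, ℂ)) :
    𝓢(Spacetime n, ℂ) :=
  SchwartzMap.compSubConstCLM ℂ x
    (SchwartzMap.compCLMOfContinuousLinearEquiv ℂ (lorentzEquiv Λ.inv) f)

theorem poincareTest_apply (x : Spacetime n) (Λ : ProperOrthochronous n)
    (f : 𝓢(Spacetime n, ℂ)) (z : Spacetime n) :
    poincareTest x Λ f z = f (Λ.inv.mat.mulVec (z - x)) := by
  simp [poincareTest, lorentzEquiv_apply]

/-- The complex conjugate of a test function. -/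
def conjTest (f : 𝓢(Spacetime n, ℂ)) : 𝓢(Spacetime n, ℂ) :=
  SchwartzMap.postcompCLM (𝕜 := ℝ) (Complex.conjCLE : ℂ →L[ℝ] ℂ) f

theorem conjTest_apply (f : 𝓢(Spacetime n, ℂ)) (z : Spacetime n) :
    conjTest f z = conj (f z) := by
  simp [conjTest]

/-- The test function `conj f ∘ (0, j)⁻¹` for the reflection `j x = -x`. -/
def reflectTest (f : 𝓢(Spacetime n, ℂ)) : 𝓢(Spacetime n, ℂ) :=
  SchwartzMap.compCLMOfContinuousLinearEquiv ℂ (ContinuousLinearEquiv.neg ℝ) (conjTest f)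

theorem reflectTest_apply (f : 𝓢(Spacetime n, ℂ)) (z : Spacetime n) :
    reflectTest f z = conj (f (-z)) := by
  simp [reflectTest, conjTest]

end TestFunctions

section WarpedConvolution

variable {n : ℕ} {F : Type*} [NormedAddCommGroup F] [InnerProductSpace ℂ F]

/-- The operator `U A U⁻¹` with domain `U (dom A)`, for `U` unitary or antiunitary. -/
def conjugate {σ : ℂ →+* ℂ} [RingHomInvPair σ σ]
    (U : F ≃ₛₗᵢ[σ] F) (A : F →ₗ.[ℂ] F) : F →ₗ.[ℂ] F where
  domain := A.domain.comap U.symm.toLinearEquiv.toLinearMap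
  toFun :=
    { toFun := fun Ψ => U (A ⟨U.symm Ψ, Ψ.2⟩)
      map_add' := fun Ψ Φ => by
        rw [← map_add, ← A.map_add]
        congr 2
        exact Subtype.ext (map_add U.symm _ _)
      map_smul' := fun c Ψ => by
        have h : (⟨U.symm ((c • Ψ : _) : F), (c • Ψ).2⟩ : A.domain)
            = σ c • ⟨U.symm (Ψ : F), Ψ.2⟩ := Subtype.ext (map_smulₛₗ U.symm c _)
        rw [h, A.map_smul, map_smulₛₗ, RingHomInvPair.comp_apply_eq, RingHom.id_apply] }

/-- The generator `A` of the one-parameter group `t ↦ W (t e_μ) = exp (i t A)`, on its natural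
domain. -/
def generator (W : Spacetime n → F ≃ₗᵢ[ℂ] F) (μ : Fin (n + 1)) : F →ₗ.[ℂ] F where
  domain :=
    { carrier := {Ψ | DifferentiableAt ℝ (fun t : ℝ => W (Pi.single μ t) Ψ) 0}
      zero_mem' := by simp
      add_mem' := fun {Ψ Φ} hΨ hΦ => by
        simp only [Set.mem_ofPred_eq, map_add] at *
        exact DifferentiableAt.fun_add hΨ hΦ
      smul_mem' := fun c Ψ hΨ => by
        simp only [Set.mem_ofPred_eq, map_smul] at *
        exact DifferentiableAt.fun_const_smul hΨ c }
  toFun :=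
    { toFun := fun Ψ => (-Complex.I) • deriv (fun t : ℝ => W (Pi.single μ t) (Ψ : F)) 0
      map_add' := fun Ψ Φ => by
        simp only [Submodule.coe_add, map_add]
        rw [deriv_fun_add Ψ.2 Φ.2, smul_add]
      map_smul' := fun c Ψ => by
        simp only [Submodule.coe_smul, map_smul, RingHom.id_apply]
        rw [deriv_fun_const_smul c Ψ.2, smul_comm] }

/-- `W y = exp (i y^μ X_μ)`: the strongly continuous unitary representation `W` of the translation
group has the generators `X_μ`. -/
structure IsExponential (X : Fin (n + 1) → (F →ₗ.[ℂ] F)) (W : Spacetime n → F ≃ₗᵢ[ℂ] F) : Prop where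
  map_add : ∀ y z Ψ, W (y + z) Ψ = W y (W z Ψ)
  continuous : ∀ Ψ, Continuous fun y => W y Ψ
  generator_eq : ∀ μ, generator W μ = X μ

open Classical in
/-- The unitary operators `exp (i y^μ X_μ)` (the identity if the `X_μ` are not the generators of a
strongly continuous unitary representation). -/
def expI (X : Fin (n + 1) → (F →ₗ.[ℂ] F)) : Spacetime n → F ≃ₗᵢ[ℂ] F :=
  if h : ∃ W, IsExponential X W then h.choose else fun _ => LinearIsometryEquiv.refl ℂ F

open Classical in
/-- `A Ψ`, set to `0` outside of the domain of `A`. -/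
def applyOrZero (A : F →ₗ.[ℂ] F) (Ψ : F) : F :=
  if h : Ψ ∈ A.domain then A ⟨Ψ, h⟩ else 0

theorem applyOrZero_of_mem (A : F →ₗ.[ℂ] F) {Ψ : F} (h : Ψ ∈ A.domain) :
    applyOrZero A Ψ = A ⟨Ψ, h⟩ :=
  dif_pos h

theorem applyOrZero_add (A : F →ₗ.[ℂ] F) {Ψ Φ : F} (h : Ψ ∈ A.domain) (h' : Φ ∈ A.domain) :
    applyOrZero A (Ψ + Φ) = applyOrZero A Ψ + applyOrZero A Φ := by
  rw [applyOrZero_of_mem A h, applyOrZero_of_mem A h',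
    applyOrZero_of_mem A (Submodule.add_mem _ h h')]
  exact A.map_add ⟨Ψ, h⟩ ⟨Φ, h'⟩

theorem applyOrZero_smul (A : F →ₗ.[ℂ] F) (c : ℂ) {Ψ : F} (h : Ψ ∈ A.domain) :
    applyOrZero A (c • Ψ) = c • applyOrZero A Ψ := by
  rw [applyOrZero_of_mem A h, applyOrZero_of_mem A (Submodule.smul_mem _ c h)]
  exact A.map_smul c ⟨Ψ, h⟩

/-- With `V(y) = exp (i y^μ X_μ)` and `β_b(A) = V(b) A V(b)⁻¹`, the integrand
`exp (-i x·y) χ(ε x, ε y) β_{θx}(A) V(y) Ψ` at `z = (x, y)`. -/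
def warpIntegrand (X : Fin (n + 1) → (F →ₗ.[ℂ] F)) (θ : Matrix (Fin (n + 1)) (Fin (n + 1)) ℝ)
    (A : F →ₗ.[ℂ] F) (χ : 𝓢(Spacetime n × Spacetime n, ℂ)) (ε : ℝ) (Ψ : F)
    (z : Spacetime n × Spacetime n) : F :=
  (Complex.exp (-Complex.I * (mink z.1 z.2 : ℂ)) * χ (ε • z)) •
    expI X (θ.mulVec z.1) (applyOrZero A ((expI X (θ.mulVec z.1)).symm (expI X z.2 Ψ)))

/-- `Φ` is the value on `Ψ` of the warped convolution of `A`, the oscillatory integral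
`(2π)^{-d} lim_{ε → 0} ∬ exp (-i x·y) χ(ε x, ε y) β_{θx}(A) V(y) Ψ dx dy`, which exists and does
not depend on the cut-off `χ`. -/
structure HasWarpedValue (X : Fin (n + 1) → (F →ₗ.[ℂ] F))
    (θ : Matrix (Fin (n + 1)) (Fin (n + 1)) ℝ) (A : F →ₗ.[ℂ] F) (Ψ Φ : F) : Prop where
  mem : Ψ ∈ A.domain
  mem_translate : ∀ x y : Spacetime n, (expI X (θ.mulVec x)).symm (expI X y Ψ) ∈ A.domain
  integrable : ∀ χ : 𝓢(Spacetime n × Spacetime n, ℂ), χ 0 = 1 → ∀ ε : ℝ, 0 < ε →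
    Integrable (warpIntegrand X θ A χ ε Ψ)
  tendsto : ∀ χ : 𝓢(Spacetime n × Spacetime n, ℂ), χ 0 = 1 →
    Tendsto (fun ε : ℝ => ((2 * (Real.pi : ℂ)) ^ (n + 1))⁻¹ • ∫ z, warpIntegrand X θ A χ ε Ψ z)
      (𝓝[>] 0) (𝓝 Φ)

theorem exists_cutoff (n : ℕ) : ∃ χ : 𝓢(Spacetime n × Spacetime n, ℂ), χ 0 = 1 := by
  let b : ContDiffBump (0 : Spacetime n × Spacetime n) := ⟨1, 2, one_pos, one_lt_two⟩
  have h1 : HasCompactSupport fun z => ((b z : ℝ) : ℂ) :=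
    b.hasCompactSupport.comp_left (g := fun t : ℝ => (t : ℂ)) (by simp)
  have h2 : ContDiff ℝ ((⊤ : ℕ∞) : WithTop ℕ∞) fun z => ((b z : ℝ) : ℂ) :=
    Complex.ofRealCLM.contDiff.comp b.contDiff
  refine ⟨h1.toSchwartzMap h2, ?_⟩
  simp [b.one_of_mem_closedBall (Metric.mem_closedBall_self b.rIn_pos.le)]

namespace HasWarpedValue

variable {X : Fin (n + 1) → (F →ₗ.[ℂ] F)} {θ : Matrix (Fin (n + 1)) (Fin (n + 1)) ℝ}
  {A : F →ₗ.[ℂ] F} {Ψ Ψ' Φ Φ' : F}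

theorem unique (h : HasWarpedValue X θ A Ψ Φ) (h' : HasWarpedValue X θ A Ψ Φ') : Φ = Φ' := by
  obtain ⟨χ, hχ⟩ := exists_cutoff n
  exact tendsto_nhds_unique (h.tendsto χ hχ) (h'.tendsto χ hχ)

theorem add (h : HasWarpedValue X θ A Ψ Φ) (h' : HasWarpedValue X θ A Ψ' Φ') :
    HasWarpedValue X θ A (Ψ + Ψ') (Φ + Φ') := by
  have hw : ∀ χ ε, warpIntegrand X θ A χ ε (Ψ + Ψ')
      = warpIntegrand X θ A χ ε Ψ + warpIntegrand X θ A χ ε Ψ' := by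
    intro χ ε
    ext1 z
    simp only [warpIntegrand, map_add, Pi.add_apply]
    rw [applyOrZero_add A (h.mem_translate z.1 z.2) (h'.mem_translate z.1 z.2), map_add,
      smul_add]
  refine ⟨Submodule.add_mem _ h.mem h'.mem, fun x y => ?_, fun χ hχ ε hε => ?_,
    fun χ hχ => ?_⟩
  · rw [map_add, map_add]
    exact Submodule.add_mem _ (h.mem_translate x y) (h'.mem_translate x y)
  · rw [hw]
    exact (h.integrable χ hχ ε hε).add (h'.integrable χ hχ ε hε)
  · refine ((h.tendsto χ hχ).add (h'.tendsto χ hχ)).congr' ?_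
    filter_upwards [self_mem_nhdsWithin] with ε hε
    rw [hw, ← smul_add]
    congr 1
    exact (integral_add (h.integrable χ hχ ε hε) (h'.integrable χ hχ ε hε)).symm

theorem smul (c : ℂ) (h : HasWarpedValue X θ A Ψ Φ) :
    HasWarpedValue X θ A (c • Ψ) (c • Φ) := by
  have hw : ∀ χ ε, warpIntegrand X θ A χ ε (c • Ψ) = c • warpIntegrand X θ A χ ε Ψ := by
    intro χ ε
    ext1 z
    rw [Pi.smul_apply, warpIntegrand, warpIntegrand, LinearIsometryEquiv.map_smul,
      LinearIsometryEquiv.map_smul, applyOrZero_smul A c (h.mem_translate z.1 z.2),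
      LinearIsometryEquiv.map_smul, smul_comm]
  refine ⟨Submodule.smul_mem _ c h.mem, fun x y => ?_, fun χ hχ ε hε => ?_, fun χ hχ => ?_⟩
  · rw [LinearIsometryEquiv.map_smul, LinearIsometryEquiv.map_smul]
    exact Submodule.smul_mem _ c (h.mem_translate x y)
  · rw [hw]
    exact (h.integrable χ hχ ε hε).smul c
  · refine ((h.tendsto χ hχ).const_smul c).congr fun ε => ?_
    rw [hw, smul_comm]
    congr 1
    exact (integral_smul c _).symm

theorem zero (X : Fin (n + 1) → (F →ₗ.[ℂ] F)) (θ : Matrix (Fin (n + 1)) (Fin (n + 1)) ℝ)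
    (A : F →ₗ.[ℂ] F) : HasWarpedValue X θ A 0 0 := by
  have h0 : applyOrZero A 0 = 0 := by
    rw [applyOrZero_of_mem A A.domain.zero_mem]
    exact A.map_zero
  have hw : ∀ χ ε, warpIntegrand X θ A χ ε 0 = 0 := by
    intro χ ε
    ext1 z
    simp only [warpIntegrand, map_zero, h0, smul_zero, Pi.zero_apply]
  refine ⟨Submodule.zero_mem _, fun x y => ?_, fun χ hχ ε hε => ?_, fun χ hχ => ?_⟩
  · rw [map_zero, map_zero]
    exact Submodule.zero_mem _
  · rw [hw]
    exact integrable_zero _ _ _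
  · simp only [hw, Pi.zero_apply, integral_zero, smul_zero]
    exact tendsto_const_nhds

end HasWarpedValue

/-- The warped convolution `A_{θ,X}` of `A`: its domain consists of the vectors in the domain of
`A` on which the defining oscillatory integral exists. -/
def warpedConvolution (X : Fin (n + 1) → (F →ₗ.[ℂ] F))
    (θ : Matrix (Fin (n + 1)) (Fin (n + 1)) ℝ) (A : F →ₗ.[ℂ] F) : F →ₗ.[ℂ] F where
  domain :=
    { carrier := {Ψ | ∃ Φ, HasWarpedValue X θ A Ψ Φ}
      zero_mem' := ⟨0, HasWarpedValue.zero X θ A⟩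
      add_mem' := fun ⟨_, h⟩ ⟨_, h'⟩ => ⟨_, h.add h'⟩
      smul_mem' := fun c _ ⟨_, h⟩ => ⟨_, h.smul c⟩ }
  toFun :=
    { toFun := fun Ψ => Ψ.2.choose
      map_add' := fun Ψ Φ => (Ψ + Φ).2.choose_spec.unique (Ψ.2.choose_spec.add Φ.2.choose_spec)
      map_smul' := fun c Ψ => (c • Ψ).2.choose_spec.unique (Ψ.2.choose_spec.smul c) }

end WarpedConvolution

section FieldOperators

variable {n : ℕ} {m : ℝ}

/-- The Bose Fock space of the scalar field of mass `m` in `n + 1` space-time dimensions. -/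
abbrev FieldSpace (n : ℕ) (m : ℝ) : Type := Fock (OneParticle n m)

/-- The representation `U(x, Λ)` of the proper orthochronous Poincaré group. -/
def poincare (m : ℝ) [Fact (0 < m)] (x : Spacetime n) (Λ : ProperOrthochronous n) :
    FieldSpace n m ≃ₗᵢ[ℂ] FieldSpace n m :=
  secondQuant ((lorentz₁ m Λ).trans (translation₁ m x))

/-- The antiunitary operator `U(0, j)` of the space-time reflection `j x = -x`. -/
def reflection (n : ℕ) (m : ℝ) : FieldSpace n m ≃ₛₗᵢ[starRingEnd ℂ] FieldSpace n m :=
  secondQuant (reflection₁ n m)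

/-- The energy-momentum operators `P_μ`, the self-adjoint generators of the translations
`U(y) = Γ(exp (i p·y)) = exp (i y^μ P_μ)`. -/
def momentum (n : ℕ) (m : ℝ) (μ : Fin (n + 1)) : FieldSpace n m →ₗ.[ℂ] FieldSpace n m :=
  generator (fun y => secondQuant (translation₁ m y)) μ

/-- The operators `X_μ = Γ(V⁻¹) P_μ Γ(V)`. -/
def deformOp (V : OneParticle n m ≃ₗᵢ[ℂ] OneParticle n m) (μ : Fin (n + 1)) :
    FieldSpace n m →ₗ.[ℂ] FieldSpace n m :=
  conjugate (secondQuant V.symm) (momentum n m μ)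

/-- The free scalar field `φ(f) = a(conj f⁻) + a*(f⁺)` on the vectors of finite particle number. -/
def freeField [Fact (0 < m)] (f : 𝓢(Spacetime n, ℂ)) : FieldSpace n m →ₗ.[ℂ] FieldSpace n m where
  domain := finiteParticle (OneParticle n m)
  toFun := annihilation (reflection₁ n m (minusVec m f)) + creation (plusVec m f)

/-- The deformed field operator `φ_{θ,X}(f)`, the warped convolution of the free field. -/
def deformedField [Fact (0 < m)] (X : Fin (n + 1) → (FieldSpace n m →ₗ.[ℂ] FieldSpace n m))
    (θ : Matrix (Fin (n + 1)) (Fin (n + 1)) ℝ) (f : 𝓢(Spacetime n, ℂ)) :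
    FieldSpace n m →ₗ.[ℂ] FieldSpace n m :=
  warpedConvolution X θ (freeField f)

/-- `θ` is skew-symmetric with respect to the Lorentzian scalar product, `x·(θy) = -(θx)·y`. -/
def IsMinkSkew (θ : Matrix (Fin (n + 1)) (Fin (n + 1)) ℝ) : Prop :=
  minkTranspose θ = -θ

/-- The map `γ_Λ(θ) = ± Λ θ Λᵀ`, with `+` for orthochronous and `-` for antichronous Lorentz
transformations; the transpose is the one with respect to the Lorentzian scalar product. -/
def gammaMap (M θ : Matrix (Fin (n + 1)) (Fin (n + 1)) ℝ) :
    Matrix (Fin (n + 1)) (Fin (n + 1)) ℝ :=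
  if 0 < M 0 0 then M * θ * minkTranspose M else -(M * θ * minkTranspose M)

/-- Covariance of `X` under the proper orthochronous Lorentz group,
`U(0, Λ) X^μ U(0, Λ)⁻¹ = (Λ⁻¹)^μ_ν X^ν`, in terms of the unitary operators `exp (i y·X)`:
`U(0, Λ) exp (i y·X) U(0, Λ)⁻¹ = exp (i (Λy)·X)`. -/
def IsLorentzCovariant [Fact (0 < m)]
    (X : Fin (n + 1) → (FieldSpace n m →ₗ.[ℂ] FieldSpace n m)) : Prop :=
  ∀ (Λ : ProperOrthochronous n) (y : Spacetime n) (Ψ : FieldSpace n m),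
    poincare m 0 Λ (expI X y ((poincare m 0 Λ).symm Ψ)) = expI X (Λ.mat.mulVec y) Ψ

/-- Covariance of `X` under the proper orthochronous Poincaré group,
`U(x, Λ) X^μ U(x, Λ)⁻¹ = (Λ⁻¹)^μ_ν X^ν`, in terms of the unitary operators `exp (i y·X)`. -/
def IsPoincareCovariant [Fact (0 < m)]
    (X : Fin (n + 1) → (FieldSpace n m →ₗ.[ℂ] FieldSpace n m)) : Prop :=
  ∀ (x : Spacetime n) (Λ : ProperOrthochronous n) (y : Spacetime n) (Ψ : FieldSpace n m),
    poincare m x Λ (expI X y ((poincare m x Λ).symm Ψ)) = expI X (Λ.mat.mulVec y) Ψ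

/-- Covariance of `X` under the space-time reflection `j y = -y`:
`U(0, j) exp (i y·X) U(0, j)⁻¹ = exp (i (j y)·X)`. -/
def IsReflectionCovariant (X : Fin (n + 1) → (FieldSpace n m →ₗ.[ℂ] FieldSpace n m)) : Prop :=
  ∀ (y : Spacetime n) (Ψ : FieldSpace n m),
    reflection n m (expI X y ((reflection n m).symm Ψ)) = expI X (-y) Ψ

end FieldOperators

section Wedges

variable {n : ℕ} {m : ℝ}

/-- The right wedge `W₁ = {x | x₁ > |x₀|}`. -/
def rightWedge (n : ℕ) : Set (Spacetime n) := {x | |x 0| < x 1}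

/-- The Lorentz transformations `Λ` and `j Λ = -Λ`, with `Λ` proper orthochronous. -/
def IsWedgeTransformation (M : Matrix (Fin (n + 1)) (Fin (n + 1)) ℝ) : Prop :=
  ∃ Λ : ProperOrthochronous n, M = Λ.mat ∨ M = -Λ.mat

/-- The wedges, the images of the right wedge under the proper orthochronous Lorentz group and the
space-time reflection. If the space dimension is at least `2`, then `-W₁` is the image of `W₁`
under a rotation, and these are the images under the proper orthochronous Lorentz group alone. -/
def wedges (n : ℕ) : Set (Set (Spacetime n)) :=
  {W | ∃ M, IsWedgeTransformation M ∧ W = M.mulVec '' rightWedge n}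

/-- The admissible matrices: the entries `(0, 1)` and `(1, 0)` are `l ≥ 0`, in dimension
`d = n + 1 = 4` the entries `(2, 3)` and `(3, 2)` are `e` and `-e`, all others are `0`. -/
def IsAdmissible (θ : Matrix (Fin (n + 1)) (Fin (n + 1)) ℝ) : Prop :=
  ∃ l e : ℝ, 0 ≤ l ∧ (n + 1 ≠ 4 → e = 0) ∧ ∀ i k : Fin (n + 1), θ i k =
    if (i.val = 0 ∧ k.val = 1) ∨ (i.val = 1 ∧ k.val = 0) then l
    else if i.val = 2 ∧ k.val = 3 then e
    else if i.val = 3 ∧ k.val = 2 then -e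
    else 0

open Classical in
/-- The matrix `Q(W)` which belongs to the wedge `W`, given by `Q(Λ W₁) = γ_Λ(θ)`. For admissible
`θ` it does not depend on the choice of `Λ`. -/
def wedgeMatrix (θ : Matrix (Fin (n + 1)) (Fin (n + 1)) ℝ) (W : Set (Spacetime n)) :
    Matrix (Fin (n + 1)) (Fin (n + 1)) ℝ :=
  if h : ∃ M, IsWedgeTransformation M ∧ W = M.mulVec '' rightWedge n then gammaMap h.choose θ
  else 0

/-- The family of fields `φ_W(f) = φ_{Q(W),X}(f)`. -/
def wedgeField [Fact (0 < m)] (X : Fin (n + 1) → (FieldSpace n m →ₗ.[ℂ] FieldSpace n m))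
    (θ : Matrix (Fin (n + 1)) (Fin (n + 1)) ℝ) (W : Set (Spacetime n))
    (f : 𝓢(Spacetime n, ℂ)) : FieldSpace n m →ₗ.[ℂ] FieldSpace n m :=
  deformedField X (wedgeMatrix θ W) f

/-- A family of fields, indexed by the wedges, which satisfies the domain and continuity
assumptions of the Wightman axioms on the vectors of finite particle number and which is covariant
under the Poincaré group and the space-time reflection. -/
structure IsWedgeCovariantField [Fact (0 < m)]
    (φ : Set (Spacetime n) → 𝓢(Spacetime n, ℂ) → (FieldSpace n m →ₗ.[ℂ] FieldSpace n m)) :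
    Prop where
  dense_domain : Dense (finiteParticle (OneParticle n m) : Set (FieldSpace n m))
  vacuum_mem : vacuum (OneParticle n m) ∈ finiteParticle (OneParticle n m)
  poincare_mem : ∀ x Λ, ∀ Ψ ∈ finiteParticle (OneParticle n m),
    poincare m x Λ Ψ ∈ finiteParticle (OneParticle n m)
  reflection_mem : ∀ Ψ ∈ finiteParticle (OneParticle n m),
    reflection n m Ψ ∈ finiteParticle (OneParticle n m)
  le_domain : ∀ W ∈ wedges n, ∀ f, finiteParticle (OneParticle n m) ≤ (φ W f).domain
  map_mem : ∀ W ∈ wedges n, ∀ f, ∀ Ψ : (φ W f).domain,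
    (Ψ : FieldSpace n m) ∈ finiteParticle (OneParticle n m) →
      φ W f Ψ ∈ finiteParticle (OneParticle n m)
  hermitian : ∀ W ∈ wedges n, ∀ f, ∀ (Ψ : (φ W f).domain) (Φ : (φ W (conjTest f)).domain),
    (Ψ : FieldSpace n m) ∈ finiteParticle (OneParticle n m) →
    (Φ : FieldSpace n m) ∈ finiteParticle (OneParticle n m) →
      ⟪(Φ : FieldSpace n m), φ W f Ψ⟫_ℂ = ⟪φ W (conjTest f) Φ, (Ψ : FieldSpace n m)⟫_ℂ
  tempered : ∀ W ∈ wedges n, ∀ Ψ ∈ finiteParticle (OneParticle n m),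
    ∃ T : 𝓢(Spacetime n, ℂ) →L[ℂ] FieldSpace n m,
      ∀ f, ∀ h : Ψ ∈ (φ W f).domain, T f = φ W f ⟨Ψ, h⟩
  poincare_covariant : ∀ W ∈ wedges n, ∀ x Λ f,
    conjugate (poincare m x Λ) (φ W f) = φ (Λ.mat.mulVec '' W) (poincareTest x Λ f)
  reflection_covariant : ∀ W ∈ wedges n, ∀ f,
    conjugate (reflection n m) (φ W f) = φ ((fun x => -x) '' W) (reflectTest f)

end Wedges

end WarpedField
end

open WarpedField

noncomputable section

/-! Through the isometry `V` the operators exp(iy·X) on the one-particle space become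
multiplications by exp(ip·y), so on each particle number the oscillatory integral reduces to a
scalar one. Write τ(y) for the one-particle translations. For a vector Ψ with k particles, the
rotated creation operator applied to the translated Ψ is, up to √(k+1) and symmetrization, the
operator τ(θx) ⊗ τ(y) ⊗ ⋯ ⊗ τ(y) applied to the fixed vector g ⊗ Ψ. Spectrally this is
multiplication by exp(i(x·a + y·b)) with a = θᵀp₀ and b = p₁ + ⋯ + p_k. The annihilation operator
gives τ(θx)⁻¹τ(y) ⊗ τ(y) ⊗ ⋯ on Ψ, followed by contraction with a fixed vector; there a = -θᵀp₀, and
b is the sum of all momenta.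

The scalar integral (2π)^{-d} ∬ exp(-ix·y) χ(εx, εy) exp(i(x·a + y·b)) dx dy tends to exp(ia·b) and
is bounded uniformly in ε, a and b: the substitution x → x/ε, y → a + εw turns it into exp(ia·b)
times an integral of the partial Fourier transform of χ, to which dominated convergence and Fourier
inversion apply (`oscIntegral_eq`, `exists_oscIntegral_bound`, `tendsto_oscIntegral`). By Fubini and
dominated convergence in L² the operator-valued integral converges strongly
(`IsSpectral.tendsto_integral`). No regularity of Ψ is needed, so the domain is all of the finite
particle vectors (`exists_twist`, `deformedField_domain`).

The deformed field is therefore an ordinary field operator with a phase operator inserted in front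
of the symmetrization or contraction. The phase operators do not depend on the test function, which
gives invariance of the domain and continuity in f. For skew θ one has θᵀp·p = 0, so the phases of
the two parts are complex conjugate, which gives hermiticity.

All covariance statements are a change of variables (x, y) → (Lx, By) in the oscillatory integral
(`HasWarpedValue.transport`, `conjugate_deformedField`): (1, 1) for the conjugated X, (Λ, Λ) for
covariant X, and (1, -1) for the reflection, where antilinearity conjugates exp(-ix·y). They rest on
the covariance of the free field and on the fact that generators determine the representation
(`IsExponential.unique`), which makes `expI` computable.

The map Q is well defined because a transformation ±Λ that maps the right wedge into itself splits
into a block on the (0,1)-plane and a block on the other coordinates; such matrices commute with an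
admissible θ up to exactly the sign in γ (`wedge_stabilizer_entries`, `commute_of_stabilizer`). -/

namespace WarpedField

open MeasureTheory Filter Topology
open scoped InnerProductSpace SchwartzMap ComplexConjugate ComplexOrder

/-! ### One-parameter unitary groups are determined by their generators. -/

section Generators

variable {n : ℕ} {F : Type*} [NormedAddCommGroup F] [InnerProductSpace ℂ F]
  {X : Fin (n + 1) → (F →ₗ.[ℂ] F)} {W W' : Spacetime n → F ≃ₗᵢ[ℂ] F}

namespace IsExponential

theorem map_zero (h : IsExponential X W) (Ψ : F) : W 0 Ψ = Ψ := by
  have := h.map_add 0 0 Ψ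
  rw [add_zero] at this
  exact ((W 0).injective this).symm

theorem map_single_add (h : IsExponential X W) (μ : Fin (n + 1)) (s t : ℝ) (Ψ : F) :
    W (Pi.single μ (s + t)) Ψ = W (Pi.single μ s) (W (Pi.single μ t) Ψ) := by
  rw [Pi.single_add, h.map_add]

/-- By the group law the orbit near time t is the image under the unitary at time t of the orbit
near 0, so differentiability at 0 propagates to all times. -/
theorem hasDerivAt_single (h : IsExponential X W) (μ : Fin (n + 1)) {Ψ : F}
    (hΨ : Ψ ∈ (generator W μ).domain) (t : ℝ) :
    HasDerivAt (fun s : ℝ => W (Pi.single μ s) Ψ)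
      (W (Pi.single μ t) (deriv (fun s : ℝ => W (Pi.single μ s) Ψ) 0)) t := by
  have h0 : HasDerivAt (fun s : ℝ => W (Pi.single μ s) Ψ)
      (deriv (fun s : ℝ => W (Pi.single μ s) Ψ) 0) (t - t) := by
    rw [sub_self]
    exact DifferentiableAt.hasDerivAt hΨ
  have h1 := h0.comp_sub_const t t
  have h2 := (((W (Pi.single μ t)).toContinuousLinearEquiv.toContinuousLinearMap).restrictScalars
    ℝ).hasFDerivAt.comp_hasDerivAt t h1
  refine h2.congr_of_eventuallyEq (Eventually.of_forall fun s => ?_)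
  change W (Pi.single μ s) Ψ = W (Pi.single μ t) (W (Pi.single μ (s - t)) Ψ)
  rw [← h.map_single_add, add_sub_cancel]

/-- The same derivative, read at time 0 of the orbit that starts at the evolved vector: the
generator commutes with its group and the group preserves its domain. -/
theorem hasDerivAt_map (h : IsExponential X W) (μ : Fin (n + 1)) {Ψ : F}
    (hΨ : Ψ ∈ (generator W μ).domain) (t : ℝ) :
    HasDerivAt (fun s : ℝ => W (Pi.single μ s) (W (Pi.single μ t) Ψ))
      (W (Pi.single μ t) (deriv (fun s : ℝ => W (Pi.single μ s) Ψ) 0)) 0 := by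
  have h1 := h.hasDerivAt_single μ hΨ (0 + t)
  have h2 := h1.comp_add_const 0 t
  rw [zero_add] at h2
  refine h2.congr_of_eventuallyEq (Eventually.of_forall fun s => ?_)
  exact (h.map_single_add μ s t Ψ).symm

theorem mem_domain_map (h : IsExponential X W) (μ : Fin (n + 1)) {Ψ : F}
    (hΨ : Ψ ∈ (generator W μ).domain) (t : ℝ) :
    W (Pi.single μ t) Ψ ∈ (generator W μ).domain :=
  (h.hasDerivAt_map μ hΨ t).differentiableAt

/-- A vector `u(t)` in the domain of the generator `A` with `u'(t) = i A u(t)` has constant norm. -/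
theorem re_inner_deriv (W : Spacetime n → F ≃ₗᵢ[ℂ] F) (h0 : ∀ Ψ, W 0 Ψ = Ψ) (μ : Fin (n + 1))
    {Ψ : F} (hΨ : Ψ ∈ (generator W μ).domain) :
    (⟪Ψ, deriv (fun s : ℝ => W (Pi.single μ s) Ψ) 0⟫_ℂ).re = 0 := by
  -- The product rule for the squared norm is real. Its inner product is the real part of the
  -- complex one, by definition.
  let : InnerProductSpace ℝ F := InnerProductSpace.rclikeToReal ℂ F
  have h1 := (DifferentiableAt.hasDerivAt hΨ).norm_sq
  have h2 : HasDerivAt (fun s : ℝ => ‖W (Pi.single μ s) Ψ‖ ^ 2) 0 0 := by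
    simp only [LinearIsometryEquiv.norm_map]
    exact hasDerivAt_const _ _
  have h3 := h1.unique h2
  rw [Pi.single_zero, h0] at h3
  have h4 : ⟪Ψ, deriv (fun s : ℝ => W (Pi.single μ s) Ψ) 0⟫_ℝ = 0 := by linarith
  exact h4

/-- Integrals of an orbit over [0, b] lie in the domain, because translating such an integral only
moves the endpoints and so is differentiable. Divided by b they converge to the initial vector as b
tends to 0. -/
theorem dense_domain [CompleteSpace F] (h : IsExponential X W) (μ : Fin (n + 1)) :
    Dense ((generator W μ).domain : Set F) := by
  intro Ψ
  have hc : Continuous fun s : ℝ => W (Pi.single μ s) Ψ :=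
    (h.continuous Ψ).comp (continuous_single (A := fun _ : Fin (n + 1) => ℝ) μ)
  have hint : ∀ a b : ℝ, IntervalIntegrable (fun s : ℝ => W (Pi.single μ s) Ψ) volume a b :=
    fun a b => hc.intervalIntegrable a b
  have hmem : ∀ b : ℝ, (∫ s in (0 : ℝ)..b, W (Pi.single μ s) Ψ) ∈ (generator W μ).domain := by
    intro b
    have e : (fun t : ℝ => W (Pi.single μ t) (∫ s in (0 : ℝ)..b, W (Pi.single μ s) Ψ))
        = fun t : ℝ => (∫ s in (0 : ℝ)..(b + t), W (Pi.single μ s) Ψ)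
          - ∫ s in (0 : ℝ)..t, W (Pi.single μ s) Ψ := by
      ext t
      have h1 := ((W (Pi.single μ t)).toContinuousLinearEquiv.toContinuousLinearMap
        ).intervalIntegral_comp_comm (hint 0 b)
      have h2 : W (Pi.single μ t) (∫ s in (0 : ℝ)..b, W (Pi.single μ s) Ψ)
          = ∫ s in (0 : ℝ)..b, W (Pi.single μ (s + t)) Ψ := by
        refine h1.symm.trans (intervalIntegral.integral_congr fun s _ => ?_)
        rw [add_comm s t, h.map_single_add]
        rfl
      rw [h2, intervalIntegral.integral_comp_add_right (fun s => W (Pi.single μ s) Ψ), zero_add,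
        intervalIntegral.integral_interval_sub_left (hint _ _) (hint _ _)]
    change DifferentiableAt ℝ _ 0
    rw [e]
    have hd : ∀ x : ℝ, DifferentiableAt ℝ (fun u : ℝ => ∫ s in (0 : ℝ)..u, W (Pi.single μ s) Ψ) x :=
      fun x => (hc.integral_hasStrictDerivAt 0 x).hasDerivAt.differentiableAt
    refine DifferentiableAt.sub ?_ (hd 0)
    exact (hd (b + 0)).comp (f := fun t : ℝ => b + t) 0 (by fun_prop)
  have hd := (hc.integral_hasStrictDerivAt 0 0).hasDerivAt
  rw [hasDerivAt_iff_tendsto_slope, Pi.single_zero, h.map_zero] at hd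
  refine mem_closure_of_tendsto hd (Eventually.of_forall fun t => ?_)
  rw [slope_def_module, intervalIntegral.integral_same, sub_zero, sub_zero]
  have := (generator W μ).domain.smul_mem ((t⁻¹ : ℝ) : ℂ) (hmem t)
  rwa [Complex.coe_smul] at this

/-- The difference of two orbits of a common domain vector stays in the domain and solves the same
evolution equation. By `re_inner_deriv` its norm is constant, and it vanishes at time 0. Density of
the domain and continuity do the rest. -/
theorem single_eq [CompleteSpace F] (h : IsExponential X W) (h' : IsExponential X W')
    (μ : Fin (n + 1)) (t : ℝ) : W (Pi.single μ t) = W' (Pi.single μ t) := by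
  have hg : generator W μ = generator W' μ := (h.generator_eq μ).trans (h'.generator_eq μ).symm
  have hdom : (generator W μ).domain = (generator W' μ).domain := by rw [hg]
  have hδ : ∀ Ψ ∈ (generator W μ).domain, deriv (fun s : ℝ => W (Pi.single μ s) Ψ) 0
      = deriv (fun s : ℝ => W' (Pi.single μ s) Ψ) 0 := by
    intro Ψ hΨ
    have h1 : generator W μ ⟨Ψ, hΨ⟩ = generator W' μ ⟨Ψ, hdom ▸ hΨ⟩ := by
      apply (LinearPMap.ext_iff.mp hg).2
    have h2 : (-Complex.I) • deriv (fun s : ℝ => W (Pi.single μ s) Ψ) 0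
        = (-Complex.I) • deriv (fun s : ℝ => W' (Pi.single μ s) Ψ) 0 := h1
    exact smul_right_injective F (neg_ne_zero.mpr Complex.I_ne_zero) h2
  have key : ∀ Ψ ∈ (generator W μ).domain, W (Pi.single μ t) Ψ = W' (Pi.single μ t) Ψ := by
    intro Ψ hΨ
    let : InnerProductSpace ℝ F := InnerProductSpace.rclikeToReal ℂ F
    set D : ℝ → F := fun s => W (Pi.single μ s) Ψ - W' (Pi.single μ s) Ψ with hD
    have hΨ' : Ψ ∈ (generator W' μ).domain := hdom ▸ hΨ
    have hmem : ∀ s, D s ∈ (generator W μ).domain := fun s =>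
      Submodule.sub_mem _ (h.mem_domain_map μ hΨ s) (hdom ▸ h'.mem_domain_map μ hΨ' s)
    have hderiv : ∀ s, HasDerivAt D (deriv (fun r : ℝ => W (Pi.single μ r) (D s)) 0) s := by
      intro s
      have h1 := (h.hasDerivAt_single μ hΨ s).sub (h'.hasDerivAt_single μ hΨ' s)
      refine h1.congr_deriv ?_
      have m1 := h.mem_domain_map μ hΨ s
      have m2 := h'.mem_domain_map μ hΨ' s
      have m2' : W' (Pi.single μ s) Ψ ∈ (generator W μ).domain := hdom ▸ m2
      simp only [hD, map_sub]
      rw [deriv_fun_sub m1 m2', hδ _ m2', (h.hasDerivAt_map μ hΨ s).deriv,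
        (h'.hasDerivAt_map μ hΨ' s).deriv]
    have hn : ∀ s, HasDerivAt (fun s => ‖D s‖ ^ 2) 0 s := by
      intro s
      refine (hderiv s).norm_sq.congr_deriv ?_
      have := re_inner_deriv W h.map_zero μ (hmem s)
      have h4 : ⟪D s, deriv (fun r : ℝ => W (Pi.single μ r) (D s)) 0⟫_ℝ = 0 := this
      rw [h4, mul_zero]
    have hconst := is_const_of_deriv_eq_zero (fun s => (hn s).differentiableAt)
      (fun s => (hn s).deriv) t 0
    have hD0 : D 0 = 0 := by simp [hD, h.map_zero, h'.map_zero]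
    simp only [hD0, norm_zero] at hconst
    have : D t = 0 := by
      rw [← norm_eq_zero]
      exact pow_eq_zero_iff (two_ne_zero) |>.mp (by simpa using hconst)
    exact sub_eq_zero.mp this
  ext Ψ
  refine congrFun (Continuous.ext_on (h.dense_domain μ) (W (Pi.single μ t)).continuous
    (W' (Pi.single μ t)).continuous key) Ψ

/-- A strongly continuous unitary representation is determined by its generators. -/
theorem unique [CompleteSpace F] (h : IsExponential X W) (h' : IsExponential X W') : W = W' := by
  -- A translation is the product of its components along the axes, where the previous lemma
  -- applies.
  have key : ∀ (y : Spacetime n) (s : Finset (Fin (n + 1))) (Ψ : F),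
      W (∑ μ ∈ s, Pi.single μ (y μ)) Ψ = W' (∑ μ ∈ s, Pi.single μ (y μ)) Ψ := by
    intro y s
    induction s using Finset.induction_on with
    | empty => intro Ψ; rw [Finset.sum_empty, h.map_zero, h'.map_zero]
    | insert a s ha ih =>
      intro Ψ
      rw [Finset.sum_insert ha, h.map_add, h'.map_add, ih, h.single_eq h']
  ext y Ψ
  have := key y Finset.univ Ψ
  rwa [Finset.univ_sum_single] at this

/-- The exponential is defined by a choice. Uniqueness makes the choice irrelevant, so any explicit
representation with the right generators may be used in its place. -/
theorem expI_eq [CompleteSpace F] (h : IsExponential X W) : expI X = W := by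
  have hex : ∃ W, IsExponential X W := ⟨W, h⟩
  rw [expI, dif_pos hex]
  exact hex.choose_spec.unique h

/-- A unitary operator neither creates nor destroys differentiability of an orbit, so the generators
match including their domains. -/
theorem conjugate (h : IsExponential X W) (U : F ≃ₗᵢ[ℂ] F) :
    IsExponential (fun μ => WarpedField.conjugate U (X μ))
      (fun y => (U.symm.trans (W y)).trans U) where
  map_add y z Ψ := by simp [h.map_add]
  continuous Ψ := U.continuous.comp (h.continuous _)
  generator_eq μ := by
    have hg := h.generator_eq μ
    rw [← hg]
    have hiff : ∀ Ψ : F, DifferentiableAt ℝ (fun t : ℝ => U (W (Pi.single μ t) (U.symm Ψ))) 0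
        ↔ DifferentiableAt ℝ (fun t : ℝ => W (Pi.single μ t) (U.symm Ψ)) 0 := by
      intro Ψ
      exact (U.toContinuousLinearEquiv.restrictScalars ℝ).comp_differentiableAt_iff
    refine LinearPMap.ext (Submodule.ext fun Ψ => hiff Ψ) ?_
    intro Ψ h1 h2
    have h3 : deriv (fun t : ℝ => U (W (Pi.single μ t) (U.symm Ψ))) 0
        = U (deriv (fun t : ℝ => W (Pi.single μ t) (U.symm Ψ)) 0) := by
      have hd : DifferentiableAt ℝ (fun t : ℝ => W (Pi.single μ t) (U.symm Ψ)) 0 := h2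
      exact ((((U.toContinuousLinearEquiv.toContinuousLinearMap).restrictScalars
        ℝ).hasFDerivAt.comp_hasDerivAt 0 hd.hasDerivAt)).deriv
    change (-Complex.I) • deriv (fun t : ℝ => U (W (Pi.single μ t) (U.symm Ψ))) 0
      = U ((-Complex.I) • deriv (fun t : ℝ => W (Pi.single μ t) (U.symm Ψ)) 0)
    rw [h3, map_smul]

end IsExponential

end Generators

/-! ### Change of variables in the oscillatory integral. -/

section Transport

variable {n : ℕ} {F : Type*} [NormedAddCommGroup F] [InnerProductSpace ℂ F]

theorem UnitaryScalar.apply_ofReal (σ : ℂ →+* ℂ) [h : UnitaryScalar σ] (r : ℝ) :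
    σ (r : ℂ) = r := by
  rcases h.eq_or_eq with rfl | rfl <;> simp

/-- A unitary or antiunitary operator as a real linear map. -/
def realLinear {σ : ℂ →+* ℂ} [RingHomInvPair σ σ] (U : F ≃ₛₗᵢ[σ] F) : F →L[ℝ] F :=
  (AddMonoidHomClass.toAddMonoidHom U).toRealLinearMap U.continuous

theorem realLinear_apply {σ : ℂ →+* ℂ} [RingHomInvPair σ σ] (U : F ≃ₛₗᵢ[σ] F) (v : F) :
    realLinear U v = U v := rfl

/-- The default value 0 off the domain is transported as well, so integrands can be compared without
membership conditions. -/
theorem applyOrZero_conjugate {σ : ℂ →+* ℂ} [RingHomInvPair σ σ] (U : F ≃ₛₗᵢ[σ] F)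
    (A : F →ₗ.[ℂ] F) (v : F) : applyOrZero (conjugate U A) (U v) = U (applyOrZero A v) := by
  have hiff : U v ∈ (conjugate U A).domain ↔ v ∈ A.domain := by
    change U.symm (U v) ∈ A.domain ↔ _
    rw [U.symm_apply_apply]
  by_cases hv : v ∈ A.domain
  · rw [applyOrZero_of_mem A hv, applyOrZero_of_mem _ (hiff.mpr hv)]
    change U (A ⟨U.symm (U v), _⟩) = _
    congr 2
    exact Subtype.ext (U.symm_apply_apply v)
  · rw [applyOrZero, applyOrZero, dif_neg hv, dif_neg (fun h => hv (hiff.mp h)), map_zero]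

/-- An antiunitary operator also conjugates the cut-off; the result must again be a Schwartz
function for independence of the cut-off to carry over. -/
theorem exists_schwartz_scalar (σ : ℂ →+* ℂ) [h : UnitaryScalar σ] {E : Type*}
    [NormedAddCommGroup E] [NormedSpace ℝ E] (χ : 𝓢(E, ℂ)) :
    ∃ χ' : 𝓢(E, ℂ), ∀ z, χ' z = σ (χ z) := by
  rcases h.eq_or_eq with rfl | rfl
  · exact ⟨χ, fun _ => rfl⟩
  · exact ⟨SchwartzMap.postcompCLM (𝕜 := ℝ) (Complex.conjCLE : ℂ →L[ℝ] ℂ) χ, fun z => by simp⟩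

/-- Transport of the value of a warped convolution by a unitary or antiunitary operator which
intertwines the two representations of the translations. -/
theorem HasWarpedValue.transport [CompleteSpace F] {σ : ℂ →+* ℂ} [UnitaryScalar σ]
    [RingHomInvPair σ σ]
    {X X' : Fin (n + 1) → (F →ₗ.[ℂ] F)} {θ θ' : Matrix (Fin (n + 1)) (Fin (n + 1)) ℝ}
    {A : F →ₗ.[ℂ] F} {Ψ Φ : F} (h : HasWarpedValue X θ A Ψ Φ) (U : F ≃ₛₗᵢ[σ] F)
    (L B : Spacetime n ≃L[ℝ] Spacetime n)
    (hB : ∀ y v, U (expI X y v) = expI X' (B y) (U v))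
    (hθ : ∀ x, θ'.mulVec (L x) = B (θ.mulVec x))
    (hmp : MeasurePreserving (L.prodCongr B : Spacetime n × Spacetime n → _))
    (hphase : ∀ x y, σ (Complex.exp (-Complex.I * (mink x y : ℂ)))
      = Complex.exp (-Complex.I * (mink (L x) (B y) : ℂ))) :
    HasWarpedValue X' θ' (conjugate U A) (U Ψ) (U Φ) := by
  have hBs : ∀ y v, (expI X' (B y)).symm (U v) = U ((expI X y).symm v) := by
    intro y v
    rw [LinearIsometryEquiv.symm_apply_eq, ← hB, LinearIsometryEquiv.apply_symm_apply]
  have hσ : ∀ c : ℂ, σ (σ c) = c := fun c => RingHomInvPair.comp_apply_eq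
  have hemb : MeasurableEmbedding (L.prodCongr B : Spacetime n × Spacetime n → _) :=
    (L.prodCongr B).toHomeomorph.measurableEmbedding
  -- Each cut-off of the new integral comes from a cut-off of the old one, pulled back by L × B and
  -- composed with σ. With it the two integrands agree pointwise after the substitution; σ applied
  -- twice cancels.
  have hχ : ∀ χ' : 𝓢(Spacetime n × Spacetime n, ℂ), χ' 0 = 1 →
      ∃ χ : 𝓢(Spacetime n × Spacetime n, ℂ), χ 0 = 1 ∧ ∀ ε z,
        warpIntegrand X' θ' (conjugate U A) χ' ε (U Ψ) (L.prodCongr B z)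
          = realLinear U (warpIntegrand X θ A χ ε Ψ z) := by
    intro χ' h0
    obtain ⟨χ, hχ⟩ := exists_schwartz_scalar σ
      (SchwartzMap.compCLMOfContinuousLinearEquiv ℂ (L.prodCongr B) χ')
    refine ⟨χ, ?_, fun ε z => ?_⟩
    · rw [hχ, SchwartzMap.compCLMOfContinuousLinearEquiv_apply, Function.comp_apply, map_zero, h0,
        map_one]
    have e1 : σ (χ (ε • z)) = χ' (ε • (L.prodCongr B z)) := by
      rw [hχ, hσ, ← map_smul (L.prodCongr B)]
      rfl
    have e2 : (L.prodCongr B z) = (L z.1, B z.2) := rfl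
    rw [realLinear_apply, warpIntegrand, warpIntegrand, map_smulₛₗ U, map_mul σ, hphase, e1, e2]
    dsimp only
    rw [hθ, ← hB, hBs, applyOrZero_conjugate, ← hB]
  -- The normalization is real and hence fixed by σ.
  have hc : ((2 * (Real.pi : ℂ)) ^ (n + 1))⁻¹ = ((((2 * Real.pi) ^ (n + 1))⁻¹ : ℝ) : ℂ) := by
    push_cast
    rfl
  refine ⟨?_, fun x y => ?_, fun χ' h0 ε hε => ?_, fun χ' h0 => ?_⟩
  · change U.symm (U Ψ) ∈ A.domain
    rw [U.symm_apply_apply]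
    exact h.mem
  -- The point (x, y) is the image under L × B of the point with coordinates L⁻¹x and B⁻¹y, where
  -- membership is known.
  · have hx := hθ (L.symm x)
    have hy := hB (B.symm y) Ψ
    rw [ContinuousLinearEquiv.apply_symm_apply] at hx hy
    change U.symm _ ∈ A.domain
    rw [hx, ← hy, hBs, U.symm_apply_apply]
    exact h.mem_translate _ _
  · obtain ⟨χ, h1, hw⟩ := hχ χ' h0
    rw [← hmp.integrable_comp_emb hemb]
    refine ((realLinear U).integrable_comp (h.integrable χ h1 ε hε)).congr
      (Eventually.of_forall fun z => (hw ε z).symm)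
  · obtain ⟨χ, h1, hw⟩ := hχ χ' h0
    refine ((U.continuous.tendsto Φ).comp (h.tendsto χ h1)).congr' ?_
    filter_upwards [self_mem_nhdsWithin] with ε hε
    rw [← hmp.integral_comp hemb]
    simp only [hw]
    rw [(realLinear U).integral_comp_comm (h.integrable χ h1 ε hε), Function.comp_apply,
      map_smulₛₗ, hc, UnitaryScalar.apply_ofReal, realLinear_apply]

theorem warpedConvolution_apply {X : Fin (n + 1) → (F →ₗ.[ℂ] F)}
    {θ : Matrix (Fin (n + 1)) (Fin (n + 1)) ℝ} {A : F →ₗ.[ℂ] F} {Ψ Φ : F}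
    (h : HasWarpedValue X θ A Ψ Φ) (hΨ : Ψ ∈ (warpedConvolution X θ A).domain) :
    warpedConvolution X θ A ⟨Ψ, hΨ⟩ = Φ :=
  (Exists.choose_spec hΨ).unique h

end Transport

/-! ### Finite particle vectors and operators that change the particle number by one. -/

section FockOperators

variable {H : Type*} [NormedAddCommGroup H] [InnerProductSpace ℂ H]

/-- The component `T ⊗ ⋯ ⊗ T` of the second quantization on the `k`-particle Bose space. -/
def symMap {σ : ℂ →+* ℂ} [UnitaryScalar σ] (T : H →ₛₗᵢ[σ] H) (k : ℕ) (u : symPow H k) :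
    symPow H k :=
  ⟨tensorMap T k u, tensorMap_mem_symPow T u.2⟩

theorem secondQuant_apply {σ : ℂ →+* ℂ} [UnitaryScalar σ] [RingHomInvPair σ σ] (T : H ≃ₛₗᵢ[σ] H)
    (Ψ : Fock H) (k : ℕ) : secondQuant T Ψ k = symMap T.toLinearIsometry k (Ψ k) := rfl

theorem secondQuant_symm {σ : ℂ →+* ℂ} [UnitaryScalar σ] [RingHomInvPair σ σ] (T : H ≃ₛₗᵢ[σ] H) :
    (secondQuant T).symm = secondQuant T.symm := rfl

theorem secondQuant_trans (S T : H ≃ₗᵢ[ℂ] H) :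
    (secondQuant S).trans (secondQuant T) = secondQuant (S.trans T) := by
  ext Ψ : 1
  refine fock_ext fun k => ?_
  have h : (tensorMap T.toLinearIsometry k).comp (tensorMap S.toLinearIsometry k)
      = tensorMap (S.trans T).toLinearIsometry k :=
    tensor_hom_ext fun x => by simp [tensorMap_tensor]
  exact congrArg (fun A => A (Ψ k : TensorPow H k)) h

theorem symMap_single_zero {σ : ℂ →+* ℂ} [UnitaryScalar σ] (T : H →ₛₗᵢ[σ] H) (k : ℕ) :
    symMap T k 0 = 0 :=
  Subtype.ext (map_zero _)

theorem secondQuant_mem {σ : ℂ →+* ℂ} [UnitaryScalar σ] [RingHomInvPair σ σ] (T : H ≃ₛₗᵢ[σ] H)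
    {Ψ : Fock H} (h : Ψ ∈ finiteParticle H) : secondQuant T Ψ ∈ finiteParticle H := by
  obtain ⟨N, hN⟩ := h
  exact ⟨N, fun k hk => by rw [secondQuant_apply, hN k hk, symMap_single_zero]⟩

theorem secondQuant_mem_iff {σ : ℂ →+* ℂ} [UnitaryScalar σ] [RingHomInvPair σ σ]
    (T : H ≃ₛₗᵢ[σ] H) {Ψ : Fock H} : secondQuant T Ψ ∈ finiteParticle H ↔ Ψ ∈ finiteParticle H := by
  refine ⟨fun h => ?_, secondQuant_mem T⟩
  have := secondQuant_mem T.symm h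
  rwa [← secondQuant_symm, LinearIsometryEquiv.symm_apply_apply] at this

/-- The inclusion of the `k`-particle space. -/
def fockSingle (H : Type*) [NormedAddCommGroup H] [InnerProductSpace ℂ H] (k : ℕ) :
    symPow H k →L[ℂ] Fock H :=
  lp.singleContinuousLinearMap ℂ (fun k : ℕ => symPow H k) 2 k

theorem fockSingle_self (k : ℕ) (u : symPow H k) : fockSingle H k u k = u :=
  lp.single_apply_self (E := fun k : ℕ => symPow H k) 2 k u

theorem fockSingle_ne {k j : ℕ} (u : symPow H k) (h : j ≠ k) : fockSingle H k u j = 0 :=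
  lp.single_apply_ne (E := fun k : ℕ => symPow H k) 2 k u h

theorem fockSingle_mem (k : ℕ) (u : symPow H k) : fockSingle H k u ∈ finiteParticle H :=
  ⟨k + 1, fun j hj => fockSingle_ne u (by omega)⟩

theorem secondQuant_fockSingle {σ : ℂ →+* ℂ} [UnitaryScalar σ] [RingHomInvPair σ σ]
    (T : H ≃ₛₗᵢ[σ] H) (k : ℕ) (u : symPow H k) :
    secondQuant T (fockSingle H k u) = fockSingle H k (symMap T.toLinearIsometry k u) := by
  refine lp.ext (funext fun j => ?_)
  rw [secondQuant_apply]
  by_cases h : j = k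
  · subst h
    rw [fockSingle_self, fockSingle_self]
  · rw [fockSingle_ne _ h, fockSingle_ne _ h, symMap_single_zero]

theorem eq_sum_fockSingle {Ψ : Fock H} {N : ℕ} (h : ∀ k, N ≤ k → Ψ k = 0) :
    Ψ = ∑ k ∈ Finset.range N, fockSingle H k (Ψ k) := by
  refine lp.ext (funext fun j => ?_)
  rw [lp.coeFn_sum, Finset.sum_apply]
  by_cases hj : j < N
  · rw [Finset.sum_eq_single_of_mem j (Finset.mem_range.mpr hj)
      fun k _ hk => fockSingle_ne _ (Ne.symm hk), fockSingle_self]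
  · rw [h j (not_lt.mp hj)]
    refine (Finset.sum_eq_zero fun k hk => fockSingle_ne _ ?_).symm
    rintro rfl
    exact hj (Finset.mem_range.mp hk)

/-- Such a vector is the finite sum of its components, so additive statements need proof only at
fixed particle number. The predicate takes the membership proof because the field operators act on
the subtype. -/
theorem finiteParticle_induction {p : ∀ Ψ : Fock H, Ψ ∈ finiteParticle H → Prop}
    (zero : p 0 (Submodule.zero_mem _))
    (add : ∀ Ψ Φ hΨ hΦ, p Ψ hΨ → p Φ hΦ → p (Ψ + Φ) (Submodule.add_mem _ hΨ hΦ))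
    (single : ∀ k u, p (fockSingle H k u) (fockSingle_mem k u))
    {Ψ : Fock H} (hΨ : Ψ ∈ finiteParticle H) : p Ψ hΨ := by
  have key : ∀ s : Finset ℕ, ∃ h, p (∑ k ∈ s, fockSingle H k (Ψ k)) h := by
    intro s
    induction s using Finset.induction_on with
    | empty => exact ⟨_, zero⟩
    | insert a s ha ih =>
      obtain ⟨h, ih⟩ := ih
      rw [Finset.sum_insert ha]
      exact ⟨_, add _ _ _ _ (single a _) ih⟩
  obtain ⟨N, hN⟩ := id hΨ
  obtain ⟨h, hp⟩ := key (Finset.range N)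
  have e := eq_sum_fockSingle hN
  revert hΨ
  rw [e]
  exact fun _ => hp

theorem dense_finiteParticle : Dense (finiteParticle H : Set (Fock H)) := by
  intro Ψ
  refine mem_closure_of_tendsto (lp.hasSum_single (by simp) Ψ) (Eventually.of_forall fun s => ?_)
  exact Submodule.sum_mem _ fun k _ => fockSingle_mem k (Ψ k)

theorem vacuum_mem_finiteParticle : vacuum H ∈ finiteParticle H := fockSingle_mem 0 _

/-- Pointwise limits of uniformly bounded continuous families are continuous. -/
theorem continuous_apply_of_dense {K α : Type*} [NormedAddCommGroup K] [InnerProductSpace ℂ K]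
    [TopologicalSpace α] (S : α → K ≃ₗᵢ[ℂ] K) {D : Set K} (hD : Dense D)
    (h : ∀ v ∈ D, Continuous fun a => S a v) (v : K) : Continuous fun a => S a v := by
  refine continuous_of_uniform_approx_of_continuous fun u hu => ?_
  obtain ⟨ε, hε, hu⟩ := Metric.mem_uniformity_dist.mp hu
  obtain ⟨w, hw, hd⟩ := hD.exists_dist_lt v hε
  exact ⟨fun a => S a w, h w hw, fun a => hu (by rwa [(S a).isometry.dist_eq])⟩

/-- The operators are isometric, so strong continuity passes from the dense finite particle vectors
to the whole space; on those it is a statement about single tensor powers. -/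
theorem continuous_secondQuant {α : Type*} [TopologicalSpace α] (S : α → H ≃ₗᵢ[ℂ] H)
    (h : ∀ k (u : TensorPow H k), Continuous fun a => tensorMap (S a).toLinearIsometry k u)
    (Ψ : Fock H) : Continuous fun a => secondQuant (S a) Ψ := by
  refine continuous_apply_of_dense (fun a => secondQuant (S a)) dense_finiteParticle
    (fun Ψ hΨ => ?_) Ψ
  induction hΨ using finiteParticle_induction with
  | zero => simpa using continuous_const
  | add Ψ Φ _ _ hΨ hΦ =>
    simp only [map_add]
    exact hΨ.add hΦ
  | single k u =>
    simp only [secondQuant_fockSingle]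
    exact (fockSingle H k).continuous.comp ((h k u).subtype_mk _)

/-- The operator which raises the particle number by one, with components `C k`. -/
def raiseOp (C : ∀ k, symPow H k →L[ℂ] symPow H (k + 1)) : finiteParticle H →ₗ[ℂ] Fock H where
  toFun Ψ := ⟨fun | 0 => 0 | k + 1 => C k ((Ψ : Fock H) k), by
    obtain ⟨N, hN⟩ := Ψ.2
    refine memℓp_of_finite (N := N + 1) fun k hk => ?_
    obtain ⟨j, rfl⟩ : ∃ j, k = j + 1 := ⟨k - 1, by omega⟩
    simp [hN j (by omega)]⟩
  map_add' Ψ Φ := by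
    refine fock_ext fun k => congrArg Subtype.val ?_
    cases k with
    | zero => exact (add_zero _).symm
    | succ k => exact map_add (C k) _ _
  map_smul' c Ψ := by
    refine fock_ext fun k => congrArg Subtype.val ?_
    cases k with
    | zero => exact (smul_zero c).symm
    | succ k => exact map_smul (C k) _ _

/-- The operator which lowers the particle number by one, with components `A k`. -/
def lowerOp (A : ∀ k, symPow H (k + 1) →L[ℂ] symPow H k) : finiteParticle H →ₗ[ℂ] Fock H where
  toFun Ψ := ⟨fun k => A k ((Ψ : Fock H) (k + 1)), by
    obtain ⟨N, hN⟩ := Ψ.2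
    refine memℓp_of_finite (N := N) fun k hk => ?_
    simp [hN (k + 1) (by omega)]⟩
  map_add' Ψ Φ := fock_ext fun k => congrArg Subtype.val (map_add (A k) _ _)
  map_smul' c Ψ := fock_ext fun k => congrArg Subtype.val (map_smul (A k) _ _)

variable (C : ∀ k, symPow H k →L[ℂ] symPow H (k + 1))
  (A : ∀ k, symPow H (k + 1) →L[ℂ] symPow H k)

theorem raiseOp_zero (Ψ : finiteParticle H) : raiseOp C Ψ 0 = 0 := rfl

theorem raiseOp_succ (Ψ : finiteParticle H) (k : ℕ) :
    raiseOp C Ψ (k + 1) = C k ((Ψ : Fock H) k) := rfl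

theorem lowerOp_apply (Ψ : finiteParticle H) (k : ℕ) :
    lowerOp A Ψ k = A k ((Ψ : Fock H) (k + 1)) := rfl

theorem raiseOp_mem (Ψ : finiteParticle H) : raiseOp C Ψ ∈ finiteParticle H := by
  obtain ⟨N, hN⟩ := Ψ.2
  refine ⟨N + 1, fun k hk => ?_⟩
  obtain ⟨j, rfl⟩ : ∃ j, k = j + 1 := ⟨k - 1, by omega⟩
  rw [raiseOp_succ, hN j (by omega), map_zero]

theorem lowerOp_mem (Ψ : finiteParticle H) : lowerOp A Ψ ∈ finiteParticle H := by
  obtain ⟨N, hN⟩ := Ψ.2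
  exact ⟨N, fun k hk => by rw [lowerOp_apply, hN (k + 1) (by omega), map_zero]⟩

theorem raiseOp_fockSingle (k : ℕ) (u : symPow H k) :
    raiseOp C ⟨fockSingle H k u, fockSingle_mem k u⟩ = fockSingle H (k + 1) (C k u) := by
  refine lp.ext (funext fun j => ?_)
  cases j with
  | zero => rw [raiseOp_zero, fockSingle_ne _ (by omega)]
  | succ j =>
    rw [raiseOp_succ]
    by_cases h : j = k
    · subst h
      rw [fockSingle_self, fockSingle_self]
    · rw [fockSingle_ne _ h, fockSingle_ne _ (by omega), map_zero]

theorem lowerOp_fockSingle_zero (u : symPow H 0) :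
    lowerOp A ⟨fockSingle H 0 u, fockSingle_mem 0 u⟩ = 0 := by
  refine lp.ext (funext fun j => ?_)
  rw [lowerOp_apply, fockSingle_ne _ (by omega), map_zero]
  rfl

theorem lowerOp_fockSingle_succ (k : ℕ) (u : symPow H (k + 1)) :
    lowerOp A ⟨fockSingle H (k + 1) u, fockSingle_mem (k + 1) u⟩ = fockSingle H k (A k u) := by
  refine lp.ext (funext fun j => ?_)
  rw [lowerOp_apply]
  by_cases h : j = k
  · subst h
    rw [fockSingle_self, fockSingle_self]
  · rw [fockSingle_ne _ h, fockSingle_ne _ (by omega), map_zero]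

/-- Free and deformed fields both have the form lowering plus raising operator and differ only in
the components, so the general facts on such operators serve both. -/
theorem creation_eq_raiseOp (h : H) : creation h = raiseOp (creationPart h) := by
  refine LinearMap.ext fun Ψ => lp.ext (funext fun j => ?_)
  cases j <;> rfl

theorem annihilation_eq_lowerOp (h : H) : annihilation h = lowerOp (annihilationPart h) := rfl

theorem secondQuant_raiseOp {σ : ℂ →+* ℂ} [UnitaryScalar σ] [RingHomInvPair σ σ]
    (T : H ≃ₛₗᵢ[σ] H) {C C' : ∀ k, symPow H k →L[ℂ] symPow H (k + 1)}
    (h : ∀ k u, symMap T.toLinearIsometry (k + 1) (C k u) = C' k (symMap T.toLinearIsometry k u))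
    (Ψ : finiteParticle H) :
    secondQuant T (raiseOp C Ψ) = raiseOp C' ⟨secondQuant T Ψ, secondQuant_mem T Ψ.2⟩ := by
  refine lp.ext (funext fun j => ?_)
  cases j with
  | zero => rw [secondQuant_apply, raiseOp_zero, raiseOp_zero, symMap_single_zero]
  | succ j => rw [secondQuant_apply, raiseOp_succ, raiseOp_succ, h, secondQuant_apply]

theorem secondQuant_lowerOp {σ : ℂ →+* ℂ} [UnitaryScalar σ] [RingHomInvPair σ σ]
    (T : H ≃ₛₗᵢ[σ] H) {A A' : ∀ k, symPow H (k + 1) →L[ℂ] symPow H k}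
    (h : ∀ k u, symMap T.toLinearIsometry k (A k u) = A' k (symMap T.toLinearIsometry (k + 1) u))
    (Ψ : finiteParticle H) :
    secondQuant T (lowerOp A Ψ) = lowerOp A' ⟨secondQuant T Ψ, secondQuant_mem T Ψ.2⟩ := by
  refine lp.ext (funext fun j => ?_)
  rw [secondQuant_apply, lowerOp_apply, lowerOp_apply, h, secondQuant_apply]

/-- Raising and lowering operators with adjoint components are formally adjoint. -/
theorem inner_raiseOp (Φ Ψ : finiteParticle H) :
    ⟪(Φ : Fock H), raiseOp C Ψ⟫_ℂ
      = ⟪lowerOp (fun k => ContinuousLinearMap.adjoint (C k)) Φ, (Ψ : Fock H)⟫_ℂ := by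
  rw [lp.inner_eq_tsum, lp.inner_eq_tsum,
    (lp.summable_inner (𝕜 := ℂ) (Φ : Fock H) (raiseOp C Ψ)).tsum_eq_zero_add, raiseOp_zero,
    inner_zero_right, zero_add]
  refine tsum_congr fun k => ?_
  rw [raiseOp_succ, lowerOp_apply, ContinuousLinearMap.adjoint_inner_left]

theorem inner_lowerOp (Φ Ψ : finiteParticle H) :
    ⟪(Φ : Fock H), lowerOp (fun k => ContinuousLinearMap.adjoint (C k)) Ψ⟫_ℂ
      = ⟪raiseOp C Φ, (Ψ : Fock H)⟫_ℂ := by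
  rw [← inner_conj_symm, ← inner_raiseOp, inner_conj_symm]

end FockOperators

/-! ### Second quantization intertwines creation and annihilation operators. -/

section Covariance

variable {H : Type*} [NormedAddCommGroup H] [InnerProductSpace ℂ H]

theorem tensorMap_symm_apply {σ : ℂ →+* ℂ} [UnitaryScalar σ] [RingHomInvPair σ σ]
    (T : H ≃ₛₗᵢ[σ] H) {k : ℕ} (u : TensorPow H k) :
    tensorMap T.toLinearIsometry k (tensorMap T.symm.toLinearIsometry k u) = u := by
  have : (tensorMap T.toLinearIsometry k).comp (tensorMap T.symm.toLinearIsometry k)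
      = ContinuousLinearMap.id ℂ (TensorPow H k) :=
    tensor_hom_ext fun x => by simp [tensorMap_tensor]
  exact congrArg (fun A => A u) this

theorem inner_tensorMap {σ : ℂ →+* ℂ} [UnitaryScalar σ] (T : H →ₛₗᵢ[σ] H) {k : ℕ}
    (u v : TensorPow H k) : ⟪tensorMap T k u, tensorMap T k v⟫_ℂ = σ ⟪u, v⟫_ℂ :=
  UnitaryScalar.inner_map (H := TensorPow H k) ⟨(tensorMap T k).toLinearMap, tensorMap_norm T⟩ u v

theorem inner_symMap {σ : ℂ →+* ℂ} [UnitaryScalar σ] (T : H →ₛₗᵢ[σ] H) {k : ℕ}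
    (u v : symPow H k) : ⟪symMap T k u, symMap T k v⟫_ℂ = σ ⟪u, v⟫_ℂ :=
  inner_tensorMap T (u : TensorPow H k) v

theorem symMap_symm_apply {σ : ℂ →+* ℂ} [UnitaryScalar σ] [RingHomInvPair σ σ]
    (T : H ≃ₛₗᵢ[σ] H) {k : ℕ} (u : symPow H k) :
    symMap T.toLinearIsometry k (symMap T.symm.toLinearIsometry k u) = u :=
  Subtype.ext (tensorMap_symm_apply T _)

/-- The tensor power of T and that of its inverse preserve the symmetric tensors and the inner
product up to σ; hence they respect the orthogonal projection. It suffices to test against vectors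
written as images under T. -/
theorem symMap_proj {σ : ℂ →+* ℂ} [UnitaryScalar σ] [RingHomInvPair σ σ] (T : H ≃ₛₗᵢ[σ] H)
    {k : ℕ} (v : TensorPow H k) :
    symMap T.toLinearIsometry k ((symPow H k).orthogonalProjectionOnto v)
      = (symPow H k).orthogonalProjectionOnto (tensorMap T.toLinearIsometry k v) := by
  refine ext_inner_left ℂ fun w => ?_
  rw [← symMap_symm_apply T w, inner_symMap]
  have h1 : ∀ (a : symPow H k) (b : TensorPow H k),
      ⟪a, (symPow H k).orthogonalProjectionOnto b⟫_ℂ = ⟪(a : TensorPow H k), b⟫_ℂ := fun a b =>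
    Submodule.inner_orthogonalProjectionOnto_eq_of_mem_left a b
  rw [h1, h1]
  exact (inner_tensorMap T.toLinearIsometry _ _).symm

theorem tensorMap_tensorCons {σ : ℂ →+* ℂ} [UnitaryScalar σ] (T : H →ₛₗᵢ[σ] H) (h : H) {k : ℕ}
    (u : TensorPow H k) :
    tensorMap T (k + 1) (tensorCons h k u) = tensorCons (T h) k (tensorMap T k u) := by
  have : (tensorMap T (k + 1)).comp (tensorCons h k)
      = (tensorCons (T h) k).comp (tensorMap T k) :=
    tensor_hom_ext fun x => by
      simp only [ContinuousLinearMap.comp_apply, tensorCons_tensor, tensorMap_tensor]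
      congr 1
      ext i
      refine Fin.cases rfl (fun j => rfl) i
  exact congrArg (fun A => A u) this

theorem creationPart_apply (h : H) (k : ℕ) (u : symPow H k) :
    creationPart h k u = ((Real.sqrt (k + 1) : ℝ) : ℂ) •
      (symPow H (k + 1)).orthogonalProjectionOnto (tensorCons h k u) := rfl

theorem symMap_smul {σ : ℂ →+* ℂ} [UnitaryScalar σ] (T : H →ₛₗᵢ[σ] H) {k : ℕ} (c : ℂ)
    (u : symPow H k) : symMap T k (c • u) = σ c • symMap T k u :=
  Subtype.ext (map_smulₛₗ (tensorMap T k) c (u : TensorPow H k))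

/-- The factor √(k + 1) is real, so the antiunitary case needs no correction. -/
theorem symMap_creationPart {σ : ℂ →+* ℂ} [UnitaryScalar σ] [RingHomInvPair σ σ]
    (T : H ≃ₛₗᵢ[σ] H) (h : H) (k : ℕ) (u : symPow H k) :
    symMap T.toLinearIsometry (k + 1) (creationPart h k u)
      = creationPart (T h) k (symMap T.toLinearIsometry k u) := by
  rw [creationPart_apply, creationPart_apply, symMap_smul, UnitaryScalar.apply_ofReal,
    symMap_proj, tensorMap_tensorCons]
  rfl

/-- By duality from the creation operator. Both pairings acquire the same σ, so the state h is
simply replaced by its image. -/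
theorem symMap_annihilationPart {σ : ℂ →+* ℂ} [UnitaryScalar σ] [RingHomInvPair σ σ]
    (T : H ≃ₛₗᵢ[σ] H) (h : H) (k : ℕ) (u : symPow H (k + 1)) :
    symMap T.toLinearIsometry k (annihilationPart h k u)
      = annihilationPart (T h) k (symMap T.toLinearIsometry (k + 1) u) := by
  refine ext_inner_left ℂ fun w => ?_
  rw [← symMap_symm_apply T w, inner_symMap, annihilationPart, annihilationPart,
    ContinuousLinearMap.adjoint_inner_right, ContinuousLinearMap.adjoint_inner_right,
    ← symMap_creationPart, inner_symMap]

theorem secondQuant_creation {σ : ℂ →+* ℂ} [UnitaryScalar σ] [RingHomInvPair σ σ]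
    (T : H ≃ₛₗᵢ[σ] H) (h : H) (Ψ : finiteParticle H) :
    secondQuant T (creation h Ψ) = creation (T h) ⟨secondQuant T Ψ, secondQuant_mem T Ψ.2⟩ := by
  rw [creation_eq_raiseOp, creation_eq_raiseOp]
  exact secondQuant_raiseOp T (symMap_creationPart T h) Ψ

theorem secondQuant_annihilation {σ : ℂ →+* ℂ} [UnitaryScalar σ] [RingHomInvPair σ σ]
    (T : H ≃ₛₗᵢ[σ] H) (h : H) (Ψ : finiteParticle H) :
    secondQuant T (annihilation h Ψ)
      = annihilation (T h) ⟨secondQuant T Ψ, secondQuant_mem T Ψ.2⟩ := by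
  rw [annihilation_eq_lowerOp, annihilation_eq_lowerOp]
  exact secondQuant_lowerOp T (symMap_annihilationPart T h) Ψ

end Covariance

/-! ### Uniform decay of the partial Fourier transforms of a Schwartz function. -/

section Slices

variable {V Z : Type*} [NormedAddCommGroup V] [InnerProductSpace ℝ V]
  [NormedAddCommGroup Z] [NormedSpace ℝ Z]

/-- A slice is a translate of χ composed with the inclusion of the first factor, a linear map of
norm at most 1. -/
theorem norm_iteratedFDeriv_slice_le (χ : 𝓢(V × Z, ℂ)) (j : ℕ) (z : Z) (v : V) :
    ‖iteratedFDeriv ℝ j (fun v => χ (v, z)) v‖ ≤ ‖iteratedFDeriv ℝ j χ (v, z)‖ := by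
  have e : (fun v => χ (v, z)) = (fun p : V × Z => χ (p + (0, z)))
      ∘ ContinuousLinearMap.inl ℝ V Z := by
    ext v
    simp
  have hs : ContDiff ℝ j (fun p : V × Z => χ (p + (0, z))) :=
    (χ.smooth j).comp (contDiff_id.add contDiff_const)
  rw [e, ContinuousLinearMap.iteratedFDeriv_comp_right _ hs _ le_rfl,
    iteratedFDeriv_comp_add_right]
  refine (ContinuousMultilinearMap.norm_compContinuousLinearMap_le _ _).trans ?_
  have h1 : ContinuousLinearMap.inl ℝ V Z v + (0, z) = (v, z) := by simp
  rw [h1]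
  refine mul_le_of_le_one_right (norm_nonneg _) ?_
  refine Finset.prod_le_one (fun _ _ => norm_nonneg _) fun _ _ => ?_
  exact ContinuousLinearMap.opNorm_le_bound _ zero_le_one fun v => by simp

/-- The constant does not depend on the slice, since ‖v‖ ≤ ‖(v, z)‖ turns joint decay into decay in
v alone. -/
theorem exists_slice_decay (χ : 𝓢(V × Z, ℂ)) (r j : ℕ) :
    ∃ C, ∀ z v, ‖iteratedFDeriv ℝ j (fun v => χ (v, z)) v‖ ≤ C * (1 + ‖v‖) ^ (-(r : ℝ)) := by
  refine ⟨2 ^ r * (Finset.Iic (r, j)).sup (fun m => SchwartzMap.seminorm ℝ m.1 m.2) χ,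
    fun z v => ?_⟩
  have h := SchwartzMap.one_add_le_sup_seminorm_apply (𝕜 := ℝ) (m := (r, j)) le_rfl le_rfl χ (v, z)
  rw [Real.rpow_neg (by positivity), Real.rpow_natCast, ← div_eq_mul_inv, le_div_iff₀ (by positivity),
    mul_comm]
  refine le_trans ?_ h
  have h2 : ‖v‖ ≤ ‖(v, z)‖ := le_max_left _ _
  have := norm_iteratedFDeriv_slice_le χ j z v
  gcongr

variable [FiniteDimensional ℝ V] [MeasurableSpace V] [BorelSpace V]

/-- The Fourier transforms of the slices of a Schwartz function decay uniformly. -/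
theorem exists_fourier_slice_decay (χ : 𝓢(V × Z, ℂ)) (r : ℕ) :
    ∃ C, ∀ z w, ‖FourierTransform.fourier (fun v => χ (v, z)) w‖ ≤ C * (1 + ‖w‖) ^ (-(r : ℝ)) := by
  -- One power more than the dimension makes the majorant of every derivative integrable.
  set q : ℕ := Module.finrank ℝ V + 1 with hq
  choose C hC using exists_slice_decay χ q
  have hint : Integrable fun v : V => (1 + ‖v‖) ^ (-(q : ℝ)) :=
    integrable_one_add_norm (by simp [hq])
  have hsm : ∀ z, ContDiff ℝ ((⊤ : ℕ∞) : WithTop ℕ∞) (fun v => χ (v, z)) := fun z =>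
    χ.smooth'.comp (contDiff_id.prodMk contDiff_const)
  have hintj : ∀ z j, Integrable fun v : V => ‖iteratedFDeriv ℝ j (fun v => χ (v, z)) v‖ := by
    intro z j
    refine (hint.const_mul (C j)).mono' ?_ (Eventually.of_forall fun v => ?_)
    · exact (((hsm z).continuous_iteratedFDeriv (m := j) (mod_cast le_top)).norm).aestronglyMeasurable
    · rw [norm_norm]
      exact hC j z v
  -- The right side of Mathlib's bound for the undifferentiated Fourier transform, with the
  -- derivatives of the slice replaced by their uniform majorants.
  set B : ℕ → ℝ := fun k => (2 * Real.pi) ^ 0 * (2 * ((0 : ℕ) : ℝ) + 2) ^ k *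
    ∑ p ∈ Finset.range (0 + 1) ×ˢ Finset.range (k + 1), C p.2 * ∫ v : V, (1 + ‖v‖) ^ (-(q : ℝ))
  have key : ∀ (k : ℕ) z w, ‖w‖ ^ k * ‖FourierTransform.fourier (fun v => χ (v, z)) w‖ ≤ B k := by
    intro k z w
    have h := Real.pow_mul_norm_iteratedFDeriv_fourier_le (K := 0) (N := ⊤) (hsm z)
      (fun a b ha _ => by
        have ha0 : a = 0 := by simpa using ha
        subst ha0
        simpa using hintj z b) (k := 0) (n := k) le_rfl le_top w
    rw [norm_iteratedFDeriv_zero] at h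
    refine h.trans (mul_le_mul_of_nonneg_left (Finset.sum_le_sum fun p hp => ?_) (by positivity))
    have hp1 : p.1 = 0 := by
      have := (Finset.mem_product.mp hp).1
      simpa using this
    rw [hp1, ← integral_const_mul]
    simp only [pow_zero, one_mul]
    exact integral_mono (hintj z p.2) (hint.const_mul _) fun v => hC p.2 z v
  -- The bounds for the powers 0 and r combine through (1 + t)^r ≤ 2^(r-1) (1 + t^r).
  refine ⟨2 ^ (r - 1) * (B 0 + B r), fun z w => ?_⟩
  rw [Real.rpow_neg (by positivity), Real.rpow_natCast, ← div_eq_mul_inv, le_div_iff₀ (by positivity)]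
  have h1 := add_pow_le zero_le_one (norm_nonneg w) r
  rw [one_pow] at h1
  have h2 := key 0 z w
  have h3 := key r z w
  rw [pow_zero, one_mul] at h2
  set G := ‖FourierTransform.fourier (fun v => χ (v, z)) w‖
  calc G * (1 + ‖w‖) ^ r ≤ G * (2 ^ (r - 1) * (1 + ‖w‖ ^ r)) := by gcongr
    _ = 2 ^ (r - 1) * (G + ‖w‖ ^ r * G) := by ring
    _ ≤ _ := by gcongr

end Slices

/-! ### The scalar oscillatory integral and its limit. -/

section Oscillatory

variable {n : ℕ}

theorem continuous_mink : Continuous fun p : Spacetime n × Spacetime n => mink p.1 p.2 := by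
  unfold mink
  fun_prop

/-- The partial Fourier transform `∫ exp (-i x·w) χ(x, z) dx`. -/
def sliceFourier (χ : 𝓢(Spacetime n × Spacetime n, ℂ)) (w z : Spacetime n) : ℂ :=
  ∫ x, Complex.exp (-Complex.I * (mink x w : ℂ)) * χ (x, z)

/-- The Fourier variable on Euclidean space which belongs to `w`. -/
def euclideanFreq (w : Spacetime n) : EuclideanSpace ℝ (Fin (n + 1)) :=
  WithLp.toLp 2 ((2 * Real.pi)⁻¹ • (metric n).mulVec w)

/-- Fourier theory is available on Euclidean space with the kernel exp(-2πi⟨v, ξ⟩). The Lorentzian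
product x·w is the Euclidean product of x with the metric applied to w, which leads to the frequency
(2π)⁻¹ times that vector. -/
theorem sliceFourier_eq (χ : 𝓢(Spacetime n × Spacetime n, ℂ)) (w z : Spacetime n) :
    sliceFourier χ w z = FourierTransform.fourier
      (fun v => SchwartzMap.compCLMOfContinuousLinearEquiv ℂ
        ((EuclideanSpace.equiv (Fin (n + 1)) ℝ).prodCongr (ContinuousLinearEquiv.refl ℝ _)) χ (v, z))
      (euclideanFreq w) := by
  rw [Real.fourier_eq', sliceFourier,
    ← (PiLp.volume_preserving_ofLp (Fin (n + 1))).integral_comp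
      (MeasurableEquiv.toLp 2 (Fin (n + 1) → ℝ)).symm.measurableEmbedding]
  refine integral_congr_ae (Eventually.of_forall fun x => ?_)
  have h1 : -2 * Real.pi * ⟪x, euclideanFreq w⟫_ℝ = - mink (WithLp.ofLp x) w := by
    rw [mink_eq]
    simp only [PiLp.inner_apply, euclideanFreq, Pi.smul_apply, smul_eq_mul, RCLike.inner_apply,
      conj_trivial, Finset.mul_sum, dotProduct, ← Finset.sum_neg_distrib]
    refine Finset.sum_congr rfl fun i _ => ?_
    field_simp
  simp only [h1, smul_eq_mul]
  have h2 : -Complex.I * (mink (WithLp.ofLp x) w : ℂ)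
      = ((-mink (WithLp.ofLp x) w : ℝ) : ℂ) * Complex.I := by
    push_cast
    ring
  rw [h2]
  rfl

theorem norm_le_euclideanFreq (w : Spacetime n) :
    ‖w‖ ≤ 2 * Real.pi * ‖euclideanFreq w‖ := by
  refine (pi_norm_le_iff_of_nonneg (by positivity)).mpr fun i => ?_
  have h := PiLp.norm_apply_le (euclideanFreq w) i
  have h2 : ‖euclideanFreq w i‖ = (2 * Real.pi)⁻¹ * ‖w i‖ := by
    refine Fin.cases ?_ (fun j => ?_) i <;>
    simp [euclideanFreq, metric, Matrix.mulVec_diagonal, abs_of_pos Real.pi_pos]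
  rw [h2] at h
  have := mul_le_mul_of_nonneg_left h (show 0 ≤ 2 * Real.pi by positivity)
  rwa [← mul_assoc, mul_inv_cancel₀ (by positivity), one_mul] at this

/-- The exponent n + 2 exceeds the dimension n + 1 by one; this function dominates in all limits
below. -/
theorem integrable_decay (n : ℕ) :
    Integrable fun w : Spacetime n => (1 + ‖w‖) ^ (-((n + 2 : ℕ) : ℝ)) :=
  integrable_one_add_norm (by simp)

theorem exists_sliceFourier_decay (χ : 𝓢(Spacetime n × Spacetime n, ℂ)) :
    ∃ C, ∀ w z, ‖sliceFourier χ w z‖ ≤ C * (1 + ‖w‖) ^ (-((n + 2 : ℕ) : ℝ)) := by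
  obtain ⟨C, hC⟩ := exists_fourier_slice_decay (SchwartzMap.compCLMOfContinuousLinearEquiv ℂ
    ((EuclideanSpace.equiv (Fin (n + 1)) ℝ).prodCongr (ContinuousLinearEquiv.refl ℝ _)) χ) (n + 2)
  have hC0 : 0 ≤ C := by
    have := (norm_nonneg _).trans (hC 0 0)
    simpa using this
  refine ⟨C * (2 * Real.pi) ^ (n + 2), fun w z => ?_⟩
  rw [sliceFourier_eq]
  refine (hC z _).trans ?_
  rw [Real.rpow_neg (by positivity), Real.rpow_natCast, Real.rpow_neg (by positivity),
    Real.rpow_natCast, mul_assoc]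
  refine mul_le_mul_of_nonneg_left ?_ hC0
  have h := norm_le_euclideanFreq w
  have h2pi : 1 ≤ 2 * Real.pi := by linarith [Real.pi_gt_three]
  rw [← div_eq_mul_inv, le_div_iff₀ (by positivity), mul_comm, ← div_eq_mul_inv,
    div_le_iff₀ (by positivity), ← mul_pow]
  exact pow_le_pow_left₀ (by positivity) (by nlinarith [norm_nonneg (euclideanFreq w)]) _

theorem exists_norm_le_decay (χ : 𝓢(Spacetime n × Spacetime n, ℂ)) :
    ∃ C, ∀ x z, ‖χ (x, z)‖ ≤ C * (1 + ‖x‖) ^ (-((n + 2 : ℕ) : ℝ)) := by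
  refine ⟨2 ^ (n + 2) * (Finset.Iic (n + 2, 0)).sup (fun m => SchwartzMap.seminorm ℝ m.1 m.2) χ,
    fun x z => ?_⟩
  have h := SchwartzMap.one_add_le_sup_seminorm_apply (𝕜 := ℝ) (m := (n + 2, 0)) le_rfl le_rfl χ
    (x, z)
  rw [norm_iteratedFDeriv_zero] at h
  rw [Real.rpow_neg (by positivity), Real.rpow_natCast, ← div_eq_mul_inv, le_div_iff₀ (by positivity),
    mul_comm]
  refine le_trans ?_ h
  have h2 : ‖x‖ ≤ ‖(x, z)‖ := le_max_left _ _
  gcongr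

theorem norm_exp_neg_I (t : ℝ) : ‖Complex.exp (-Complex.I * (t : ℂ))‖ = 1 := by
  have h : -Complex.I * (t : ℂ) = ((-t : ℝ) : ℂ) * Complex.I := by
    push_cast
    ring
  rw [h, Complex.norm_exp_ofReal_mul_I]

theorem continuous_sliceFourier (χ : 𝓢(Spacetime n × Spacetime n, ℂ)) :
    Continuous fun p : Spacetime n × Spacetime n => sliceFourier χ p.1 p.2 := by
  obtain ⟨C, hC⟩ := exists_norm_le_decay χ
  have hm := continuous_mink (n := n)
  unfold sliceFourier
  refine continuous_of_dominated (bound := fun x => C * (1 + ‖x‖) ^ (-((n + 2 : ℕ) : ℝ)))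
    (fun p => ?_) (fun p => Eventually.of_forall fun x => ?_) ((integrable_decay n).const_mul C)
    (Eventually.of_forall fun x => ?_)
  · have h1 : Continuous fun x : Spacetime n => mink x p.1 :=
      hm.comp (continuous_id.prodMk continuous_const)
    have h2 : Continuous fun x : Spacetime n => χ (x, p.2) :=
      χ.continuous.comp (continuous_id.prodMk continuous_const)
    exact Continuous.aestronglyMeasurable (by fun_prop)
  · rw [norm_mul, norm_exp_neg_I, one_mul]
    exact hC x p.2
  · have h1 : Continuous fun p : Spacetime n × Spacetime n => mink x p.1 :=
      hm.comp (continuous_const.prodMk continuous_fst)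
    have h2 : Continuous fun p : Spacetime n × Spacetime n => χ (x, p.2) :=
      χ.continuous.comp (continuous_const.prodMk continuous_snd)
    fun_prop

theorem measurePreserving_metric (n : ℕ) :
    MeasurePreserving fun w : Spacetime n => (metric n).mulVec w := by
  have hdet : |(metric n).det| = 1 := by
    rw [metric, Matrix.det_diagonal, Fin.prod_univ_succ]
    simp
  have h := Real.map_matrix_volume_pi_eq_smul_volume_pi (M := metric n) (by
    intro h0
    rw [h0] at hdet
    simp at hdet)
  refine ⟨by fun_prop, ?_⟩
  rw [abs_inv, hdet, inv_one, ENNReal.ofReal_one, one_smul] at h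
  exact h

/-- Fourier inversion for a slice. -/
theorem integral_sliceFourier (χ : 𝓢(Spacetime n × Spacetime n, ℂ)) :
    ∫ w, sliceFourier χ w 0 = (2 * (Real.pi : ℂ)) ^ (n + 1) * χ 0 := by
  set χ' := SchwartzMap.compCLMOfContinuousLinearEquiv ℂ
    ((EuclideanSpace.equiv (Fin (n + 1)) ℝ).prodCongr (ContinuousLinearEquiv.refl ℝ (Spacetime n)))
    χ with hχ'
  set g := FourierTransform.fourier (fun v => χ' (v, 0)) with hg
  obtain ⟨C, hC⟩ := exists_slice_decay χ' (n + 2) 0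
  obtain ⟨C', hC'⟩ := exists_fourier_slice_decay χ' (n + 2)
  have hcont : Continuous fun v => χ' (v, 0) :=
    χ'.continuous.comp (continuous_id.prodMk continuous_const)
  have hdec : Integrable fun w : EuclideanSpace ℝ (Fin (n + 1)) =>
      (1 + ‖w‖) ^ (-((n + 2 : ℕ) : ℝ)) :=
    integrable_one_add_norm (by simp)
  have hint : Integrable fun v => χ' (v, 0) := by
    refine (hdec.const_mul C).mono' hcont.aestronglyMeasurable (Eventually.of_forall fun v => ?_)
    have := hC 0 v
    rwa [norm_iteratedFDeriv_zero] at this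
  have hgc : Continuous g :=
    VectorFourier.fourierIntegral_continuous Real.continuous_fourierChar
      (by exact continuous_inner) hint
  have hgint : Integrable g :=
    (hdec.const_mul C').mono' hgc.aestronglyMeasurable (Eventually.of_forall fun v => hC' 0 v)
  -- Inversion at the origin, where the kernel is 1: the integral of the transform is the value of
  -- the slice at 0.
  have hinv := hint.fourierInv_fourier_eq hgint (v := 0) hcont.continuousAt
  rw [Real.fourierInv_eq'] at hinv
  simp only [inner_zero_right, mul_zero, Complex.ofReal_zero, zero_mul, Complex.exp_zero,
    one_smul] at hinv
  have h1 : ∀ w, sliceFourier χ w 0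
      = g (WithLp.toLp 2 ((2 * Real.pi)⁻¹ • (metric n).mulVec w)) := fun w => sliceFourier_eq χ w 0
  have hme : MeasurableEmbedding fun w : Spacetime n => (metric n).mulVec w := by
    let e : Spacetime n ≃L[ℝ] Spacetime n := (LinearEquiv.ofLinearMap (Matrix.mulVecLin (metric n))
      (Matrix.mulVecLin (metric n))
      (by rw [← Matrix.mulVecLin_mul, metric_mul_self, Matrix.mulVecLin_one])
      (by rw [← Matrix.mulVecLin_mul, metric_mul_self, Matrix.mulVecLin_one])).toContinuousLinearEquiv
    exact e.toHomeomorph.measurableEmbedding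
  simp only [h1]
  -- The metric has determinant ±1 and preserves the measure; the dilation by (2π)⁻¹ is the source
  -- of the factor (2π)^(n+1).
  rw [(measurePreserving_metric n).integral_comp hme
    (fun w => g (WithLp.toLp 2 ((2 * Real.pi)⁻¹ • w))),
    Measure.integral_comp_inv_smul volume (fun w => g (WithLp.toLp 2 w)),
    (PiLp.volume_preserving_toLp (Fin (n + 1))).integral_comp
      (MeasurableEquiv.toLp 2 (Fin (n + 1) → ℝ)).measurableEmbedding, hinv]
  have h2 : χ' (0, 0) = χ 0 := by
    rw [hχ', SchwartzMap.compCLMOfContinuousLinearEquiv_apply, Function.comp_apply]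
    congr 1
  rw [h2, Module.finrank_fin_fun, abs_of_pos (by positivity), Complex.real_smul]
  push_cast
  rfl

/-- The oscillatory integral `∬ exp (-i x·y) χ(ε x, ε y) exp (i (x·a + y·b)) dx dy`. -/
def oscIntegral (χ : 𝓢(Spacetime n × Spacetime n, ℂ)) (ε : ℝ) (a b : Spacetime n) : ℂ :=
  ∫ z : Spacetime n × Spacetime n, Complex.exp (-Complex.I * (mink z.1 z.2 : ℂ)) * χ (ε • z) *
    Complex.exp (Complex.I * ((mink z.1 a + mink z.2 b : ℝ) : ℂ))

theorem integrable_cutoff (χ : 𝓢(Spacetime n × Spacetime n, ℂ)) {ε : ℝ} (hε : 0 < ε) :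
    Integrable fun z : Spacetime n × Spacetime n =>
      Complex.exp (-Complex.I * (mink z.1 z.2 : ℂ)) * χ (ε • z) := by
  have : (volume : Measure (Spacetime n × Spacetime n)).IsAddHaarMeasure :=
    Measure.prod.instIsAddHaarMeasure volume volume
  have h1 : Integrable fun z : Spacetime n × Spacetime n => χ (ε • z) :=
    (χ.integrable (μ := volume)).comp_smul hε.ne'
  have hm := continuous_mink (n := n)
  refine h1.norm.mono' ?_ (Eventually.of_forall fun z => ?_)
  · exact Continuous.aestronglyMeasurable (by fun_prop)
  · rw [norm_mul, norm_exp_neg_I, one_mul]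

theorem continuous_osc_phase : Continuous fun p : (Spacetime n × Spacetime n) ×
    (Spacetime n × Spacetime n) =>
      Complex.exp (Complex.I * ((mink p.1.1 p.2.1 + mink p.1.2 p.2.2 : ℝ) : ℂ)) := by
  have hm := continuous_mink (n := n)
  have h1 : Continuous fun p : (Spacetime n × Spacetime n) × (Spacetime n × Spacetime n) =>
      mink p.1.1 p.2.1 := hm.comp (by fun_prop : Continuous fun p : (Spacetime n × Spacetime n) ×
        (Spacetime n × Spacetime n) => (p.1.1, p.2.1))
  have h2 : Continuous fun p : (Spacetime n × Spacetime n) × (Spacetime n × Spacetime n) =>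
      mink p.1.2 p.2.2 := hm.comp (by fun_prop : Continuous fun p : (Spacetime n × Spacetime n) ×
        (Spacetime n × Spacetime n) => (p.1.2, p.2.2))
  fun_prop

theorem continuous_oscIntegral (χ : 𝓢(Spacetime n × Spacetime n, ℂ)) {ε : ℝ} (hε : 0 < ε) :
    Continuous fun p : Spacetime n × Spacetime n => oscIntegral χ ε p.1 p.2 := by
  have hc := continuous_osc_phase (n := n)
  have hi := integrable_cutoff χ hε
  unfold oscIntegral
  refine continuous_of_dominated (fun p => ?_) (fun p => Eventually.of_forall fun z => ?_) hi.norm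
    (Eventually.of_forall fun z => ?_)
  · exact hi.aestronglyMeasurable.mul (hc.comp (continuous_id.prodMk
      continuous_const : Continuous fun z => (z, p))).aestronglyMeasurable
  · rw [norm_mul, norm_phase, mul_one]
  · exact continuous_const.mul (hc.comp (continuous_const.prodMk continuous_id :
      Continuous fun p => (z, p)))

theorem mink_add_left (x y z : Spacetime n) : mink (x + y) z = mink x z + mink y z := by
  simp [mink_eq, add_dotProduct]

theorem mink_smul_left (c : ℝ) (x z : Spacetime n) : mink (c • x) z = c * mink x z := by
  simp [mink_eq]

theorem mink_comm (x z : Spacetime n) : mink x z = mink z x := by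
  simp [mink, mul_comm]

theorem mink_add_right (x y z : Spacetime n) : mink x (y + z) = mink x y + mink x z := by
  rw [mink_comm, mink_add_left, mink_comm y, mink_comm z]

theorem mink_smul_right (c : ℝ) (x z : Spacetime n) : mink x (c • z) = c * mink x z := by
  rw [mink_comm, mink_smul_left, mink_comm]

theorem mink_neg_right (x z : Spacetime n) : mink x (-z) = -mink x z := by
  simpa using mink_smul_right (-1) x z

theorem mink_neg_left (x z : Spacetime n) : mink (-x) z = -mink x z := by
  simpa using mink_smul_left (-1) x z

/-- Substitute x → x/ε and y → a + εw. The term x·a/ε from the oscillating kernel cancels the one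
from exp(ix·a), so no singular phase is left; exp(ia·b) splits off, and the remaining x-integral is
the partial Fourier transform of χ at w. -/
theorem oscIntegral_eq (χ : 𝓢(Spacetime n × Spacetime n, ℂ)) {ε : ℝ} (hε : 0 < ε)
    (a b : Spacetime n) :
    oscIntegral χ ε a b = Complex.exp (Complex.I * (mink a b : ℂ)) *
      ∫ w, Complex.exp (Complex.I * ((ε * mink w b : ℝ) : ℂ)) *
        sliceFourier χ w (ε • a + ε ^ 2 • w) := by
  set f : Spacetime n × Spacetime n → ℂ := fun z =>
    Complex.exp (-Complex.I * (mink z.1 z.2 : ℂ)) * χ (ε • z) *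
      Complex.exp (Complex.I * ((mink z.1 a + mink z.2 b : ℝ) : ℂ)) with hf
  have hfi : Integrable f := by
    refine (integrable_cutoff χ hε).norm.mono' ?_ (Eventually.of_forall fun z => ?_)
    · exact (integrable_cutoff χ hε).aestronglyMeasurable.mul (continuous_osc_phase.comp
        (continuous_id.prodMk continuous_const : Continuous fun z =>
          (z, (a, b)))).aestronglyMeasurable
    · rw [norm_mul, norm_phase, mul_one]
  have h1 : oscIntegral χ ε a b = ∫ y, ∫ x, f (x, y) := by
    rw [← integral_prod_symm _ hfi]
    rfl
  have hd : Module.finrank ℝ (Spacetime n) = n + 1 := Module.finrank_fin_fun ℝ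
  -- The Jacobians of the two dilations are inverse to each other.
  have h2 : ∫ w, ∫ x, f (ε⁻¹ • x, a + ε • w) = ∫ y, ∫ x, f (x, y) := by
    have e1 : ∀ w : Spacetime n, ∫ x, f (ε⁻¹ • x, a + ε • w)
        = ((ε ^ (n + 1) : ℝ) : ℂ) * ∫ x, f (x, a + ε • w) := by
      intro w
      rw [Measure.integral_comp_inv_smul volume (fun x => f (x, a + ε • w)), hd,
        abs_of_pos (by positivity), Complex.real_smul]
    simp only [e1]
    rw [integral_const_mul, Measure.integral_comp_smul volume (fun w => ∫ x, f (x, a + w)), hd,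
      abs_of_pos (by positivity), Complex.real_smul, ← mul_assoc, ← Complex.ofReal_mul,
      mul_inv_cancel₀ (by positivity), Complex.ofReal_one, one_mul,
      integral_add_left_eq_self (fun w => ∫ x, f (x, w)) a]
  rw [h1, ← h2, ← integral_const_mul]
  refine integral_congr_ae (Eventually.of_forall fun w => ?_)
  simp only [sliceFourier]
  rw [← integral_const_mul, ← integral_const_mul]
  refine integral_congr_ae (Eventually.of_forall fun x => ?_)
  simp only [hf]
  have e2 : ε • (ε⁻¹ • x, a + ε • w) = (x, ε • a + ε ^ 2 • w) := by
    ext1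
    · simp [smul_smul, mul_inv_cancel₀ hε.ne']
    · simp [smul_smul, pow_two]
  rw [e2, mul_right_comm, ← Complex.exp_add, ← mul_assoc, ← mul_assoc, ← Complex.exp_add,
    ← Complex.exp_add]
  congr 2
  simp only [mink_add_left, mink_add_right, mink_smul_left, mink_smul_right]
  push_cast
  have : (ε : ℂ) ≠ 0 := by exact_mod_cast hε.ne'
  field_simp
  ring

/-- In the substituted form only phases depend on a, b and ε, apart from the second argument of the
partial Fourier transform, in which its decay is uniform. -/
theorem exists_oscIntegral_bound (χ : 𝓢(Spacetime n × Spacetime n, ℂ)) :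
    ∃ C, ∀ ε, 0 < ε → ∀ a b, ‖oscIntegral χ ε a b‖ ≤ C := by
  obtain ⟨C, hC⟩ := exists_sliceFourier_decay χ
  refine ⟨∫ w : Spacetime n, C * (1 + ‖w‖) ^ (-((n + 2 : ℕ) : ℝ)), fun ε hε a b => ?_⟩
  rw [oscIntegral_eq χ hε, norm_mul, norm_phase, one_mul]
  refine norm_integral_le_of_norm_le ((integrable_decay n).const_mul C)
    (Eventually.of_forall fun w => ?_)
  rw [norm_mul, norm_phase, one_mul]
  exact hC _ _

/-- Dominated convergence in the substituted form: the second argument εa + ε²w tends to 0, and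
Fourier inversion evaluates the limit. -/
theorem tendsto_oscIntegral (χ : 𝓢(Spacetime n × Spacetime n, ℂ)) (a b : Spacetime n) :
    Tendsto (fun ε => oscIntegral χ ε a b) (𝓝[>] 0)
      (𝓝 (Complex.exp (Complex.I * (mink a b : ℂ)) * ((2 * (Real.pi : ℂ)) ^ (n + 1) * χ 0))) := by
  obtain ⟨C, hC⟩ := exists_sliceFourier_decay χ
  have hm := continuous_mink (n := n)
  have hs := continuous_sliceFourier χ
  have h1 : Tendsto (fun ε : ℝ => ∫ w, Complex.exp (Complex.I * ((ε * mink w b : ℝ) : ℂ)) *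
        sliceFourier χ w (ε • a + ε ^ 2 • w)) (𝓝[>] 0) (𝓝 (∫ w, sliceFourier χ w 0)) := by
    refine tendsto_integral_filter_of_dominated_convergence
      (fun w => C * (1 + ‖w‖) ^ (-((n + 2 : ℕ) : ℝ))) (Eventually.of_forall fun ε => ?_)
      (Eventually.of_forall fun ε => Eventually.of_forall fun w => ?_)
      ((integrable_decay n).const_mul C) (Eventually.of_forall fun w => ?_)
    · have e1 : Continuous fun w : Spacetime n => mink w b :=
        hm.comp (continuous_id.prodMk continuous_const)
      have e2 : Continuous fun w : Spacetime n => sliceFourier χ w (ε • a + ε ^ 2 • w) :=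
        hs.comp (continuous_id.prodMk (by fun_prop))
      exact Continuous.aestronglyMeasurable (by fun_prop)
    · rw [norm_mul, norm_phase, one_mul]
      exact hC _ _
    · have e2 : Continuous fun ε : ℝ => sliceFourier χ w (ε • a + ε ^ 2 • w) :=
        hs.comp (continuous_const.prodMk (by fun_prop))
      have e3 : Continuous fun ε : ℝ => Complex.exp (Complex.I * ((ε * mink w b : ℝ) : ℂ)) *
        sliceFourier χ w (ε • a + ε ^ 2 • w) := by fun_prop
      have := (e3.tendsto 0).mono_left (nhdsWithin_le_nhds (s := Set.Ioi (0 : ℝ)))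
      simpa using this
  rw [integral_sliceFourier] at h1
  refine (h1.const_mul _).congr' ?_
  filter_upwards [self_mem_nhdsWithin] with ε hε
  exact (oscIntegral_eq χ hε a b).symm

end Oscillatory

/-! ### Oscillatory integrals of operators diagonalized by an isometry into L². -/

section Multipliers

variable {M : Type*} [MeasurableSpace M] {ν : Measure M}

theorem norm_sq_eq_integral (g : Lp ℂ 2 ν) : ‖g‖ ^ 2 = ∫ ξ, ‖g ξ‖ ^ 2 ∂ν := by
  have h := L2.inner_def (𝕜 := ℂ) g g
  have h2 : ∀ ξ, ⟪g ξ, g ξ⟫_ℂ = ((‖g ξ‖ ^ 2 : ℝ) : ℂ) := fun ξ => by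
    rw [inner_self_eq_norm_sq_to_K]
    norm_cast
  simp only [h2, inner_self_eq_norm_sq_to_K] at h
  rw [integral_complex_ofReal] at h
  exact Complex.ofReal_injective ((Complex.ofReal_pow _ _).trans h)

theorem integrable_norm_sq (g : Lp ℂ 2 ν) : Integrable (fun ξ => ‖g ξ‖ ^ 2) ν :=
  (memLp_two_iff_integrable_sq_norm (Lp.aestronglyMeasurable g)).mp (Lp.memLp g)

/-- Dominated convergence for multiplication operators on `L²`. -/
theorem tendsto_multiplier {α : Type*} {l : Filter α} [l.IsCountablyGenerated] {v w : Lp ℂ 2 ν}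
    {u : α → Lp ℂ 2 ν} {E : α → M → ℂ} {E' : M → ℂ} {C : ℝ}
    (hu : ∀ᶠ a in l, u a =ᵐ[ν] fun ξ => E a ξ * v ξ) (hw : w =ᵐ[ν] fun ξ => E' ξ * v ξ)
    (hE : ∀ᶠ a in l, ∀ ξ, ‖E a ξ‖ ≤ C) (hE' : ∀ ξ, ‖E' ξ‖ ≤ C)
    (hlim : ∀ ξ, Tendsto (fun a => E a ξ) l (𝓝 (E' ξ))) : Tendsto u l (𝓝 w) := by
  have hae : ∀ᶠ a in l, (fun ξ => ‖(u a - w) ξ‖ ^ 2)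
      =ᵐ[ν] fun ξ => ‖E a ξ - E' ξ‖ ^ 2 * ‖v ξ‖ ^ 2 := by
    filter_upwards [hu] with a ha
    filter_upwards [ha, hw, Lp.coeFn_sub (u a) w] with ξ h1 h2 h3
    rw [h3, Pi.sub_apply, h1, h2, ← sub_mul, norm_mul, mul_pow]
  have h1 : Tendsto (fun a => ∫ ξ, ‖E a ξ - E' ξ‖ ^ 2 * ‖v ξ‖ ^ 2 ∂ν) l (𝓝 (∫ _, (0 : ℝ) ∂ν)) := by
    refine tendsto_integral_filter_of_dominated_convergence
      (fun ξ => (C + C) ^ 2 * ‖v ξ‖ ^ 2) ?_ ?_ ((integrable_norm_sq v).const_mul _)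
      (Eventually.of_forall fun ξ => ?_)
    · filter_upwards [hae] with a ha
      exact ((Lp.aestronglyMeasurable (u a - w)).norm.pow 2).congr ha
    · filter_upwards [hE] with a ha
      refine Eventually.of_forall fun ξ => ?_
      rw [Real.norm_of_nonneg (by positivity)]
      have : ‖E a ξ - E' ξ‖ ≤ C + C := (norm_sub_le _ _).trans (add_le_add (ha ξ) (hE' ξ))
      gcongr
    · have h2 := (((hlim ξ).sub_const (E' ξ)).norm.pow 2).mul_const (‖v ξ‖ ^ 2)
      simpa using h2
  rw [integral_zero] at h1
  have h2 : Tendsto (fun a => ‖u a - w‖ ^ 2) l (𝓝 0) := by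
    refine h1.congr' ?_
    filter_upwards [hae] with a ha
    rw [norm_sq_eq_integral, integral_congr_ae ha]
  rw [tendsto_iff_norm_sub_tendsto_zero]
  have h3 := h2.sqrt
  simpa [Real.sqrt_sq] using h3

variable {n : ℕ} {K : Type*} [NormedAddCommGroup K] [InnerProductSpace ℂ K]
  {J : K →ₗᵢ[ℂ] Lp ℂ 2 ν} {R : Spacetime n × Spacetime n → K → K} {a b : M → Spacetime n}

/-- Through the isometry `J` into `L²`, the operators `R(x, y)` are the multiplications by
`exp (i (x·a + y·b))`. -/
def IsSpectral (J : K →ₗᵢ[ℂ] Lp ℂ 2 ν) (a b : M → Spacetime n)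
    (R : Spacetime n × Spacetime n → K → K) : Prop :=
  ∀ z v, J (R z v) =ᵐ[ν] fun ξ =>
    Complex.exp (Complex.I * ((mink z.1 (a ξ) + mink z.2 (b ξ) : ℝ) : ℂ)) * J v ξ

/-- Through the isometry `J` into `L²`, the operator `S` is the multiplication by `E`. -/
def IsMultiplier (J : K →ₗᵢ[ℂ] Lp ℂ 2 ν) (E : M → ℂ) (S : K → K) : Prop :=
  ∀ v, J (S v) =ᵐ[ν] fun ξ => E ξ * J v ξ

/-- Both inner products can be computed in L², where conjugate multipliers are adjoint; J need not
be onto for this. -/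
theorem IsMultiplier.inner_map {E E' : M → ℂ} {S S' : K → K} (h : IsMultiplier J E S)
    (h' : IsMultiplier J E' S') (hE : ∀ ξ, E' ξ = conj (E ξ)) (v w : K) :
    ⟪S v, w⟫_ℂ = ⟪v, S' w⟫_ℂ := by
  rw [← J.inner_map_map, ← J.inner_map_map, L2.inner_def, L2.inner_def]
  refine integral_congr_ae ?_
  filter_upwards [h v, h' w] with ξ h1 h2
  rw [h1, h2, hE, RCLike.inner_apply, RCLike.inner_apply, map_mul]
  ring

namespace IsSpectral

theorem norm_apply (h : IsSpectral J a b R) (z : Spacetime n × Spacetime n) (v : K) :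
    ‖R z v‖ = ‖v‖ := by
  rw [← J.norm_map, ← J.norm_map v]
  have h1 : ∀ᵐ ξ ∂ν, ‖J (R z v) ξ‖ = ‖J v ξ‖ := by
    filter_upwards [h z v] with ξ h1
    rw [h1, norm_mul, norm_phase, one_mul]
  exact le_antisymm (Lp.norm_le_norm_of_ae_le (h1.mono fun p hp => hp.le))
    (Lp.norm_le_norm_of_ae_le (h1.mono fun p hp => hp.ge))

theorem continuous_apply (h : IsSpectral J a b R) (v : K) : Continuous fun z => R z v := by
  rw [J.isometry.isUniformInducing.isInducing.continuous_iff, continuous_iff_continuousAt]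
  intro z
  refine tendsto_multiplier (C := 1) (Eventually.of_forall fun z => h z v) (h z v)
    (Eventually.of_forall fun z ξ => (norm_phase _).le) (fun ξ => (norm_phase _).le) fun ξ => ?_
  exact (continuous_osc_phase.comp (continuous_id.prodMk continuous_const :
    Continuous fun z => (z, (a ξ, b ξ)))).tendsto z

theorem integrable (h : IsSpectral J a b R) (χ : 𝓢(Spacetime n × Spacetime n, ℂ)) {ε : ℝ}
    (hε : 0 < ε) (v : K) : Integrable fun z : Spacetime n × Spacetime n =>
      (Complex.exp (-Complex.I * (mink z.1 z.2 : ℂ)) * χ (ε • z)) • R z v := by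
  have hi := integrable_cutoff χ hε
  refine (hi.norm.mul_const ‖v‖).mono'
    (hi.aestronglyMeasurable.smul (h.continuous_apply v).aestronglyMeasurable)
    (Eventually.of_forall fun z => ?_)
  rw [norm_smul, h.norm_apply]

theorem memLp_osc (ha : Measurable a) (hb : Measurable b)
    (χ : 𝓢(Spacetime n × Spacetime n, ℂ)) {ε : ℝ} (hε : 0 < ε) (g : Lp ℂ 2 ν) :
    MemLp (fun ξ => oscIntegral χ ε (a ξ) (b ξ) * g ξ) 2 ν := by
  obtain ⟨C, hC⟩ := exists_oscIntegral_bound χ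
  refine (Lp.memLp g).of_le_mul (c := C) ?_ (Eventually.of_forall fun ξ => ?_)
  · exact (((continuous_oscIntegral χ hε).measurable.comp
      (ha.prodMk hb)).aestronglyMeasurable).mul (Lp.aestronglyMeasurable g)
  · rw [norm_mul]
    exact mul_le_mul_of_nonneg_right (hC ε hε _ _) (norm_nonneg _)

theorem memLp_limit (ha : Measurable a) (hb : Measurable b) (g : Lp ℂ 2 ν) :
    MemLp (fun ξ => Complex.exp (Complex.I * (mink (a ξ) (b ξ) : ℂ)) * g ξ) 2 ν := by
  have hm : Measurable fun ξ => Complex.exp (Complex.I * (mink (a ξ) (b ξ) : ℂ)) := by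
    have : Continuous fun p : Spacetime n × Spacetime n =>
        Complex.exp (Complex.I * (mink p.1 p.2 : ℂ)) := by
      have := continuous_mink (n := n)
      fun_prop
    exact this.measurable.comp (ha.prodMk hb)
  refine (Lp.memLp g).of_le (hm.aestronglyMeasurable.mul (Lp.aestronglyMeasurable g))
    (Eventually.of_forall fun ξ => ?_)
  rw [norm_mul, norm_phase, one_mul]

variable [SFinite ν] [CompleteSpace K]

/-- After pairing with an arbitrary L² vector, Fubini moves the integral over spacetime inside,
where it becomes the scalar oscillatory integral at the spectral values a and b. -/
theorem integral_coe (h : IsSpectral J a b R) (ha : Measurable a) (hb : Measurable b)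
    (χ : 𝓢(Spacetime n × Spacetime n, ℂ)) {ε : ℝ} (hε : 0 < ε) (v : K) :
    J (∫ z : Spacetime n × Spacetime n,
      (Complex.exp (-Complex.I * (mink z.1 z.2 : ℂ)) * χ (ε • z)) • R z v)
      =ᵐ[ν] fun ξ => oscIntegral χ ε (a ξ) (b ξ) * J v ξ := by
  set c : Spacetime n × Spacetime n → ℂ := fun z =>
    Complex.exp (-Complex.I * (mink z.1 z.2 : ℂ)) * χ (ε • z) with hc
  have hci : Integrable c := integrable_cutoff χ hε
  have hi := h.integrable χ hε v
  have key : J (∫ z, c z • R z v) = (memLp_osc ha hb χ hε (J v)).toLp _ := by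
    refine ext_inner_left ℂ fun g => ?_
    have e1 : ⟪g, J (∫ z, c z • R z v)⟫_ℂ = ∫ z, c z * ⟪g, J (R z v)⟫_ℂ := by
      have := (((innerSL ℂ g).comp J.toContinuousLinearMap).integral_comp_comm hi).symm
      refine this.trans (integral_congr_ae (Eventually.of_forall fun z => ?_))
      simp [hc]
    set F : Spacetime n × Spacetime n → M → ℂ := fun z ξ =>
      Complex.exp (Complex.I * ((mink z.1 (a ξ) + mink z.2 (b ξ) : ℝ) : ℂ)) with hF
    have e2 : ∀ z, c z * ⟪g, J (R z v)⟫_ℂ = ∫ ξ, c z * (F z ξ * (J v ξ * conj (g ξ))) ∂ν := by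
      intro z
      rw [L2.inner_def, ← integral_const_mul]
      refine integral_congr_ae ?_
      filter_upwards [h z v] with ξ h1
      rw [h1, RCLike.inner_apply, hF]
      ring
    have hg : Integrable (fun ξ => J v ξ * conj (g ξ)) ν := by
      have := L2.integrable_inner (𝕜 := ℂ) g (J v)
      simpa only [RCLike.inner_apply] using this
    have hprod := hci.mul_prod hg
    have hFm : Measurable (Function.uncurry F) := by
      have : Function.uncurry F = (fun p : (Spacetime n × Spacetime n) ×
          (Spacetime n × Spacetime n) => Complex.exp (Complex.I *
            ((mink p.1.1 p.2.1 + mink p.1.2 p.2.2 : ℝ) : ℂ)))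
          ∘ fun q : (Spacetime n × Spacetime n) × M => (q.1, (a q.2, b q.2)) := rfl
      rw [this]
      exact continuous_osc_phase.measurable.comp (by fun_prop)
    have hint : Integrable (Function.uncurry fun z ξ => c z * (F z ξ * (J v ξ * conj (g ξ))))
        ((volume : Measure (Spacetime n × Spacetime n)).prod ν) := by
      refine hprod.norm.mono' ?_ (Eventually.of_forall fun q => ?_)
      · refine (hFm.aestronglyMeasurable.mul hprod.aestronglyMeasurable).congr
          (Eventually.of_forall fun q => ?_)
        simp only [Function.uncurry, Pi.mul_apply]
        ring
      · simp only [Function.uncurry, hF, norm_mul, norm_phase, one_mul]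
        exact le_rfl
    rw [e1]
    simp only [e2]
    rw [integral_integral_swap hint, L2.inner_def]
    refine integral_congr_ae ?_
    filter_upwards [MemLp.coeFn_toLp (memLp_osc ha hb χ hε (J v))] with ξ h2
    rw [h2, RCLike.inner_apply, oscIntegral, mul_assoc, ← integral_mul_const]
    refine integral_congr_ae (Eventually.of_forall fun z => ?_)
    simp only [hc, hF]
    ring
  rw [key]
  exact MemLp.coeFn_toLp _

/-- The multipliers are uniformly bounded and converge pointwise, hence the operators converge
strongly. The limit is tested against a given L² vector because at this stage it is not known to lie
in the range of J. -/
theorem tendsto_toLp (h : IsSpectral J a b R) (ha : Measurable a) (hb : Measurable b)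
    {χ : 𝓢(Spacetime n × Spacetime n, ℂ)} (hχ : χ 0 = 1) (v : K) {w : Lp ℂ 2 ν}
    (hw : w =ᵐ[ν] fun ξ => Complex.exp (Complex.I * (mink (a ξ) (b ξ) : ℂ)) * J v ξ) :
    Tendsto (fun ε : ℝ => J (((2 * (Real.pi : ℂ)) ^ (n + 1))⁻¹ •
      ∫ z : Spacetime n × Spacetime n,
        (Complex.exp (-Complex.I * (mink z.1 z.2 : ℂ)) * χ (ε • z)) • R z v)) (𝓝[>] 0) (𝓝 w) := by
  obtain ⟨C, hC⟩ := exists_oscIntegral_bound χ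
  set k : ℂ := ((2 * (Real.pi : ℂ)) ^ (n + 1))⁻¹ with hk
  have hk0 : (2 * (Real.pi : ℂ)) ^ (n + 1) ≠ 0 :=
    pow_ne_zero _ (mul_ne_zero two_ne_zero (by exact_mod_cast Real.pi_ne_zero))
  refine tendsto_multiplier (v := J v) (E := fun ε ξ => k * oscIntegral χ ε (a ξ) (b ξ))
    -- One constant for the approximating multipliers and for the limiting phase of modulus 1.
    (C := max (‖k‖ * C) 1) ?_ hw ?_ (fun ξ => (norm_phase _).le.trans (le_max_right _ _))
    (fun ξ => ?_)
  · filter_upwards [self_mem_nhdsWithin] with ε hε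
    rw [map_smul]
    filter_upwards [h.integral_coe ha hb χ hε v, Lp.coeFn_smul k (J (∫ z : Spacetime n × Spacetime n,
        (Complex.exp (-Complex.I * (mink z.1 z.2 : ℂ)) * χ (ε • z)) • R z v))] with ξ h1 h2
    rw [h2, Pi.smul_apply, h1, smul_eq_mul, mul_assoc]
  · filter_upwards [self_mem_nhdsWithin] with ε hε ξ
    rw [norm_mul]
    exact (mul_le_mul_of_nonneg_left (hC ε hε _ _) (norm_nonneg _)).trans (le_max_left _ _)
  · have h1 := (tendsto_oscIntegral χ (a ξ) (b ξ)).const_mul k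
    rwa [hχ, mul_one, mul_left_comm, hk, inv_mul_cancel₀ hk0, mul_one] at h1

/-- The operator which the oscillatory integral of `R` defines. -/
theorem exists_multiplier (h : IsSpectral J a b R) (ha : Measurable a) (hb : Measurable b) :
    ∃ S : K →ₗᵢ[ℂ] K,
      IsMultiplier J (fun ξ => Complex.exp (Complex.I * (mink (a ξ) (b ξ) : ℂ))) S := by
  have hex : ∀ v, ∃ u, J u =ᵐ[ν] fun ξ =>
      Complex.exp (Complex.I * (mink (a ξ) (b ξ) : ℂ)) * J v ξ := by
    intro v
    obtain ⟨χ, hχ⟩ := exists_cutoff n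
    -- The range of an isometry of a complete space is closed, so the L² limit comes from a vector
    -- of K although J may fail to be onto.
    have hcl : IsClosed (Set.range J) := J.isometry.isClosedEmbedding.isClosed_range
    have hmem := hcl.mem_of_tendsto (h.tendsto_toLp ha hb hχ v
      (MemLp.coeFn_toLp (memLp_limit ha hb (J v)))) (Eventually.of_forall fun ε => ⟨_, rfl⟩)
    obtain ⟨u, hu⟩ := hmem
    exact ⟨u, hu ▸ MemLp.coeFn_toLp _⟩
  choose S hS using hex
  refine ⟨⟨⟨⟨S, fun u v => ?_⟩, fun c v => ?_⟩, fun v => ?_⟩, hS⟩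
  · refine J.injective (Lp.ext ?_)
    rw [map_add]
    have h3 := hS (u + v)
    rw [map_add] at h3
    filter_upwards [hS u, hS v, h3, Lp.coeFn_add (J u) (J v), Lp.coeFn_add (J (S u)) (J (S v))]
      with ξ h1 h2 h3 h4 h5
    rw [h3, h5, Pi.add_apply, h1, h2, h4, Pi.add_apply, mul_add]
  · refine J.injective (Lp.ext ?_)
    rw [map_smul]
    have h3 := hS (c • v)
    rw [map_smul] at h3
    filter_upwards [hS v, h3, Lp.coeFn_smul c (J v), Lp.coeFn_smul c (J (S v))] with ξ h1 h2 h3 h4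
    simp only [RingHom.id_apply]
    rw [h2, h4, Pi.smul_apply, h1, h3, Pi.smul_apply, smul_eq_mul, smul_eq_mul]
    ring
  · change ‖S v‖ = ‖v‖
    rw [← J.norm_map, ← J.norm_map v]
    have h1 : ∀ᵐ ξ ∂ν, ‖J (S v) ξ‖ = ‖J v ξ‖ := by
      filter_upwards [hS v] with ξ h1
      rw [h1, norm_mul, norm_phase, one_mul]
    exact le_antisymm (Lp.norm_le_norm_of_ae_le (h1.mono fun p hp => hp.le))
      (Lp.norm_le_norm_of_ae_le (h1.mono fun p hp => hp.ge))

theorem tendsto_integral (h : IsSpectral J a b R) (ha : Measurable a) (hb : Measurable b)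
    {χ : 𝓢(Spacetime n × Spacetime n, ℂ)} (hχ : χ 0 = 1) {S : K → K}
    (hS : IsMultiplier J (fun ξ => Complex.exp (Complex.I * (mink (a ξ) (b ξ) : ℂ))) S) (v : K) :
    Tendsto (fun ε : ℝ => ((2 * (Real.pi : ℂ)) ^ (n + 1))⁻¹ •
      ∫ z : Spacetime n × Spacetime n,
        (Complex.exp (-Complex.I * (mink z.1 z.2 : ℂ)) * χ (ε • z)) • R z v)
      (𝓝[>] 0) (𝓝 (S v)) := by
  rw [J.isometry.isUniformInducing.isInducing.tendsto_nhds_iff]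
  exact h.tendsto_toLp ha hb hχ v (hS v)

end IsSpectral

end Multipliers

/-! ### Tensor products of different unitaries. -/

section TensorFamily

variable {H : Type*} [NormedAddCommGroup H] [InnerProductSpace ℂ H]

/-- The operator `T 0 ⊗ ⋯ ⊗ T (k - 1)`. -/
def tensorFamily {k : ℕ} (T : Fin k → H →ₗᵢ[ℂ] H) : TensorPow H k →L[ℂ] TensorPow H k :=
  tensorLift (RingHom.id ℂ) (fun x => tensor fun i => T i (x i)) zero_le_one (by
    intro x y
    simp [inner_tensor, tensorKernel])

theorem tensorFamily_tensor {k : ℕ} (T : Fin k → H →ₗᵢ[ℂ] H) (x : Fin k → H) :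
    tensorFamily T (tensor x) = tensor fun i => T i (x i) :=
  tensorLift_tensor ..

theorem tensorFamily_norm {k : ℕ} (T : Fin k → H →ₗᵢ[ℂ] H) (u : TensorPow H k) :
    ‖tensorFamily T u‖ = ‖u‖ :=
  (tensorLift_norm ..).trans (one_mul _)

theorem inner_tensorFamily {k : ℕ} (T : Fin k → H →ₗᵢ[ℂ] H) (u v : TensorPow H k) :
    ⟪tensorFamily T u, tensorFamily T v⟫_ℂ = ⟪u, v⟫_ℂ :=
  LinearIsometry.inner_map_map (⟨(tensorFamily T).toLinearMap, tensorFamily_norm T⟩ :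
    TensorPow H k →ₗᵢ[ℂ] TensorPow H k) u v

/-- Collects all dependence on the translations in one operator acting on a fixed vector, the form
that the spectral calculus needs. -/
theorem tensorCons_tensorMap (S T : H →ₗᵢ[ℂ] H) (h : H) {k : ℕ} (u : TensorPow H k) :
    tensorCons (S h) k (tensorMap T k u)
      = tensorFamily (Fin.cons S fun _ => T) (tensorCons h k u) := by
  have : (tensorCons (S h) k).comp (tensorMap T k)
      = (tensorFamily (Fin.cons S fun _ => T)).comp (tensorCons h k) :=
    tensor_hom_ext fun x => by
      simp only [ContinuousLinearMap.comp_apply, tensorCons_tensor, tensorMap_tensor,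
        tensorFamily_tensor]
      congr 1
      ext i
      refine Fin.cases rfl (fun j => rfl) i
  exact congrArg (fun A => A u) this

/-- The isometry S ⊗ 1 ⊗ ⋯ ⊗ 1 moves S from the left vector to the first factor on the right, where
it appears inverted. This is the counterpart for annihilation. -/
theorem inner_tensorCons_tensorMap (S T : H ≃ₗᵢ[ℂ] H) (h : H) {k : ℕ} (u : TensorPow H k)
    (v : TensorPow H (k + 1)) :
    ⟪tensorCons (S h) k u, tensorMap T.toLinearIsometry (k + 1) v⟫_ℂ
      = ⟪tensorCons h k u, tensorFamily (Fin.cons (T.trans S.symm).toLinearIsometry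
          fun _ => T.toLinearIsometry) v⟫_ℂ := by
  rw [← inner_tensorFamily (Fin.cons S.toLinearIsometry fun _ => LinearIsometry.id)
    (tensorCons h k u)]
  have h1 : tensorFamily (Fin.cons S.toLinearIsometry fun _ => LinearIsometry.id)
      (tensorCons h k u) = tensorCons (S h) k u := by
    have h2 : tensorMap (LinearIsometry.id : H →ₗᵢ[ℂ] H) k u = u := by
      have : tensorMap (LinearIsometry.id : H →ₗᵢ[ℂ] H) k = ContinuousLinearMap.id ℂ _ :=
        tensor_hom_ext fun x => by simp [tensorMap_tensor]
      rw [this, ContinuousLinearMap.id_apply]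
    have := tensorCons_tensorMap S.toLinearIsometry LinearIsometry.id h u
    rw [h2] at this
    exact this.symm
  have h3 : (tensorFamily (Fin.cons S.toLinearIsometry fun _ => LinearIsometry.id)).comp
      (tensorFamily (Fin.cons (T.trans S.symm).toLinearIsometry fun _ => T.toLinearIsometry))
      = tensorMap T.toLinearIsometry (k + 1) :=
    tensor_hom_ext fun x => by
      simp only [ContinuousLinearMap.comp_apply, tensorMap_tensor, tensorFamily_tensor]
      congr 1
      ext i
      refine Fin.cases ?_ (fun j => ?_) i <;> simp
  rw [h1, ← h3, ContinuousLinearMap.comp_apply]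

end TensorFamily

/-! ### Spectral representation on tensor powers. -/

section TensorSpectral

variable {M : Type*} [MeasurableSpace M] {ν : Measure M}

theorem memLp_mul {E : M → ℂ} (hE : Measurable E) (hE' : ∀ ξ, ‖E ξ‖ ≤ 1) (g : Lp ℂ 2 ν) :
    MemLp (fun ξ => E ξ * g ξ) 2 ν :=
  (Lp.memLp g).of_le (hE.aestronglyMeasurable.mul (Lp.aestronglyMeasurable g))
    (Eventually.of_forall fun ξ => by
      rw [norm_mul]
      exact mul_le_of_le_one_left (norm_nonneg _) (hE' ξ))

/-- Multiplication by a measurable function of modulus at most one. -/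
def mulLp {E : M → ℂ} (hE : Measurable E) (hE' : ∀ ξ, ‖E ξ‖ ≤ 1) : Lp ℂ 2 ν →L[ℂ] Lp ℂ 2 ν :=
  have hmem := memLp_mul hE hE'
  LinearMap.mkContinuous
    { toFun := fun g => (hmem g).toLp _
      map_add' := fun g h => by
        refine Lp.ext ?_
        filter_upwards [(hmem (g + h)).coeFn_toLp, (hmem g).coeFn_toLp, (hmem h).coeFn_toLp,
          Lp.coeFn_add g h, Lp.coeFn_add ((hmem g).toLp _) ((hmem h).toLp _)] with ξ h1 h2 h3 h4 h5
        rw [h1, h5, Pi.add_apply, h2, h3, h4, Pi.add_apply, mul_add]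
      map_smul' := fun c g => by
        refine Lp.ext ?_
        filter_upwards [(hmem (c • g)).coeFn_toLp, (hmem g).coeFn_toLp, Lp.coeFn_smul c g,
          Lp.coeFn_smul c ((hmem g).toLp _)] with ξ h1 h2 h3 h4
        simp only [RingHom.id_apply]
        rw [h1, h4, Pi.smul_apply, h2, h3, Pi.smul_apply, smul_eq_mul, smul_eq_mul]
        ring } 1 fun g => by
    rw [one_mul]
    refine Lp.norm_le_norm_of_ae_le ?_
    filter_upwards [(hmem g).coeFn_toLp] with ξ h1
    refine (congrArg norm h1).le.trans ?_
    rw [norm_mul]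
    exact mul_le_of_le_one_left (norm_nonneg _) (hE' ξ)

theorem mulLp_coe {E : M → ℂ} (hE : Measurable E) (hE' : ∀ ξ, ‖E ξ‖ ≤ 1) (g : Lp ℂ 2 ν) :
    mulLp hE hE' g =ᵐ[ν] fun ξ => E ξ * g ξ :=
  MemLp.coeFn_toLp (memLp_mul hE hE' g)

variable {H : Type*} [NormedAddCommGroup H] [InnerProductSpace ℂ H]
  {n : ℕ} {J : H →ₗᵢ[ℂ] Lp ℂ 2 ν} {P : M → Spacetime n} {τ : Spacetime n → H ≃ₗᵢ[ℂ] H}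

theorem isMultiplier_symm_trans
    (hτ : ∀ y, IsMultiplier J (fun ξ => Complex.exp (Complex.I * (mink (P ξ) y : ℂ))) (τ y))
    (y w : Spacetime n) : IsMultiplier J
      (fun ξ => Complex.exp (Complex.I * (mink (P ξ) (y - w) : ℂ))) ((τ y).trans (τ w).symm) := by
  intro v
  have h1 := hτ w ((τ w).symm (τ y v))
  rw [LinearIsometryEquiv.apply_symm_apply] at h1
  filter_upwards [h1, hτ y v] with ξ h1 h2
  rw [h2] at h1
  have h3 : Complex.exp (Complex.I * (mink (P ξ) y : ℂ))
      = Complex.exp (Complex.I * (mink (P ξ) (y - w) : ℂ))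
        * Complex.exp (Complex.I * (mink (P ξ) w : ℂ)) := by
    rw [← Complex.exp_add, ← mul_add, ← Complex.ofReal_add, ← mink_add_right, sub_add_cancel]
  rw [h3] at h1
  have h4 := Complex.exp_ne_zero (Complex.I * (mink (P ξ) w : ℂ))
  refine mul_left_cancel₀ h4 ?_
  change _ * (J ((τ w).symm (τ y v)) ξ) = _
  rw [← h1]
  ring

variable [SigmaFinite ν]

/-- The squared modulus is a product of integrable functions of separate variables. -/
theorem memLp_prod {k : ℕ} (x : Fin k → Lp ℂ 2 ν) :
    MemLp (fun p : Fin k → M => ∏ i, x i (p i)) 2 (Measure.pi fun _ => ν) := by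
  have hm : StronglyMeasurable fun p : Fin k → M => ∏ i, x i (p i) :=
    Finset.stronglyMeasurable_fun_prod _ fun i _ =>
      (Lp.stronglyMeasurable (x i)).comp_measurable (measurable_pi_apply i)
  rw [memLp_two_iff_integrable_sq_norm hm.aestronglyMeasurable]
  simp only [norm_prod, ← Finset.prod_pow]
  exact Integrable.fintype_prod (f := fun i ξ => ‖x i ξ‖ ^ 2) fun i => integrable_norm_sq (x i)

theorem inner_prod {k : ℕ} (x y : Fin k → Lp ℂ 2 ν) :
    ⟪(memLp_prod x).toLp _, (memLp_prod y).toLp _⟫_ℂ = ∏ i, ⟪x i, y i⟫_ℂ := by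
  rw [L2.inner_def]
  simp only [L2.inner_def]
  rw [← integral_fintype_prod_eq_prod (fun i ξ => ⟪x i ξ, y i ξ⟫_ℂ)]
  refine integral_congr_ae ?_
  filter_upwards [(memLp_prod x).coeFn_toLp, (memLp_prod y).coeFn_toLp] with p h1 h2
  rw [h1, h2]
  simp only [RCLike.inner_apply, map_prod, Finset.prod_mul_distrib]

/-- The isometry of the tensor power into the `L²` space of a product, which represents an
elementary tensor by the product of the functions which represent its factors. -/
def tensorIso (J : H →ₗᵢ[ℂ] Lp ℂ 2 ν) (k : ℕ) :
    TensorPow H k →ₗᵢ[ℂ] Lp ℂ 2 (Measure.pi fun _ : Fin k => ν) :=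
  have hψ : ∀ x y : Fin k → H, ⟪(memLp_prod fun i => J (x i)).toLp _,
      (memLp_prod fun i => J (y i)).toLp _⟫_ℂ
      = (((1 : ℝ) : ℂ)) ^ 2 * (RingHom.id ℂ) (tensorKernel x y) := by
    intro x y
    simp [inner_prod, tensorKernel]
  { toLinearMap := (tensorLift (RingHom.id ℂ) (fun x => (memLp_prod fun i => J (x i)).toLp _)
      zero_le_one hψ).toLinearMap
    norm_map' := fun u => (tensorLift_norm ..).trans (one_mul _) }

theorem tensorIso_tensor (J : H →ₗᵢ[ℂ] Lp ℂ 2 ν) {k : ℕ} (x : Fin k → H) :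
    tensorIso J k (tensor x) = (memLp_prod fun i => J (x i)).toLp _ :=
  tensorLift_tensor ..

/-- Both sides are bounded operators, so elementary tensors suffice; there the identities of the
factors hold almost everywhere, since coordinate projections pull null sets back to null sets. -/
theorem isMultiplier_tensorFamily {J : H →ₗᵢ[ℂ] Lp ℂ 2 ν} {k : ℕ} {T : Fin k → H →ₗᵢ[ℂ] H}
    {E : Fin k → M → ℂ} (hE : ∀ i, Measurable (E i)) (hE' : ∀ i ξ, ‖E i ξ‖ ≤ 1)
    (h : ∀ i, IsMultiplier J (E i) (T i)) :
    IsMultiplier (tensorIso J k) (fun p => ∏ i, E i (p i)) (tensorFamily T) := by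
  have hm : Measurable fun p : Fin k → M => ∏ i, E i (p i) :=
    Finset.measurable_fun_prod _ fun i _ => (hE i).comp (measurable_pi_apply i)
  have hb : ∀ p : Fin k → M, ‖∏ i, E i (p i)‖ ≤ 1 := fun p => by
    rw [norm_prod]
    exact Finset.prod_le_one (fun _ _ => norm_nonneg _) fun i _ => hE' i _
  have key : (tensorIso J k).toContinuousLinearMap.comp (tensorFamily T)
      = (mulLp hm hb).comp (tensorIso J k).toContinuousLinearMap := by
    refine tensor_hom_ext fun x => ?_
    simp only [ContinuousLinearMap.comp_apply, LinearIsometry.coe_toContinuousLinearMap,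
      tensorFamily_tensor, tensorIso_tensor]
    refine Lp.ext ?_
    have hae : ∀ᵐ p ∂(Measure.pi fun _ : Fin k => ν), ∀ i,
        J (T i (x i)) (p i) = E i (p i) * J (x i) (p i) :=
      ae_all_iff.mpr fun i =>
        (Measure.quasiMeasurePreserving_eval (μ := fun _ : Fin k => ν) i).ae (h i (x i))
    filter_upwards [hae, (memLp_prod fun i => J (T i (x i))).coeFn_toLp,
      (memLp_prod fun i => J (x i)).coeFn_toLp,
      mulLp_coe hm hb ((memLp_prod fun i => J (x i)).toLp _)] with p h1 h2 h3 h4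
    rw [h2, h4, h3, ← Finset.prod_mul_distrib]
    exact Finset.prod_congr rfl fun i _ => h1 i
  intro u
  have h1 := congrArg (fun A => A u) key
  have h2 : tensorIso J k (tensorFamily T u) = mulLp hm hb (tensorIso J k u) := h1
  rw [h2]
  exact mulLp_coe _ _ _

theorem prod_phase {k : ℕ} (t : Fin k → ℝ) :
    ∏ i, Complex.exp (Complex.I * (t i : ℂ)) = Complex.exp (Complex.I * ((∑ i, t i : ℝ) : ℂ)) := by
  rw [← Complex.exp_sum, ← Finset.mul_sum, Complex.ofReal_sum]

theorem mink_sum_left {k : ℕ} (x : Fin k → Spacetime n) (y : Spacetime n) :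
    mink (∑ i, x i) y = ∑ i, mink (x i) y := by
  simp [mink_eq, sum_dotProduct]

theorem measurable_phase (hP : Measurable P) (y : Spacetime n) :
    Measurable fun ξ => Complex.exp (Complex.I * (mink (P ξ) y : ℂ)) := by
  have hc : Continuous fun q : Spacetime n => Complex.exp (Complex.I * (mink q y : ℂ)) := by
    have : Continuous fun q : Spacetime n => mink q y :=
      continuous_mink.comp (continuous_id.prodMk continuous_const)
    fun_prop
  exact hc.measurable.comp hP

/-- Serves only for strong continuity in the translation, with an idle first variable. -/
theorem isSpectral_tensorMap (hP : Measurable P)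
    (hτ : ∀ y, IsMultiplier J (fun ξ => Complex.exp (Complex.I * (mink (P ξ) y : ℂ))) (τ y))
    (k : ℕ) : IsSpectral (tensorIso J k) (fun _ => 0) (fun p : Fin k → M => ∑ i, P (p i))
      (fun z => tensorMap (τ z.2).toLinearIsometry k) := by
  intro z v
  have h := isMultiplier_tensorFamily (T := fun _ : Fin k => (τ z.2).toLinearIsometry)
    (fun _ => measurable_phase hP z.2) (fun _ _ => (norm_phase _).le) (fun _ => hτ z.2) v
  refine h.trans (Eventually.of_forall fun p => ?_)
  simp only
  rw [prod_phase, mink_comm z.2, mink_sum_left]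
  simp [mink_eq]

/-- The created particle feels the translation by θx, and P·θx = x·θᵀP; the particles already
present feel the translation by y. -/
theorem isSpectral_creation (hP : Measurable P)
    (hτ : ∀ y, IsMultiplier J (fun ξ => Complex.exp (Complex.I * (mink (P ξ) y : ℂ))) (τ y))
    (θ : Matrix (Fin (n + 1)) (Fin (n + 1)) ℝ) (k : ℕ) :
    IsSpectral (tensorIso J (k + 1)) (fun p => (minkTranspose θ).mulVec (P (p 0)))
      (fun p : Fin (k + 1) → M => ∑ i : Fin k, P (p i.succ))
      (fun z => tensorFamily (Fin.cons (τ (θ.mulVec z.1)).toLinearIsometry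
        fun _ => (τ z.2).toLinearIsometry)) := by
  intro z v
  have h := isMultiplier_tensorFamily (J := J) (T := Fin.cons (τ (θ.mulVec z.1)).toLinearIsometry
        fun _ : Fin k => (τ z.2).toLinearIsometry)
    (E := fun i ξ => Complex.exp (Complex.I * (mink (P ξ)
      ((Fin.cons (θ.mulVec z.1) fun _ => z.2 : Fin (k + 1) → Spacetime n) i) : ℂ)))
    (fun _ => measurable_phase hP _) (fun _ _ => (norm_phase _).le)
    (fun i => by refine Fin.cases ?_ (fun j => ?_) i <;> exact hτ _) v
  refine h.trans (Eventually.of_forall fun p => ?_)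
  simp only
  rw [prod_phase, mink_comm z.2, mink_sum_left, ← mink_mulVec, Fin.sum_univ_succ, mink_comm]
  rfl

/-- The annihilated particle is translated by y - θx, so its momentum enters both spectral
functions; the other particles are translated by y. -/
theorem isSpectral_annihilation (hP : Measurable P)
    (hτ : ∀ y, IsMultiplier J (fun ξ => Complex.exp (Complex.I * (mink (P ξ) y : ℂ))) (τ y))
    (θ : Matrix (Fin (n + 1)) (Fin (n + 1)) ℝ) (k : ℕ) :
    IsSpectral (tensorIso J (k + 1)) (fun p => -(minkTranspose θ).mulVec (P (p 0)))
      (fun p : Fin (k + 1) → M => P (p 0) + ∑ i : Fin k, P (p i.succ))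
      (fun z => tensorFamily (Fin.cons
        ((τ z.2).trans (τ (θ.mulVec z.1)).symm).toLinearIsometry
        fun _ => (τ z.2).toLinearIsometry)) := by
  intro z v
  have h := isMultiplier_tensorFamily (J := J)
    (T := Fin.cons ((τ z.2).trans (τ (θ.mulVec z.1)).symm).toLinearIsometry
        fun _ : Fin k => (τ z.2).toLinearIsometry)
    (E := fun i ξ => Complex.exp (Complex.I * (mink (P ξ)
      ((Fin.cons (z.2 - θ.mulVec z.1) fun _ => z.2 : Fin (k + 1) → Spacetime n) i) : ℂ)))
    (fun _ => measurable_phase hP _) (fun _ _ => (norm_phase _).le)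
    (fun i => by
      refine Fin.cases ?_ (fun j => ?_) i
      · exact isMultiplier_symm_trans hτ _ _
      · exact hτ _) v
  refine h.trans (Eventually.of_forall fun p => ?_)
  simp only
  rw [prod_phase, Fin.sum_univ_succ, mink_neg_right, ← mink_mulVec, mink_comm z.2, mink_add_left,
    mink_sum_left]
  simp only [Fin.cons_zero, Fin.cons_succ]
  rw [sub_eq_add_neg, mink_add_right, mink_neg_right, mink_comm (θ.mulVec z.1)]
  congr 4
  ring

end TensorSpectral

/-! ### Warped convolution of a field operator on finite particle vectors. -/

section TwistedField

variable {H : Type*} [NormedAddCommGroup H] [InnerProductSpace ℂ H]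

/-- The field operator `a(h) + a*(g)` on the vectors of finite particle number. -/
def fieldOp (g h : H) : Fock H →ₗ.[ℂ] Fock H where
  domain := finiteParticle H
  toFun := annihilation h + creation g

theorem fieldOp_apply (g h : H) (Ψ : Fock H) (hΨ : Ψ ∈ finiteParticle H) :
    applyOrZero (fieldOp g h) Ψ = annihilation h ⟨Ψ, hΨ⟩ + creation g ⟨Ψ, hΨ⟩ :=
  applyOrZero_of_mem (fieldOp g h) hΨ

/-- Equality of the domains holds because the second quantization of T and of its inverse preserve
finite particle number. -/
theorem conjugate_fieldOp {σ : ℂ →+* ℂ} [UnitaryScalar σ] [RingHomInvPair σ σ] (T : H ≃ₛₗᵢ[σ] H)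
    (g h : H) : conjugate (secondQuant T) (fieldOp g h) = fieldOp (T g) (T h) := by
  refine LinearPMap.ext (Submodule.ext fun Ψ => secondQuant_mem_iff T.symm) ?_
  intro Ψ h1 h2
  have h3 : secondQuant T.symm Ψ ∈ finiteParticle H := h1
  have e : (⟨secondQuant T ((secondQuant T).symm Ψ), secondQuant_mem T h3⟩ : finiteParticle H)
      = ⟨Ψ, h2⟩ := Subtype.ext ((secondQuant T).apply_symm_apply Ψ)
  change secondQuant T (annihilation h ⟨(secondQuant T).symm Ψ, h3⟩
    + creation g ⟨(secondQuant T).symm Ψ, h3⟩) = annihilation (T h) ⟨Ψ, h2⟩ + creation (T g) ⟨Ψ, h2⟩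
  rw [map_add, secondQuant_annihilation, secondQuant_creation]
  change annihilation (T h) ⟨secondQuant T ((secondQuant T).symm Ψ), _⟩
    + creation (T g) ⟨secondQuant T ((secondQuant T).symm Ψ), _⟩ = _
  rw [e]

/-- The creation operator followed by `S` before the symmetrization. -/
def twistedCreation (k : ℕ) (S : TensorPow H (k + 1) →L[ℂ] TensorPow H (k + 1)) (g : H) :
    symPow H k →L[ℂ] symPow H (k + 1) :=
  ((Real.sqrt (k + 1) : ℝ) : ℂ) •
    ((symPow H (k + 1)).orthogonalProjectionOnto.comp
      (S.comp ((tensorCons g k).comp (symPow H k).subtypeL)))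

/-- The contraction with `h` of a tensor, symmetrized. -/
def contraction (k : ℕ) (h : H) : TensorPow H (k + 1) →L[ℂ] symPow H k :=
  ((Real.sqrt (k + 1) : ℝ) : ℂ) •
    ((symPow H k).orthogonalProjectionOnto.comp (ContinuousLinearMap.adjoint (tensorCons h k)))

/-- The annihilation operator preceded by `S`. -/
def twistedAnnihilation (k : ℕ) (S : TensorPow H (k + 1) →L[ℂ] TensorPow H (k + 1)) (h : H) :
    symPow H (k + 1) →L[ℂ] symPow H k :=
  (contraction k h).comp (S.comp (symPow H (k + 1)).subtypeL)

theorem inner_contraction (k : ℕ) (h : H) (u : symPow H k) (v : TensorPow H (k + 1)) :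
    ⟪u, contraction k h v⟫_ℂ
      = ((Real.sqrt (k + 1) : ℝ) : ℂ) * ⟪tensorCons h k (u : TensorPow H k), v⟫_ℂ := by
  have h1 := Submodule.inner_orthogonalProjectionOnto_eq_of_mem_left (𝕜 := ℂ) u
    (ContinuousLinearMap.adjoint (tensorCons h k) v)
  rw [ContinuousLinearMap.adjoint_inner_right] at h1
  rw [← h1]
  exact inner_smul_right (𝕜 := ℂ) (E := symPow H k) _ _ _

theorem inner_twistedCreation (k : ℕ) (S : TensorPow H (k + 1) →L[ℂ] TensorPow H (k + 1)) (g : H)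
    (u : symPow H k) (v : symPow H (k + 1)) :
    ⟪twistedCreation k S g u, v⟫_ℂ = ((Real.sqrt (k + 1) : ℝ) : ℂ) *
      ⟪S (tensorCons g k (u : TensorPow H k)), (v : TensorPow H (k + 1))⟫_ℂ := by
  have h1 := Submodule.inner_orthogonalProjectionOnto_eq_of_mem_right (𝕜 := ℂ) v
    (S (tensorCons g k (u : TensorPow H k)))
  rw [← h1, ← Complex.conj_ofReal]
  exact inner_smul_left (𝕜 := ℂ) (E := symPow H (k + 1)) _ _ _

/-- Reduces hermiticity of the deformed field to an adjointness relation between the two phase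
operators on the full tensor power. -/
theorem twistedAnnihilation_eq_adjoint (k : ℕ)
    {S S' : TensorPow H (k + 1) →L[ℂ] TensorPow H (k + 1)}
    (hS : ∀ u v, ⟪S u, v⟫_ℂ = ⟪u, S' v⟫_ℂ) (h : H) :
    twistedAnnihilation k S' h = ContinuousLinearMap.adjoint (twistedCreation k S h) := by
  refine ContinuousLinearMap.ext fun v => ext_inner_left ℂ fun u => ?_
  rw [ContinuousLinearMap.adjoint_inner_right, inner_twistedCreation, hS]
  exact inner_contraction k h u _

theorem creationPart_symMap (S T : H →ₗᵢ[ℂ] H) (g : H) (k : ℕ) (u : symPow H k) :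
    creationPart (S g) k (symMap T k u)
      = twistedCreation k (tensorFamily (Fin.cons S fun _ => T)) g u := by
  change ((Real.sqrt (k + 1) : ℝ) : ℂ) •
      (symPow H (k + 1)).orthogonalProjectionOnto (tensorCons (S g) k (tensorMap T k u))
    = ((Real.sqrt (k + 1) : ℝ) : ℂ) •
      (symPow H (k + 1)).orthogonalProjectionOnto (tensorFamily _ (tensorCons g k u))
  rw [tensorCons_tensorMap]

/-- Paired with a symmetric vector, the annihilation operator is a contraction with h up to √(k +
1). The contraction stays fixed, and all translations act on u before it. -/
theorem annihilationPart_symMap (S T : H ≃ₗᵢ[ℂ] H) (h : H) (k : ℕ) (u : symPow H (k + 1)) :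
    annihilationPart (S h) k (symMap T.toLinearIsometry (k + 1) u)
      = twistedAnnihilation k (tensorFamily (Fin.cons (T.trans S.symm).toLinearIsometry
          fun _ => T.toLinearIsometry)) h u := by
  refine ext_inner_left ℂ fun w => ?_
  rw [annihilationPart, ContinuousLinearMap.adjoint_inner_right]
  have h1 := inner_twistedCreation k (ContinuousLinearMap.id ℂ _) (S h) w
    (symMap T.toLinearIsometry (k + 1) u)
  have h2 := inner_contraction k h w (tensorFamily (Fin.cons (T.trans S.symm).toLinearIsometry
          fun _ => T.toLinearIsometry) (u : TensorPow H (k + 1)))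
  refine h1.trans (Eq.trans ?_ h2.symm)
  rw [← inner_tensorCons_tensorMap]
  rfl

theorem fieldOp_rotated (S T : H ≃ₗᵢ[ℂ] H) (g h : H) {Ψ : Fock H} (hΨ : Ψ ∈ finiteParticle H) :
    secondQuant S (applyOrZero (fieldOp g h) ((secondQuant S).symm (secondQuant T Ψ)))
      = annihilation (S h) ⟨secondQuant T Ψ, secondQuant_mem T hΨ⟩
        + creation (S g) ⟨secondQuant T Ψ, secondQuant_mem T hΨ⟩ := by
  rw [← applyOrZero_conjugate, LinearIsometryEquiv.apply_symm_apply, conjugate_fieldOp,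
    fieldOp_apply _ _ _ (secondQuant_mem T hΨ)]

variable {M : Type*} [MeasurableSpace M] {ν : Measure M} {n : ℕ}

/-- A bounded operator passes through the integral and the limit. It is applied with symmetrization
for creation and with contraction for annihilation. -/
theorem IsSpectral.hasWarped {K F : Type*} [NormedAddCommGroup K] [InnerProductSpace ℂ K]
    [CompleteSpace K] [NormedAddCommGroup F] [InnerProductSpace ℂ F] [CompleteSpace F] [SFinite ν]
    {J : K →ₗᵢ[ℂ] Lp ℂ 2 ν} {a b : M → Spacetime n} {R : Spacetime n × Spacetime n → K → K}
    (h : IsSpectral J a b R) (ha : Measurable a) (hb : Measurable b) {S : K → K}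
    (hS : IsMultiplier J (fun ξ => Complex.exp (Complex.I * (mink (a ξ) (b ξ) : ℂ))) S)
    (L : K →L[ℂ] F) (v : K) :
    (∀ (χ : 𝓢(Spacetime n × Spacetime n, ℂ)) (ε : ℝ), 0 < ε →
      Integrable fun z : Spacetime n × Spacetime n =>
        (Complex.exp (-Complex.I * (mink z.1 z.2 : ℂ)) * χ (ε • z)) • L (R z v)) ∧
    ∀ χ : 𝓢(Spacetime n × Spacetime n, ℂ), χ 0 = 1 →
      Tendsto (fun ε : ℝ => ((2 * (Real.pi : ℂ)) ^ (n + 1))⁻¹ •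
        ∫ z : Spacetime n × Spacetime n,
          (Complex.exp (-Complex.I * (mink z.1 z.2 : ℂ)) * χ (ε • z)) • L (R z v))
        (𝓝[>] 0) (𝓝 (L (S v))) := by
  have hi : ∀ (χ : 𝓢(Spacetime n × Spacetime n, ℂ)) (ε : ℝ), 0 < ε →
      Integrable fun z : Spacetime n × Spacetime n =>
        (Complex.exp (-Complex.I * (mink z.1 z.2 : ℂ)) * χ (ε • z)) • L (R z v) := by
    intro χ ε hε
    refine (L.integrable_comp (h.integrable χ hε v)).congr (Eventually.of_forall fun z => ?_)
    exact map_smul L _ _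
  refine ⟨hi, fun χ hχ => ?_⟩
  have h1 := (L.continuous.tendsto _).comp (h.tendsto_integral ha hb hχ hS v)
  refine h1.congr' ?_
  filter_upwards [self_mem_nhdsWithin] with ε hε
  rw [Function.comp_apply, map_smul, ← L.integral_comp_comm (h.integrable χ hε v)]
  simp only [map_smul]

variable [SigmaFinite ν] {J : H →ₗᵢ[ℂ] Lp ℂ 2 ν} {P : M → Spacetime n}
  {τ : Spacetime n → H ≃ₗᵢ[ℂ] H}

/-- The warped convolution of `a(h) + a*(g)` with respect to a representation of the translations
with the momentum function `P` exists on all vectors of finite particle number. -/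
theorem exists_twist (hP : Measurable P)
    (hτ : ∀ y, IsMultiplier J (fun ξ => Complex.exp (Complex.I * (mink (P ξ) y : ℂ))) (τ y))
    {X : Fin (n + 1) → (Fock H →ₗ.[ℂ] Fock H)}
    (hX : IsExponential X fun y => secondQuant (τ y)) (θ : Matrix (Fin (n + 1)) (Fin (n + 1)) ℝ) :
    ∃ S S' : ∀ k, TensorPow H (k + 1) →L[ℂ] TensorPow H (k + 1),
      (IsMinkSkew θ → ∀ k u v, ⟪S k u, v⟫_ℂ = ⟪u, S' k v⟫_ℂ) ∧
      ∀ (g h : H) (Ψ : finiteParticle H), HasWarpedValue X θ (fieldOp g h) Ψ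
        (lowerOp (fun k => twistedAnnihilation k (S' k) h) Ψ
          + raiseOp (fun k => twistedCreation k (S k) g) Ψ) := by
  have hexp : ∀ y, expI X y = secondQuant (τ y) := fun y => congrFun hX.expI_eq y
  have hm : ∀ A : Matrix (Fin (n + 1)) (Fin (n + 1)) ℝ, Measurable fun x : Spacetime n =>
      A.mulVec x := fun A => by fun_prop
  have ha : ∀ k : ℕ, Measurable fun p : Fin (k + 1) → M => (minkTranspose θ).mulVec (P (p 0)) :=
    fun k => (hm _).comp (hP.comp (measurable_pi_apply 0))
  have hs : ∀ k : ℕ, Measurable fun p : Fin (k + 1) → M => ∑ i : Fin k, P (p i.succ) :=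
    fun k => Finset.measurable_fun_sum _ fun i _ => hP.comp (measurable_pi_apply _)
  have hc := fun k : ℕ => isSpectral_creation hP hτ θ k
  have hd := fun k : ℕ => isSpectral_annihilation hP hτ θ k
  have hd2 : ∀ k : ℕ, Measurable fun p : Fin (k + 1) → M => P (p 0) + ∑ i : Fin k, P (p i.succ) :=
    fun k => (hP.comp (measurable_pi_apply 0)).add (hs k)
  have hSc := fun k : ℕ => (hc k).exists_multiplier (ha k) (hs k)
  have hSd := fun k : ℕ => (hd k).exists_multiplier (ha k).neg (hd2 k)
  choose S hS using hSc
  choose S' hS' using hSd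
  -- The phases are exp(iθᵀp₀·(p₁ + ⋯ + p_k)) for creation and exp(-iθᵀp₀·(p₀ + ⋯ + p_k)) for
  -- annihilation. They are chosen before the field vectors g and h, which is what continuity and
  -- hermiticity use later.
  refine ⟨fun k => (S k).toContinuousLinearMap, fun k => (S' k).toContinuousLinearMap,
    fun hθ k u v => ?_, fun g h Ψ => ?_⟩
  · refine (hS k).inner_map (hS' k) (fun p => ?_) u v
    -- For skew θ the p₀ term in the annihilation phase vanishes, and the two phases become complex
    -- conjugate.
    have h0 : mink ((minkTranspose θ).mulVec (P (p 0))) (P (p 0)) = 0 := by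
      have h1 := mink_mulVec θ (P (p 0)) (P (p 0))
      have h2 : mink ((minkTranspose θ).mulVec (P (p 0))) (P (p 0))
          = - mink (θ.mulVec (P (p 0))) (P (p 0)) := by
        rw [hθ, Matrix.neg_mulVec, mink_neg_left]
      rw [mink_comm] at h1
      rw [mink_comm (P (p 0))] at h1
      rw [mink_comm (P (p 0))] at h1
      linarith
    rw [← Complex.exp_conj, map_mul, Complex.conj_I, Complex.conj_ofReal, mink_neg_left,
      mink_add_right, h0]
    congr 1
    push_cast
    ring
  · obtain ⟨Ψ, hΨ⟩ := Ψ
    induction hΨ using finiteParticle_induction with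
    | zero =>
      have e : (⟨0, Submodule.zero_mem _⟩ : finiteParticle H) = 0 := rfl
      rw [e, map_zero, map_zero, add_zero]
      exact HasWarpedValue.zero X θ _
    | add Ψ Φ hΨ hΦ h1 h2 =>
      have e : (⟨Ψ + Φ, Submodule.add_mem _ hΨ hΦ⟩ : finiteParticle H) = ⟨Ψ, hΨ⟩ + ⟨Φ, hΦ⟩ := rfl
      rw [e, map_add, map_add, add_add_add_comm]
      exact h1.add h2
    | single k u =>
      have hmem := fockSingle_mem k u
      -- The annihilation part is left unevaluated here, since its form depends on whether a
      -- particle is present.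
      have hw : ∀ χ ε z, warpIntegrand X θ (fieldOp g h) χ ε (fockSingle H k u) z
          = (Complex.exp (-Complex.I * (mink z.1 z.2 : ℂ)) * χ (ε • z)) •
            (lowerOp (annihilationPart (τ (θ.mulVec z.1) h))
                ⟨fockSingle H k (symMap (τ z.2).toLinearIsometry k u), fockSingle_mem k _⟩
              + fockSingle H (k + 1) (twistedCreation k (tensorFamily
                (Fin.cons (τ (θ.mulVec z.1)).toLinearIsometry
                  fun _ => (τ z.2).toLinearIsometry)) g u)) := by
        intro χ ε z
        have e : (⟨secondQuant (τ z.2) (fockSingle H k u), secondQuant_mem _ hmem⟩ :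
            finiteParticle H)
            = ⟨fockSingle H k (symMap (τ z.2).toLinearIsometry k u), fockSingle_mem k _⟩ :=
          Subtype.ext (secondQuant_fockSingle _ _ _)
        have e2 := creationPart_symMap (τ (θ.mulVec z.1)).toLinearIsometry
          (τ z.2).toLinearIsometry g k u
        rw [warpIntegrand, hexp, hexp, fieldOp_rotated _ _ _ _ hmem, e, annihilation_eq_lowerOp,
          creation_eq_raiseOp, raiseOp_fockSingle]
        exact congrArg (fun t => (Complex.exp (-Complex.I * (mink z.1 z.2 : ℂ)) * χ (ε • z)) •
          (_ + fockSingle H (k + 1) t)) e2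
      let Lc : TensorPow H (k + 1) →L[ℂ] Fock H := ((Real.sqrt (k + 1) : ℝ) : ℂ) •
        (fockSingle H (k + 1)).comp (symPow H (k + 1)).orthogonalProjectionOnto
      have hLc : ∀ T : TensorPow H (k + 1) →L[ℂ] TensorPow H (k + 1),
          fockSingle H (k + 1) (twistedCreation k T g u) = Lc (T (tensorCons g k u)) := by
        intro T
        exact map_smul (fockSingle H (k + 1)) _ _
      obtain ⟨ic, tc⟩ := (hc k).hasWarped (ha k) (hs k) (hS k) Lc (tensorCons g k u)
      have hmt : ∀ x y : Spacetime n, (expI X (θ.mulVec x)).symm (expI X y (fockSingle H k u))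
          ∈ (fieldOp g h).domain := by
        intro x y
        rw [hexp, hexp, secondQuant_symm]
        exact secondQuant_mem _ (secondQuant_mem _ hmem)
      rw [raiseOp_fockSingle, hLc]
      simp only [hLc] at hw
      -- On the vacuum sector only creation contributes. Otherwise the particle number must be a
      -- successor for the annihilation part to be a contraction of u.
      cases k with
      | zero =>
        rw [lowerOp_fockSingle_zero, zero_add]
        have hw' : ∀ χ ε, warpIntegrand X θ (fieldOp g h) χ ε (fockSingle H 0 u)
            = fun z => (Complex.exp (-Complex.I * (mink z.1 z.2 : ℂ)) * χ (ε • z)) •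
              Lc (tensorFamily (Fin.cons (τ (θ.mulVec z.1)).toLinearIsometry
                  fun _ => (τ z.2).toLinearIsometry) (tensorCons g 0 u)) := by
          intro χ ε
          ext1 z
          rw [hw, lowerOp_fockSingle_zero, zero_add]
        refine ⟨hmem, hmt, fun χ _ ε hε => ?_, fun χ hχ => ?_⟩
        · rw [hw']
          exact ic χ ε hε
        · simp only [hw']
          exact tc χ hχ
      | succ k =>
        let La : TensorPow H (k + 1) →L[ℂ] Fock H := (fockSingle H k).comp (contraction k h)
        obtain ⟨ia, ta⟩ := (hd k).hasWarped (ha k).neg (hd2 k) (hS' k) La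
          (u : TensorPow H (k + 1))
        rw [lowerOp_fockSingle_succ]
        have hw' : ∀ χ ε, warpIntegrand X θ (fieldOp g h) χ ε (fockSingle H (k + 1) u)
            = fun z => (Complex.exp (-Complex.I * (mink z.1 z.2 : ℂ)) * χ (ε • z)) •
                La (tensorFamily (Fin.cons ((τ z.2).trans (τ (θ.mulVec z.1)).symm).toLinearIsometry
                  fun _ => (τ z.2).toLinearIsometry) (u : TensorPow H (k + 1)))
              + (Complex.exp (-Complex.I * (mink z.1 z.2 : ℂ)) * χ (ε • z)) •
                Lc (tensorFamily (Fin.cons (τ (θ.mulVec z.1)).toLinearIsometry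
                  fun _ => (τ z.2).toLinearIsometry) (tensorCons g (k + 1) u)) := by
          intro χ ε
          ext1 z
          rw [hw, lowerOp_fockSingle_succ, annihilationPart_symMap, smul_add]
          rfl
        refine ⟨hmem, hmt, fun χ _ ε hε => ?_, fun χ hχ => ?_⟩
        · rw [hw']
          exact (ia χ ε hε).add (ic χ ε hε)
        · refine ((ta χ hχ).add (tc χ hχ)).congr' ?_
          filter_upwards [self_mem_nhdsWithin] with ε hε
          rw [hw', ← smul_add]
          exact congrArg _ (integral_add (ia χ ε hε) (ic χ ε hε)).symm

end TwistedField

/-! ### The stabilizer of the right wedge and the matrices attached to wedges. -/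

section WedgeGeometry

variable {n : ℕ}

theorem minkTranspose_mul (M N : Matrix (Fin (n + 1)) (Fin (n + 1)) ℝ) :
    minkTranspose (M * N) = minkTranspose N * minkTranspose M := by
  simp only [minkTranspose, Matrix.transpose_mul, mul_assoc]
  rw [← mul_assoc (metric n) (metric n), metric_mul_self, one_mul]

theorem minkTranspose_smul (c : ℝ) (M : Matrix (Fin (n + 1)) (Fin (n + 1)) ℝ) :
    minkTranspose (c • M) = c • minkTranspose M := by
  simp [minkTranspose]

theorem minkTranspose_neg (M : Matrix (Fin (n + 1)) (Fin (n + 1)) ℝ) :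
    minkTranspose (-M) = -minkTranspose M := by
  simp [minkTranspose]

theorem minkTranspose_one : minkTranspose (1 : Matrix (Fin (n + 1)) (Fin (n + 1)) ℝ) = 1 := by
  simp [minkTranspose, metric_mul_self]

namespace ProperOrthochronous

/-- The first column of a proper orthochronous Lorentz transformation is a future directed unit
vector. -/
theorem col_zero (Λ : ProperOrthochronous n) :
    (fun i => Λ.mat i 0) = shellPoint 1 (fun i : Fin n => Λ.mat i.succ 0) := by
  have h := congrFun (congrFun Λ.isLorentz 0) 0
  simp only [metric] at h
  rw [Matrix.mul_apply] at h
  simp [Matrix.mul_diagonal, Fin.sum_univ_succ] at h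
  have h2 : (Λ.mat 0 0) ^ 2 = energy 1 (fun i : Fin n => Λ.mat i.succ 0) ^ 2 := by
    rw [energy_sq]
    have h3 : ∑ i : Fin n, (Λ.mat i.succ 0) ^ 2 = ∑ i : Fin n, Λ.mat i.succ 0 * Λ.mat i.succ 0 :=
      Finset.sum_congr rfl fun i _ => pow_two _
    rw [h3]
    linarith
  have : Fact ((0 : ℝ) < 1) := ⟨one_pos⟩
  ext i
  refine Fin.cases ?_ (fun j => rfl) i
  exact (sq_eq_sq₀ Λ.orthochronous.le (energy_pos _).le).mp h2

/-- The product of two proper orthochronous Lorentz transformations. -/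
def mul (Λ Λ' : ProperOrthochronous n) : ProperOrthochronous n where
  mat := Λ.mat * Λ'.mat
  isLorentz := by
    have h := Λ.isLorentz
    have h' := Λ'.isLorentz
    unfold IsLorentz at h h' ⊢
    rw [Matrix.transpose_mul, mul_assoc, mul_assoc, ← mul_assoc (metric n), ← mul_assoc _ _ Λ'.mat,
      ← mul_assoc Λ.mat.transpose, h, ← mul_assoc, h']
  det_eq_one := by rw [Matrix.det_mul, Λ.det_eq_one, Λ'.det_eq_one, one_mul]
  orthochronous := by
    have : Fact ((0 : ℝ) < 1) := ⟨one_pos⟩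
    -- The first column of Λ' lies on the upper mass shell of mass 1, which Λ maps to vectors with
    -- positive time component.
    have h := time_mulVec_pos (m := 1) Λ (fun i : Fin n => Λ'.mat i.succ 0)
    rw [← col_zero] at h
    simpa [Matrix.mul_apply, Matrix.mulVec, dotProduct] using h

end ProperOrthochronous

/-- With an explicit sign s the transformations Λ and jΛ are treated at once, and s is also the sign
in γ. -/
theorem isWedgeTransformation_iff {M : Matrix (Fin (n + 1)) (Fin (n + 1)) ℝ} :
    IsWedgeTransformation M ↔
      ∃ (s : ℝ) (Λ : ProperOrthochronous n), (s = 1 ∨ s = -1) ∧ M = s • Λ.mat := by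
  constructor
  · rintro ⟨Λ, rfl | rfl⟩
    · exact ⟨1, Λ, Or.inl rfl, (one_smul _ _).symm⟩
    · exact ⟨-1, Λ, Or.inr rfl, by simp⟩
  · rintro ⟨s, Λ, rfl | rfl, rfl⟩
    · exact ⟨Λ, Or.inl (one_smul _ _)⟩
    · exact ⟨Λ, Or.inr (by simp)⟩

theorem gammaMap_smul {s : ℝ} (hs : s = 1 ∨ s = -1) (Λ : ProperOrthochronous n)
    (θ : Matrix (Fin (n + 1)) (Fin (n + 1)) ℝ) :
    gammaMap (s • Λ.mat) θ = s • (Λ.mat * θ * minkTranspose Λ.mat) := by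
  have h := Λ.orthochronous
  rcases hs with rfl | rfl
  · rw [gammaMap, one_smul, one_smul, if_pos h]
  · rw [gammaMap, if_neg, minkTranspose_smul]
    · simp
    · simp [h.le]

theorem gammaMap_mat (Λ : ProperOrthochronous n) (θ : Matrix (Fin (n + 1)) (Fin (n + 1)) ℝ) :
    gammaMap Λ.mat θ = Λ.mat * θ * minkTranspose Λ.mat :=
  if_pos Λ.orthochronous

namespace IsWedgeTransformation

variable {M N : Matrix (Fin (n + 1)) (Fin (n + 1)) ℝ}

theorem mul (hM : IsWedgeTransformation M) (hN : IsWedgeTransformation N) :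
    IsWedgeTransformation (M * N) := by
  rw [isWedgeTransformation_iff] at hM hN ⊢
  obtain ⟨s, Λ, hs, rfl⟩ := hM
  obtain ⟨t, Λ', ht, rfl⟩ := hN
  refine ⟨s * t, Λ.mul Λ', ?_, ?_⟩
  · rcases hs with rfl | rfl <;> rcases ht with rfl | rfl <;> simp
  · rw [Matrix.smul_mul, Matrix.mul_smul, smul_smul]
    rfl

/-- The signs multiply and the Lorentzian transpose reverses products, so γ is a group action. -/
theorem gammaMap_mul (hM : IsWedgeTransformation M) (hN : IsWedgeTransformation N)
    (θ : Matrix (Fin (n + 1)) (Fin (n + 1)) ℝ) :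
    gammaMap (M * N) θ = gammaMap M (gammaMap N θ) := by
  rw [isWedgeTransformation_iff] at hM hN
  obtain ⟨s, Λ, hs, rfl⟩ := hM
  obtain ⟨t, Λ', ht, rfl⟩ := hN
  have hst : s * t = 1 ∨ s * t = -1 := by
    rcases hs with rfl | rfl <;> rcases ht with rfl | rfl <;> simp
  have e : (s • Λ.mat) * (t • Λ'.mat) = (s * t) • (Λ.mul Λ').mat := by
    rw [Matrix.smul_mul, Matrix.mul_smul, smul_smul]
    rfl
  rw [e, gammaMap_smul hst, gammaMap_smul hs, gammaMap_smul ht]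
  change (s * t) • (Λ.mat * Λ'.mat * θ * minkTranspose (Λ.mat * Λ'.mat)) = _
  rw [minkTranspose_mul, Matrix.mul_smul, Matrix.smul_mul, smul_smul]
  simp only [mul_assoc]

theorem exists_inv (hM : IsWedgeTransformation M) :
    ∃ M', IsWedgeTransformation M' ∧ M' * M = 1 ∧ M * M' = 1 := by
  obtain ⟨s, Λ, hs, rfl⟩ := isWedgeTransformation_iff.mp hM
  have hss : s * s = 1 := by rcases hs with rfl | rfl <;> simp
  refine ⟨s • Λ.inv.mat, isWedgeTransformation_iff.mpr ⟨s, _, hs, rfl⟩, ?_, ?_⟩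
  · rw [Matrix.smul_mul, Matrix.mul_smul, smul_smul, hss, one_smul, Λ.inv_mul_mat]
  · rw [Matrix.smul_mul, Matrix.mul_smul, smul_smul, hss, one_smul, Λ.mat_mul_inv]

end IsWedgeTransformation

theorem gammaMap_isMinkSkew {M θ : Matrix (Fin (n + 1)) (Fin (n + 1)) ℝ} (hθ : IsMinkSkew θ) :
    IsMinkSkew (gammaMap M θ) := by
  have h : minkTranspose (M * θ * minkTranspose M) = -(M * θ * minkTranspose M) := by
    rw [minkTranspose_mul, minkTranspose_mul, minkTranspose_transpose, hθ]
    simp [mul_assoc]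
  unfold IsMinkSkew gammaMap
  split_ifs
  · exact h
  · rw [minkTranspose_neg, h]

/-- The (0,1) block is symmetric and the metric has opposite signs on it; the (2,3) block is
antisymmetric and the signs agree. -/
theorem IsAdmissible.isMinkSkew {θ : Matrix (Fin (n + 1)) (Fin (n + 1)) ℝ} (h : IsAdmissible θ) :
    IsMinkSkew θ := by
  obtain ⟨l, e, _, _, h⟩ := h
  ext i j
  have h1 : minkTranspose θ i j = (Fin.cons 1 (fun _ => -1) : Fin (n + 1) → ℝ) i * θ j i
      * (Fin.cons 1 (fun _ => -1) : Fin (n + 1) → ℝ) j := by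
    simp only [minkTranspose, metric, Matrix.mul_diagonal, Matrix.diagonal_mul,
      Matrix.transpose_apply]
  have hg : ∀ i : Fin (n + 1), (Fin.cons 1 (fun _ => -1) : Fin (n + 1) → ℝ) i
      = if i.val = 0 then 1 else -1 := fun i => by
    refine Fin.cases ?_ (fun j => ?_) i <;> simp
  rw [h1, hg, hg, Matrix.neg_apply, h, h]
  split_ifs <;> first | (exfalso; omega) | simp

theorem mul_metric_mul_transpose_apply {N : Matrix (Fin (n + 1)) (Fin (n + 1)) ℝ}
    (hL : N * minkTranspose N = 1) (i j : Fin (n + 1)) :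
    N i 0 * N j 0 - ∑ l : Fin n, N i l.succ * N j l.succ = metric n i j := by
  have h1 : N * metric n * N.transpose = metric n := by
    have := congrArg (· * metric n) hL
    simp only [minkTranspose, one_mul] at this
    rwa [← mul_assoc, mul_assoc, metric_mul_self, mul_one, ← mul_assoc] at this
  have h2 := congrFun (congrFun h1 i) j
  rw [Matrix.mul_apply, Fin.sum_univ_succ] at h2
  simp only [metric, Matrix.mul_diagonal, Matrix.transpose_apply, Fin.cons_zero, Fin.cons_succ]
    at h2
  rw [← metric] at h2
  rw [← h2, mul_one, sub_eq_add_neg, ← Finset.sum_neg_distrib]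
  congr 1
  exact Finset.sum_congr rfl fun l _ => by ring

/-- The entries of a Lorentz transformation which maps the right wedge into itself. -/
theorem wedge_stabilizer_entries {k : ℕ} {N : Matrix (Fin (k + 1 + 1)) (Fin (k + 1 + 1)) ℝ}
    (hL : N * minkTranspose N = 1) (hN : ∀ x ∈ rightWedge (k + 1), N.mulVec x ∈ rightWedge (k + 1))
    {s : ℝ} (hs : s = 1 ∨ s = -1) (hpos : 0 < s * N 0 0) :
    N 0 0 = s * N 1 1 ∧ N 1 0 = s * N 0 1 ∧ N 1 1 ^ 2 - N 0 1 ^ 2 = 1 ∧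
    (∀ i : Fin k, N 0 i.succ.succ = 0 ∧ N 1 i.succ.succ = 0) ∧
    (∀ i : Fin k, N i.succ.succ 0 = 0 ∧ N i.succ.succ 1 = 0) := by
  have hmul := mul_metric_mul_transpose_apply hL
  -- The wedge contains the whole line e₁ + t eᵢ for every i ≥ 2.
  have hx : ∀ (i : Fin k) (t : ℝ), |N 0 1 + t * N 0 i.succ.succ| < N 1 1 + t * N 1 i.succ.succ := by
    intro i t
    have hmem : Pi.single 1 1 + t • Pi.single i.succ.succ 1 ∈ rightWedge (k + 1) := by
      have h01 : (1 : Fin (k + 1 + 1)) ≠ i.succ.succ := by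
        intro h
        have := congrArg Fin.val h
        simp at this
      have h00 : (0 : Fin (k + 1 + 1)) ≠ i.succ.succ := (Fin.succ_ne_zero _).symm
      simp [rightWedge, h01, h00]
    have h := hN _ hmem
    simp only [rightWedge, Set.mem_ofPred_eq, Matrix.mulVec_add, Matrix.mulVec_smul,
      Matrix.mulVec_single_one, Pi.add_apply, Pi.smul_apply, smul_eq_mul, Matrix.col_apply] at h
    exact h
  have h1 : |N 0 1| < N 1 1 := by
    have hmem : Pi.single 1 1 ∈ rightWedge (k + 1) := by
      simp [rightWedge]
    have h := hN _ hmem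
    simpa only [rightWedge, Set.mem_ofPred_eq, Matrix.mulVec_single_one, Matrix.col_apply] using h
  -- An affine function that is positive on the whole line is constant. Applied to the sum and
  -- difference of rows 1 and 0, it kills their entries from column 2 on.
  have hzero : ∀ u v : ℝ, (∀ t : ℝ, 0 < u + t * v) → v = 0 := by
    intro u v h
    by_contra hv
    have := h (-u / v)
    rw [div_mul_cancel₀ _ hv] at this
    linarith
  have hrow : ∀ i : Fin k, N 0 i.succ.succ = 0 ∧ N 1 i.succ.succ = 0 := by
    intro i
    have hp := hzero (N 1 1 + N 0 1) (N 1 i.succ.succ + N 0 i.succ.succ) fun t => by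
      have := (abs_lt.mp (hx i t)).1
      linarith
    have hm := hzero (N 1 1 - N 0 1) (N 1 i.succ.succ - N 0 i.succ.succ) fun t => by
      have := (abs_lt.mp (hx i t)).2
      linarith
    constructor <;> linarith
  have e1 : (1 : Fin (k + 1 + 1)) = Fin.succ 0 := rfl
  have hm0 : ∀ j, N 0 0 * N j 0 - N 0 1 * N j 1 = metric (k + 1) 0 j := by
    intro j
    have h := hmul 0 j
    rw [Fin.sum_univ_succ, Finset.sum_eq_zero fun i _ => by rw [(hrow i).1, zero_mul], add_zero,
      ← e1] at h
    exact h
  have hm1 : ∀ j, N 1 0 * N j 0 - N 1 1 * N j 1 = metric (k + 1) 1 j := by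
    intro j
    have h := hmul 1 j
    rw [Fin.sum_univ_succ, Finset.sum_eq_zero fun i _ => by rw [(hrow i).2, zero_mul], add_zero,
      ← e1] at h
    exact h
  have m00 := hm0 0
  have m01 := hm0 1
  have m11 := hm1 1
  have g00 : metric (k + 1) 0 0 = 1 := by simp [metric]
  have g01 : metric (k + 1) 0 1 = 0 := by simp [metric]
  have g11 : metric (k + 1) 1 1 = -1 := by
    rw [e1, metric, Matrix.diagonal_apply_eq, Fin.cons_succ]
  rw [g00] at m00
  rw [g01] at m01
  rw [g11] at m11
  set A := N 0 0
  set B := N 0 1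
  set C := N 1 0
  set D := N 1 1
  have hD : 0 < D := lt_of_le_of_lt (abs_nonneg _) h1
  have hss : s * s = 1 := by rcases hs with rfl | rfl <;> simp
  -- From A² - B² = 1, D² - C² = 1 and AC = BD, the Lorentzian orthonormality of the first two rows.
  have hAD : A ^ 2 = D ^ 2 := by
    have h2 : (A * C) ^ 2 = (B * D) ^ 2 := by
      congr 1
      linarith
    nlinarith
  have hA : s * A = D := by
    have : (s * A) ^ 2 = D ^ 2 := by
      rw [mul_pow, pow_two s, hss, one_mul, hAD]
    exact (sq_eq_sq₀ hpos.le hD.le).mp this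
  have hA' : A = s * D := by rw [← hA, ← mul_assoc, hss, one_mul]
  have hC : C = s * B := by
    have h3 : D * (s * C - B) = 0 := by
      rw [hA'] at m01
      linarith
    have h4 : s * C = B := by
      rcases mul_eq_zero.mp h3 with h | h
      · exact absurd h hD.ne'
      · linarith
    rw [← h4, ← mul_assoc, hss, one_mul]
  have hDB : D ^ 2 - B ^ 2 = 1 := by nlinarith
  refine ⟨hA', hC, hDB, hrow, fun i => ?_⟩
  have p0 := hm0 i.succ.succ
  have p1 := hm1 i.succ.succ
  have q0 : metric (k + 1) 0 i.succ.succ = 0 := Matrix.diagonal_apply_ne _ (Fin.succ_ne_zero _).symm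
  have q1 : metric (k + 1) 1 i.succ.succ = 0 := by
    refine Matrix.diagonal_apply_ne _ fun h => ?_
    have := congrArg Fin.val h
    simp at this
  rw [q0] at p0
  rw [q1] at p1
  set x := N i.succ.succ 0
  set y := N i.succ.succ 1
  have hx0 : x = 0 := by
    -- The entries x and y solve a homogeneous linear system whose determinant is s(D² - B²) = s up
    -- to sign, so they vanish.
    have h5 : A * D * x - C * B * x = 0 := by linear_combination D * p0 - B * p1
    rw [hA', hC] at h5
    have h6 : s * x = 0 := by linear_combination h5 - s * x * hDB
    linear_combination s * h6 - x * hss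
  refine ⟨hx0, ?_⟩
  rw [hx0] at p1
  have : D * y = 0 := by linarith
  exact (mul_eq_zero.mp this).resolve_left hD.ne'

/-- N is block diagonal. On the (0,1)-plane it is a boost, for s = -1 followed by a time reversal,
so it commutes with the symmetric off-diagonal block up to s. In dimension 4 the other block is
orthogonal of determinant s, and an orthogonal 2 × 2 matrix commutes with the antisymmetric block up
to its determinant. -/
theorem commute_of_stabilizer {n : ℕ} (hn : 1 ≤ n) {N θ : Matrix (Fin (n + 1)) (Fin (n + 1)) ℝ}
    (hθ : IsAdmissible θ) {s : ℝ} (hs : s = 1 ∨ s = -1) (Λ : ProperOrthochronous n)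
    (hNs : N = s • Λ.mat) (hN : ∀ x ∈ rightWedge n, N.mulVec x ∈ rightWedge n) :
    N * θ = s • (θ * N) := by
  obtain ⟨k, rfl⟩ : ∃ k, n = k + 1 := ⟨n - 1, by omega⟩
  have hss : s * s = 1 := by rcases hs with rfl | rfl <;> simp
  have hL : N * minkTranspose N = 1 := by
    rw [hNs, minkTranspose_smul, Matrix.smul_mul, Matrix.mul_smul, smul_smul, hss, one_smul,
      Λ.isLorentz.mul_transpose]
  have hpos : 0 < s * N 0 0 := by
    rw [hNs, Matrix.smul_apply, smul_eq_mul, ← mul_assoc, hss, one_mul]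
    exact Λ.orthochronous
  obtain ⟨hA, hC, hDB, hrow, hcol⟩ := wedge_stabilizer_entries hL hN hs hpos
  obtain ⟨l, e, _, he, hθ⟩ := hθ
  by_cases hk : k + 1 + 1 = 4
  · obtain rfl : k = 2 := by omega
    have r0 := hrow 0
    have r1 := hrow 1
    have c0 := hcol 0
    have c1 := hcol 1
    simp only [show (0 : Fin 2).succ.succ = (2 : Fin 4) from rfl,
      show (1 : Fin 2).succ.succ = (3 : Fin 4) from rfl] at r0 r1 c0 c1
    obtain ⟨r02, r12⟩ := r0
    obtain ⟨r03, r13⟩ := r1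
    obtain ⟨c20, c21⟩ := c0
    obtain ⟨c30, c31⟩ := c1
    -- The sign drops out because the dimension 4 is even.
    have hdet : N.det = 1 := by
      rw [hNs, Matrix.det_smul, Λ.det_eq_one]
      rcases hs with rfl | rfl
      · simp
      · norm_num
    have hrows : ∀ i j : Fin 4, N i 0 * N j 0 - (N i 1 * N j 1 + N i 2 * N j 2 + N i 3 * N j 3)
        = metric 3 i j := fun i j => by
      have h := mul_metric_mul_transpose_apply hL i j
      simpa [Fin.sum_univ_succ, add_assoc] using h
    have h22 := hrows 2 2
    have h23 := hrows 2 3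
    have h33 := hrows 3 3
    have g22 : metric 3 2 2 = -1 := rfl
    have g33 : metric 3 3 3 = -1 := rfl
    have g23 : metric 3 2 3 = 0 := rfl
    rw [c20, c21, g22] at h22
    rw [c30, c31, g33] at h33
    rw [c20, c21, c30, c31, g23] at h23
    -- The (0,1) block has determinant s and the product of the block determinants is 1.
    have hdet2 : N 2 2 * N 3 3 - N 2 3 * N 3 2 = s := by
      have h : N.det = (N 0 0 * N 1 1 - N 0 1 * N 1 0) * (N 2 2 * N 3 3 - N 2 3 * N 3 2) := by
        simp [Matrix.det_succ_row_zero, Fin.sum_univ_succ, Fin.succAbove, r02, r12, r03, r13, c20,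
          c21, c30, c31, show (Fin.succ 1 : Fin 4) = 2 from rfl, show (Fin.succ 2 : Fin 4) = 3 from rfl]
        ring
      rw [hdet, hA, hC] at h
      linear_combination -s * h - (N 2 2 * N 3 3 - N 2 3 * N 3 2) * hss
        - (N 2 2 * N 3 3 - N 2 3 * N 3 2) * s * s * hDB
    -- An orthogonal matrix of determinant s equals s times its cofactor matrix.
    have a33 : N 3 3 = s * N 2 2 := by
      linear_combination N 3 3 * h22 - N 2 3 * h23 + N 2 2 * hdet2
    have a32 : N 3 2 = -(s * N 2 3) := by
      linear_combination N 3 2 * h22 - N 2 2 * h23 - N 2 3 * hdet2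
    have hθ' : θ = !![0, l, 0, 0; l, 0, 0, 0; 0, 0, 0, e; 0, 0, -e, 0] := by
      ext i j
      rw [hθ]
      fin_cases i <;> fin_cases j <;> simp
    have hN' : N = !![s * N 1 1, N 0 1, 0, 0; s * N 0 1, N 1 1, 0, 0;
        0, 0, N 2 2, N 2 3; 0, 0, -(s * N 2 3), s * N 2 2] := by
      ext i j
      fin_cases i <;> fin_cases j <;> simp [hA, hC, r02, r12, r03, r13, c20, c21, c30, c31, a32, a33]
    generalize N 1 1 = D, N 0 1 = B, N 2 2 = a, N 2 3 = b at hN'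
    rw [hN', hθ']
    ext i j
    fin_cases i <;> fin_cases j <;>
      simp [Matrix.mul_apply, Fin.sum_univ_succ] <;>
      first
        | ring1
        | linear_combination (-B * l) * hss
        | linear_combination (-D * l) * hss
        | linear_combination (-a * e) * hss
        | linear_combination (b * e) * hss
        | linear_combination (-b * e) * hss
  -- In other dimensions θ lives on the (0,1)-plane alone, and the second block of N plays no role.
  · have he0 := he hk
    have hθ' : ∀ i j : Fin (k + 1 + 1), θ i j = if (i.val = 0 ∧ j.val = 1) ∨
        (i.val = 1 ∧ j.val = 0) then l else 0 := by
      intro i j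
      rw [hθ, he0]
      split_ifs <;> simp
    have hl : ∀ i j, (N * θ) i j = N i 0 * θ 0 j + N i 1 * θ 1 j := by
      intro i j
      rw [Matrix.mul_apply, Fin.sum_univ_succ, Fin.sum_univ_succ, Finset.sum_eq_zero, add_zero]
      · rfl
      · intro a _
        rw [hθ', if_neg, mul_zero]
        simp
    have hr : ∀ i j, (θ * N) i j = θ i 0 * N 0 j + θ i 1 * N 1 j := by
      intro i j
      rw [Matrix.mul_apply, Fin.sum_univ_succ, Fin.sum_univ_succ, Finset.sum_eq_zero, add_zero]
      · rfl
      · intro a _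
        rw [hθ', if_neg, zero_mul]
        simp
    have t00 : θ 0 0 = 0 := by rw [hθ']; simp
    have t01 : θ 0 1 = l := by rw [hθ']; simp
    have t10 : θ 1 0 = l := by rw [hθ']; simp
    have t11 : θ 1 1 = 0 := by rw [hθ']; simp
    have tl : ∀ (i : Fin (k + 1 + 1)) (a : Fin k), θ i a.succ.succ = 0 := fun i a => by
      rw [hθ']; simp
    have tr : ∀ (i : Fin (k + 1 + 1)) (a : Fin k), θ a.succ.succ i = 0 := fun i a => by
      rw [hθ']; simp
    have e1 : (Fin.succ 0 : Fin (k + 1 + 1)) = 1 := rfl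
    ext i j
    rw [Matrix.smul_apply, hl, hr, smul_eq_mul]
    refine Fin.cases ?_ (fun i => Fin.cases ?_ (fun i => ?_) i) i <;>
      refine Fin.cases ?_ (fun j => Fin.cases ?_ (fun j => ?_) j) j <;>
      simp only [e1, t00, t01, t10, t11, tl, tr, (hcol _).1, (hcol _).2, (hrow _).1, (hrow _).2,
        hA, hC, mul_zero, zero_mul, add_zero, zero_add] <;>
      first | linear_combination (-(N 0 1) * l) * hss | linear_combination (-(N 1 1) * l) * hss | ring1

/-- The stabilizer of the right wedge leaves the admissible matrices invariant. -/
theorem gammaMap_eq_self_of_stabilizer {n : ℕ} (hn : 1 ≤ n)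
    {N θ : Matrix (Fin (n + 1)) (Fin (n + 1)) ℝ} (hθ : IsAdmissible θ)
    (hN : IsWedgeTransformation N) (hW : ∀ x ∈ rightWedge n, N.mulVec x ∈ rightWedge n) :
    gammaMap N θ = θ := by
  obtain ⟨s, Λ, hs, h⟩ := isWedgeTransformation_iff.mp hN
  have hss : s * s = 1 := by rcases hs with rfl | rfl <;> simp
  have hc := commute_of_stabilizer hn hθ hs Λ h hW
  rw [h, Matrix.smul_mul, Matrix.mul_smul, smul_smul, hss, one_smul] at hc
  have hc' : Λ.mat * θ = s • (θ * Λ.mat) := by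
    rw [← hc, smul_smul, hss, one_smul]
  rw [h, gammaMap_smul hs, hc', Matrix.smul_mul, smul_smul, hss, one_smul, mul_assoc,
    Λ.isLorentz.mul_transpose, mul_one]

/-- If M and M' give the same wedge, then M'⁻¹M preserves the right wedge and so fixes θ; the group
action property of γ concludes. -/
theorem gammaMap_eq_of_image_eq {n : ℕ} (hn : 1 ≤ n)
    {M M' θ : Matrix (Fin (n + 1)) (Fin (n + 1)) ℝ} (hθ : IsAdmissible θ)
    (hM : IsWedgeTransformation M) (hM' : IsWedgeTransformation M')
    (h : M.mulVec '' rightWedge n = M'.mulVec '' rightWedge n) :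
    gammaMap M θ = gammaMap M' θ := by
  obtain ⟨K, hK, hKM, hMK⟩ := hM'.exists_inv
  have hN : gammaMap (K * M) θ = θ := by
    refine gammaMap_eq_self_of_stabilizer hn hθ (hK.mul hM) fun x hx => ?_
    obtain ⟨y, hy, hxy⟩ := h.subset (Set.mem_image_of_mem _ hx)
    rwa [← Matrix.mulVec_mulVec, ← hxy, Matrix.mulVec_mulVec, hKM, Matrix.one_mulVec]
  rw [← hN, ← hM'.gammaMap_mul (hK.mul hM), hN, ← mul_assoc, hMK, one_mul]

theorem wedgeMatrix_image {n : ℕ} (hn : 1 ≤ n) {M θ : Matrix (Fin (n + 1)) (Fin (n + 1)) ℝ}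
    (hθ : IsAdmissible θ) (hM : IsWedgeTransformation M) :
    wedgeMatrix θ (M.mulVec '' rightWedge n) = gammaMap M θ := by
  have h : ∃ M', IsWedgeTransformation M' ∧ M.mulVec '' rightWedge n = M'.mulVec '' rightWedge n :=
    ⟨M, hM, rfl⟩
  rw [wedgeMatrix, dif_pos h]
  exact gammaMap_eq_of_image_eq hn hθ h.choose_spec.1 hM h.choose_spec.2.symm

theorem wedgeMatrix_isMinkSkew {n : ℕ} (hn : 1 ≤ n) {θ : Matrix (Fin (n + 1)) (Fin (n + 1)) ℝ}
    (hθ : IsAdmissible θ) {W : Set (Spacetime n)} (hW : W ∈ wedges n) :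
    IsMinkSkew (wedgeMatrix θ W) := by
  obtain ⟨M, hM, rfl⟩ := hW
  rw [wedgeMatrix_image hn hθ hM]
  exact gammaMap_isMinkSkew hθ.isMinkSkew

theorem wedgeMatrix_map {n : ℕ} (hn : 1 ≤ n) {K θ : Matrix (Fin (n + 1)) (Fin (n + 1)) ℝ}
    (hθ : IsAdmissible θ) (hK : IsWedgeTransformation K) {W : Set (Spacetime n)}
    (hW : W ∈ wedges n) :
    wedgeMatrix θ (K.mulVec '' W) = gammaMap K (wedgeMatrix θ W) := by
  obtain ⟨M, hM, rfl⟩ := hW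
  rw [wedgeMatrix_image hn hθ hM, ← hK.gammaMap_mul hM, ← wedgeMatrix_image hn hθ (hK.mul hM),
    Set.image_image]
  simp only [Matrix.mulVec_mulVec]

/-- The identity of the proper orthochronous Lorentz group. -/
def ProperOrthochronous.refl (n : ℕ) : ProperOrthochronous n where
  mat := 1
  isLorentz := by simp [IsLorentz]
  det_eq_one := Matrix.det_one
  orthochronous := by simp

theorem wedgeMatrix_neg {n : ℕ} (hn : 1 ≤ n) {θ : Matrix (Fin (n + 1)) (Fin (n + 1)) ℝ}
    (hθ : IsAdmissible θ) {W : Set (Spacetime n)} (hW : W ∈ wedges n) :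
    wedgeMatrix θ ((fun x => -x) '' W) = -wedgeMatrix θ W := by
  -- The reflection is the antichronous matrix -1: its two factors cancel around θ and only the sign
  -- in γ remains.
  have h := wedgeMatrix_map hn hθ (K := -1) ⟨ProperOrthochronous.refl n, Or.inr rfl⟩ hW
  have h1 : (-1 : Matrix (Fin (n + 1)) (Fin (n + 1)) ℝ).mulVec = fun x => -x := by
    funext x
    rw [Matrix.neg_mulVec, Matrix.one_mulVec]
  rw [h1] at h
  rw [h, gammaMap, if_neg (by simp [le_of_lt]), minkTranspose_neg, minkTranspose_one]
  simp

end WedgeGeometry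

/-! ### Covariance of the free field. -/

section OneParticleCovariance

variable {n : ℕ} {m : ℝ}

instance : SigmaFinite (shellMeasure n m) :=
  SigmaFinite.withDensity_ofReal (μ := volume) (fun p : Fin n → ℝ => (2 * energy m p)⁻¹)

theorem measurePreserving_lorentzEquiv (Λ : ProperOrthochronous n) :
    MeasurePreserving (lorentzEquiv Λ) := by
  refine ⟨(lorentzEquiv Λ).continuous.measurable, ?_⟩
  have h := Real.map_matrix_volume_pi_eq_smul_volume_pi (M := Λ.mat)
    (by rw [Λ.det_eq_one]; exact one_ne_zero)
  rw [Λ.det_eq_one] at h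
  have h1 : Measure.map (Matrix.toLin' Λ.mat) (volume : Measure (Spacetime n)) = volume := by
    simpa using h
  exact h1

theorem plusVec_coe [Fact (0 < m)] (f : 𝓢(Spacetime n, ℂ)) :
    plusVec m f =ᵐ[shellMeasure n m] shellTransform m 1 f :=
  MemLp.coeFn_toLp _

theorem minusVec_coe [Fact (0 < m)] (f : 𝓢(Spacetime n, ℂ)) :
    minusVec m f =ᵐ[shellMeasure n m] shellTransform m (-1) f :=
  MemLp.coeFn_toLp _

theorem translation₁_coe (y : Spacetime n) (g : OneParticle n m) :
    translation₁ m y g =ᵐ[shellMeasure n m]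
      fun p => Complex.exp (Complex.I * (mink (shellPoint m p) y : ℂ)) * g p :=
  phaseFun_coe (continuous_mink_shellPoint y) g

theorem lorentz₁_coe [Fact (0 < m)] (Λ : ProperOrthochronous n) (g : OneParticle n m) :
    lorentz₁ m Λ g =ᵐ[shellMeasure n m] fun p => g (shellMap m Λ.inv.mat p) :=
  Lp.coeFn_compMeasurePreserving g (measurePreserving_shellMap Λ.inv)

theorem reflection₁_coe (g : OneParticle n m) :
    reflection₁ n m g =ᵐ[shellMeasure n m] fun p => conj (g p) :=
  Lp.coeFn_star g

theorem mink_mulVec_right (Λ : ProperOrthochronous n) (x y : Spacetime n) :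
    mink x (Λ.mat.mulVec y) = mink (Λ.inv.mat.mulVec x) y := by
  rw [mink_mulVec, ProperOrthochronous.inv, minkTranspose_transpose]

/-- Substitute z = Λw + x, which preserves the measure; the phase splits, and p·Λw = Λ⁻¹p·w. -/
theorem shellTransform_poincareTest [Fact (0 < m)] (s : ℝ) (x : Spacetime n)
    (Λ : ProperOrthochronous n) (f : 𝓢(Spacetime n, ℂ)) (p : Fin n → ℝ) :
    shellTransform m s (poincareTest x Λ f) p
      = Complex.exp (Complex.I * ((s * mink (shellPoint m p) x : ℝ) : ℂ))
        * shellTransform m s f (shellMap m Λ.inv.mat p) := by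
  rw [shellTransform, ← integral_add_right_eq_self _ x,
    ← (measurePreserving_lorentzEquiv Λ).integral_comp
      (lorentzEquiv Λ).toHomeomorph.measurableEmbedding, shellTransform,
    ← integral_const_mul]
  refine integral_congr_ae (Eventually.of_forall fun w => ?_)
  simp only
  rw [poincareTest_apply, add_sub_cancel_right, lorentzEquiv_apply, Matrix.mulVec_mulVec,
    Λ.inv_mul_mat, Matrix.one_mulVec, mink_add_right, mink_mulVec_right,
    mulVec_shellPoint, mul_add, Complex.ofReal_add, mul_add, Complex.exp_add]
  ring

theorem conj_shellTransform (s : ℝ) (f : 𝓢(Spacetime n, ℂ)) (p : Fin n → ℝ) :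
    conj (shellTransform m s f p) = shellTransform m (-s) (conjTest f) p := by
  rw [shellTransform, shellTransform, ← integral_conj]
  refine integral_congr_ae (Eventually.of_forall fun x => ?_)
  simp only
  rw [map_mul, ← Complex.exp_conj, map_mul, Complex.conj_I, Complex.conj_ofReal, conjTest_apply,
    neg_mul s, Complex.ofReal_neg, mul_neg, neg_mul]

/-- Complex conjugation and the reflection of the integration variable both reverse the frequency,
and the two reversals cancel. -/
theorem conj_shellTransform_reflectTest (s : ℝ) (f : 𝓢(Spacetime n, ℂ)) (p : Fin n → ℝ) :
    shellTransform m s (reflectTest f) p = conj (shellTransform m s f p) := by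
  rw [conj_shellTransform, shellTransform, shellTransform, ← integral_neg_eq_self]
  refine integral_congr_ae (Eventually.of_forall fun x => ?_)
  simp only
  rw [reflectTest_apply, neg_neg, conjTest_apply, mink_neg_right, mul_neg, neg_mul]

theorem translation₁_lorentz₁_plusVec [Fact (0 < m)] (x : Spacetime n)
    (Λ : ProperOrthochronous n) (f : 𝓢(Spacetime n, ℂ)) :
    translation₁ m x (lorentz₁ m Λ (plusVec m f)) = plusVec m (poincareTest x Λ f) := by
  refine Lp.ext ?_
  filter_upwards [translation₁_coe x (lorentz₁ m Λ (plusVec m f)), lorentz₁_coe Λ (plusVec m f),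
    (measurePreserving_shellMap (m := m) Λ.inv).quasiMeasurePreserving.ae (plusVec_coe f),
    plusVec_coe (m := m) (poincareTest x Λ f)] with p h1 h2 h3 h4
  rw [h1, h2, h3, h4, shellTransform_poincareTest, one_mul]

theorem reflection₁_minusVec [Fact (0 < m)] (f : 𝓢(Spacetime n, ℂ)) :
    reflection₁ n m (minusVec m f) = plusVec m (conjTest f) := by
  refine Lp.ext ?_
  filter_upwards [reflection₁_coe (minusVec m f), minusVec_coe (m := m) f,
    plusVec_coe (m := m) (conjTest f)] with p h1 h2 h3
  rw [h1, h2, h3, conj_shellTransform, neg_neg]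

theorem reflection₁_plusVec [Fact (0 < m)] (f : 𝓢(Spacetime n, ℂ)) :
    reflection₁ n m (plusVec m f) = plusVec m (reflectTest f) := by
  refine Lp.ext ?_
  filter_upwards [reflection₁_coe (plusVec m f), plusVec_coe (m := m) f,
    plusVec_coe (m := m) (reflectTest f)] with p h1 h2 h3
  rw [h1, h2, h3, conj_shellTransform_reflectTest]

theorem poincareTest_conjTest (x : Spacetime n) (Λ : ProperOrthochronous n)
    (f : 𝓢(Spacetime n, ℂ)) : poincareTest x Λ (conjTest f) = conjTest (poincareTest x Λ f) := by
  ext z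
  rw [poincareTest_apply, conjTest_apply, conjTest_apply, poincareTest_apply]

theorem reflectTest_conjTest (f : 𝓢(Spacetime n, ℂ)) :
    reflectTest (conjTest f) = conjTest (reflectTest f) := by
  ext z
  rw [reflectTest_apply, conjTest_apply, conjTest_apply, reflectTest_apply]

theorem conjTest_conjTest (f : 𝓢(Spacetime n, ℂ)) : conjTest (conjTest f) = f := by
  ext z
  rw [conjTest_apply, conjTest_apply, Complex.conj_conj]

/-- Since the conjugate of f⁻ is the plus part of the conjugate of f, both terms of the field are
governed by the transformation law of plus parts alone. -/
theorem freeField_eq [Fact (0 < m)] (f : 𝓢(Spacetime n, ℂ)) :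
    freeField (m := m) f = fieldOp (plusVec m f) (plusVec m (conjTest f)) := by
  rw [← reflection₁_minusVec]
  rfl

theorem conjugate_poincare_freeField [Fact (0 < m)] (x : Spacetime n) (Λ : ProperOrthochronous n)
    (f : 𝓢(Spacetime n, ℂ)) :
    conjugate (poincare m x Λ) (freeField f) = freeField (poincareTest x Λ f) := by
  rw [freeField_eq, freeField_eq, poincare, conjugate_fieldOp, ← poincareTest_conjTest,
    ← translation₁_lorentz₁_plusVec, ← translation₁_lorentz₁_plusVec]
  rfl

theorem conjugate_reflection_freeField [Fact (0 < m)] (f : 𝓢(Spacetime n, ℂ)) :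
    conjugate (reflection n m) (freeField f) = freeField (reflectTest f) := by
  rw [freeField_eq, freeField_eq, reflection, conjugate_fieldOp, ← reflectTest_conjTest,
    reflection₁_plusVec, reflection₁_plusVec]

end OneParticleCovariance

/-! ### The representation generated by X. -/

section DeformedTranslations

variable {n : ℕ} {m : ℝ}

/-- The translations on the one-particle space, conjugated with a unitary operator. -/
def deformedTranslation₁ (V : OneParticle n m ≃ₗᵢ[ℂ] OneParticle n m) (y : Spacetime n) :
    OneParticle n m ≃ₗᵢ[ℂ] OneParticle n m :=
  (V.trans (translation₁ m y)).trans V.symm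

/-- V itself is the diagonalizing isometry, with the mass shell as momentum function. -/
theorem isMultiplier_deformedTranslation₁ (V : OneParticle n m ≃ₗᵢ[ℂ] OneParticle n m)
    (y : Spacetime n) : IsMultiplier V.toLinearIsometry
      (fun p => Complex.exp (Complex.I * (mink (shellPoint m p) y : ℂ)))
      (deformedTranslation₁ V y) := by
  intro v
  have h : V.toLinearIsometry (deformedTranslation₁ V y v) = translation₁ m y (V v) :=
    V.apply_symm_apply _
  rw [h]
  exact translation₁_coe y (V v)

theorem deformedTranslation₁_add (V : OneParticle n m ≃ₗᵢ[ℂ] OneParticle n m)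
    (y z : Spacetime n) : deformedTranslation₁ V (y + z)
      = (deformedTranslation₁ V z).trans (deformedTranslation₁ V y) := by
  refine LinearIsometryEquiv.ext fun v => V.injective (Lp.ext ?_)
  have h1 := isMultiplier_deformedTranslation₁ V (y + z) v
  have h2 := isMultiplier_deformedTranslation₁ V y (deformedTranslation₁ V z v)
  have h3 := isMultiplier_deformedTranslation₁ V z v
  filter_upwards [h1, h2, h3] with p h1 h2 h3
  refine h1.trans (Eq.trans ?_ h2.symm)
  rw [h3, mink_add_right, Complex.ofReal_add, mul_add, Complex.exp_add, mul_assoc]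

theorem secondQuant_deformedTranslation₁_add (V : OneParticle n m ≃ₗᵢ[ℂ] OneParticle n m)
    (y z : Spacetime n) (Ψ : FieldSpace n m) : secondQuant (deformedTranslation₁ V (y + z)) Ψ
      = secondQuant (deformedTranslation₁ V y) (secondQuant (deformedTranslation₁ V z) Ψ) := by
  rw [deformedTranslation₁_add, ← secondQuant_trans, LinearIsometryEquiv.trans_apply]

theorem continuous_tensorMap_of_isMultiplier {H M : Type*} [NormedAddCommGroup H]
    [InnerProductSpace ℂ H] [MeasurableSpace M] {ν : Measure M} [SigmaFinite ν]
    {J : H →ₗᵢ[ℂ] Lp ℂ 2 ν} {P : M → Spacetime n} {τ : Spacetime n → H ≃ₗᵢ[ℂ] H}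
    (hP : Measurable P)
    (hτ : ∀ y, IsMultiplier J (fun ξ => Complex.exp (Complex.I * (mink (P ξ) y : ℂ))) (τ y))
    (k : ℕ) (u : TensorPow H k) :
    Continuous fun y => tensorMap (τ y).toLinearIsometry k u := by
  have h := (isSpectral_tensorMap hP hτ k).continuous_apply u
  -- Restriction of a jointly continuous function to the second variable.
  have hc : ∀ {f : Spacetime n × Spacetime n → TensorPow H k}, Continuous f →
      ∀ x, Continuous fun y => f (x, y) := fun hf x => by fun_prop
  exact hc h 0

theorem continuous_secondQuant_deformedTranslation₁
    (V : OneParticle n m ≃ₗᵢ[ℂ] OneParticle n m) (Ψ : FieldSpace n m) :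
    Continuous fun y => secondQuant (deformedTranslation₁ V y) Ψ :=
  continuous_secondQuant _ (continuous_tensorMap_of_isMultiplier
    (continuous_shellPoint (m := m)).measurable (isMultiplier_deformedTranslation₁ V)) Ψ

theorem isExponential_generator (V : OneParticle n m ≃ₗᵢ[ℂ] OneParticle n m) :
    IsExponential (generator fun y => secondQuant (deformedTranslation₁ V y))
      (fun y => secondQuant (deformedTranslation₁ V y)) :=
  ⟨secondQuant_deformedTranslation₁_add V, continuous_secondQuant_deformedTranslation₁ V,
    fun _ => rfl⟩

theorem isExponential_momentum (n : ℕ) (m : ℝ) :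
    IsExponential (momentum n m) (fun y => secondQuant (translation₁ m y)) := by
  have h := isExponential_generator (LinearIsometryEquiv.refl ℂ (OneParticle n m))
  exact h

theorem isExponential_deformOp (V : OneParticle n m ≃ₗᵢ[ℂ] OneParticle n m) :
    IsExponential (deformOp V) (fun y => secondQuant (deformedTranslation₁ V y)) := by
  have h := (isExponential_momentum n m).conjugate (secondQuant V.symm)
  have e : (fun y => secondQuant (deformedTranslation₁ V y)) = fun y =>
      ((secondQuant V.symm).symm.trans (secondQuant (translation₁ m y))).trans
        (secondQuant V.symm) := by
    funext y
    rw [deformedTranslation₁, ← secondQuant_trans, ← secondQuant_trans, secondQuant_symm]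
    rfl
  rw [e]
  exact h

theorem isExponential_expI_deformOp (V : OneParticle n m ≃ₗᵢ[ℂ] OneParticle n m) :
    IsExponential (deformOp V) (expI (deformOp V)) := by
  have h := isExponential_deformOp V
  rw [h.expI_eq]
  exact h

/-- Conjugation by Γ(u) replaces V by Vu⁻¹, so the class of deformations is stable and all results
apply to the conjugated operators as well. Both families generate the same representation, hence
agree with domains. -/
theorem conjugate_secondQuant_deformOp (V u : OneParticle n m ≃ₗᵢ[ℂ] OneParticle n m)
    (μ : Fin (n + 1)) : conjugate (secondQuant u) (deformOp V μ) = deformOp (u.symm.trans V) μ := by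
  have h1 := (isExponential_deformOp V).conjugate (secondQuant u)
  have h2 := isExponential_deformOp (u.symm.trans V)
  rw [← h1.generator_eq μ, ← h2.generator_eq μ]
  congr 1
  funext y
  rw [secondQuant_symm, secondQuant_trans, secondQuant_trans]
  rfl

end DeformedTranslations

/-! ### Continuity of the twisted operators in the one-particle vector. -/

section FieldContinuity

variable {H : Type*} [NormedAddCommGroup H] [InnerProductSpace ℂ H]

theorem tensorCons_norm (h : H) {k : ℕ} (u : TensorPow H k) : ‖tensorCons h k u‖ = ‖h‖ * ‖u‖ :=
  tensorLift_norm ..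

theorem tensorCons_add (g h : H) (k : ℕ) : tensorCons (g + h) k = tensorCons g k + tensorCons h k := by
  refine tensor_hom_ext fun x => ?_
  have e := tensor_update_add (Fin.cons 0 x : Fin (k + 1) → H) 0 g h
  simp only [Fin.update_cons_zero] at e
  rw [add_apply, tensorCons_tensor, tensorCons_tensor, tensorCons_tensor, e]

theorem tensorCons_smul (c : ℂ) (h : H) (k : ℕ) : tensorCons (c • h) k = c • tensorCons h k := by
  refine tensor_hom_ext fun x => ?_
  have e := tensor_update_smul (Fin.cons 0 x : Fin (k + 1) → H) 0 c h
  simp only [Fin.update_cons_zero] at e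
  rw [smul_apply, tensorCons_tensor, tensorCons_tensor, e]

theorem norm_tensorCons_le (h : H) (k : ℕ) : ‖tensorCons h k‖ ≤ 1 * ‖h‖ := by
  rw [one_mul]
  exact ContinuousLinearMap.opNorm_le_bound _ (norm_nonneg h) fun u => (tensorCons_norm h u).le

/-- The tensor product with a vector on the left, as a linear function of the vector. -/
def tensorConsLinear (H : Type*) [NormedAddCommGroup H] [InnerProductSpace ℂ H] (k : ℕ) :
    H →ₗ[ℂ] TensorPow H k →L[ℂ] TensorPow H (k + 1) where
  toFun h := tensorCons h k
  map_add' g h := tensorCons_add g h k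
  map_smul' c h := tensorCons_smul c h k

/-- The tensor product with a vector on the left, as a continuous linear function of the vector. -/
def tensorConsL (H : Type*) [NormedAddCommGroup H] [InnerProductSpace ℂ H] (k : ℕ) :
    H →L[ℂ] TensorPow H k →L[ℂ] TensorPow H (k + 1) :=
  ⟨tensorConsLinear H k, AddMonoidHomClass.continuous_of_bound (tensorConsLinear H k) 1
    fun h => norm_tensorCons_le h k⟩

theorem exists_raiseOp_clm (S : ∀ k, TensorPow H (k + 1) →L[ℂ] TensorPow H (k + 1)) {Ψ : Fock H}
    (hΨ : Ψ ∈ finiteParticle H) :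
    ∃ R : H →L[ℂ] Fock H, ∀ g, R g = raiseOp (fun k => twistedCreation k (S k) g) ⟨Ψ, hΨ⟩ := by
  induction hΨ using finiteParticle_induction with
  | zero => exact ⟨0, fun g => (map_zero _).symm⟩
  | add Ψ Φ hΨ hΦ h1 h2 =>
    obtain ⟨R, hR⟩ := h1
    obtain ⟨R', hR'⟩ := h2
    refine ⟨R + R', fun g => ?_⟩
    rw [add_apply, hR, hR', ← map_add]
    rfl
  | single k u =>
    refine ⟨((fockSingle H (k + 1)).comp
      (((Real.sqrt (k + 1) : ℝ) : ℂ) • ((symPow H (k + 1)).orthogonalProjectionOnto.comp (S k)))).comp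
        ((tensorConsL H k).flip (u : TensorPow H k)), fun g => ?_⟩
    rw [raiseOp_fockSingle]
    rfl

/-- The dependence is antilinear because the contraction is the adjoint of a linear function of h.
Composed with the antilinear passage to the conjugate of f⁻ it becomes linear in f. -/
theorem exists_lowerOp_clm (S : ∀ k, TensorPow H (k + 1) →L[ℂ] TensorPow H (k + 1)) {Ψ : Fock H}
    (hΨ : Ψ ∈ finiteParticle H) :
    ∃ R : H →SL[starRingEnd ℂ] Fock H,
      ∀ h, R h = lowerOp (fun k => twistedAnnihilation k (S k) h) ⟨Ψ, hΨ⟩ := by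
  induction hΨ using finiteParticle_induction with
  | zero => exact ⟨0, fun g => (map_zero _).symm⟩
  | add Ψ Φ hΨ hΦ h1 h2 =>
    obtain ⟨R, hR⟩ := h1
    obtain ⟨R', hR'⟩ := h2
    refine ⟨R + R', fun g => ?_⟩
    rw [add_apply, hR, hR', ← map_add]
    rfl
  | single k u =>
    cases k with
    | zero => exact ⟨0, fun g => (lowerOp_fockSingle_zero _ u).symm⟩
    | succ k =>
      refine ⟨((fockSingle H k).comp
        (((Real.sqrt (k + 1) : ℝ) : ℂ) • ((symPow H k).orthogonalProjectionOnto.comp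
          (ContinuousLinearMap.apply ℂ (TensorPow H k) (S k (u : TensorPow H (k + 1))))))).comp
          ((ContinuousLinearMap.adjoint (𝕜 := ℂ) (E := TensorPow H k)
            (F := TensorPow H (k + 1))).toContinuousLinearEquiv.toContinuousLinearMap.comp
              (tensorConsL H k)), fun g => ?_⟩
      rw [lowerOp_fockSingle_succ]
      rfl

end FieldContinuity

/-! ### Continuity of the restriction to the mass shell. -/

section TestFunctionContinuity

variable {n : ℕ} {m : ℝ}

theorem shellMeasure_le [Fact (0 < m)] :
    shellMeasure n m ≤ ENNReal.ofReal (2 * m)⁻¹ • volume := by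
  have hm : 0 < m := Fact.out
  rw [shellMeasure, ← withDensity_const]
  refine withDensity_mono (Eventually.of_forall fun p => ENNReal.ofReal_le_ofReal ?_)
  have : m ≤ energy m p := by
    refine Real.le_sqrt_of_sq_le ?_
    have : 0 ≤ ∑ i, p i ^ 2 := Finset.sum_nonneg fun i _ => sq_nonneg _
    linarith
  gcongr

/-- The square is at most (1 + ‖p‖)^(-(n+1)), integrable in dimension n, and the density of the
shell measure is bounded by (2m)⁻¹. -/
theorem memLp_decay [Fact (0 < m)] :
    MemLp (fun p : Fin n → ℝ => ((1 + ‖p‖) ^ (n + 1))⁻¹) 2 (shellMeasure n m) := by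
  have hc : Continuous fun p : Fin n → ℝ => ((1 + ‖p‖) ^ (n + 1))⁻¹ := by
    have h : ∀ p : Fin n → ℝ, (1 + ‖p‖) ^ (n + 1) ≠ 0 := fun p => by positivity
    fun_prop (disch := exact h _)
  have hvol : MemLp (fun p : Fin n → ℝ => ((1 + ‖p‖) ^ (n + 1))⁻¹) 2 volume := by
    rw [memLp_two_iff_integrable_sq hc.aestronglyMeasurable]
    refine (integrable_one_add_norm (E := Fin n → ℝ) (μ := volume) (r := (n : ℝ) + 1)
      (by simp)).mono' (hc.pow 2).aestronglyMeasurable (Eventually.of_forall fun p => ?_)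
    have h4 : (1 + ‖p‖) ^ (-((n : ℝ) + 1)) = ((1 + ‖p‖) ^ (n + 1))⁻¹ := by
      rw [Real.rpow_neg (by positivity)]
      norm_cast
    rw [h4, Real.norm_of_nonneg (by positivity), pow_two]
    refine mul_le_of_le_one_left (by positivity) (inv_le_one_of_one_le₀ (one_le_pow₀ ?_))
    linarith [norm_nonneg p]
  exact (hvol.smul_measure ENNReal.ofReal_ne_top).mono_measure shellMeasure_le

/-- The Fourier variable on the shell is at least ‖p‖/(2π), so Schwartz decay in it gives decay in
p, with a constant that is a Schwartz seminorm. The resulting L² bound makes the restriction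
continuous. -/
theorem norm_shellFreq_le {s : ℝ} (hs : |s| = 1) (g : 𝓢(EuclideanSpace ℝ (Fin (n + 1)), ℂ))
    (p : Fin n → ℝ) : ‖g (shellFreq m s p)‖ ≤ ((2 * Real.pi) ^ (n + 1) * 2 ^ (n + 1)) *
      ((Finset.Iic (n + 1, 0)).sup
        (schwartzSeminormFamily ℂ (EuclideanSpace ℝ (Fin (n + 1))) ℂ)) g
        * ((1 + ‖p‖) ^ (n + 1))⁻¹ := by
  set ξ := shellFreq m s p with hξ
  have h := SchwartzMap.one_add_le_sup_seminorm_apply (𝕜 := ℂ) (m := (n + 1, 0))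
    (k := n + 1) (n := 0) le_rfl le_rfl g ξ
  rw [norm_iteratedFDeriv_zero] at h
  have hp := norm_le_shellFreq (m := m) hs p
  rw [← hξ] at hp
  have h2pi : 1 ≤ 2 * Real.pi := by linarith [Real.pi_gt_three]
  rw [← div_eq_mul_inv, le_div_iff₀ (by positivity), mul_comm, mul_assoc]
  have h3 : (1 + ‖p‖) ^ (n + 1) ≤ (2 * Real.pi * (1 + ‖ξ‖)) ^ (n + 1) :=
    pow_le_pow_left₀ (by positivity) (by linarith) _
  calc (1 + ‖p‖) ^ (n + 1) * ‖g ξ‖ ≤ (2 * Real.pi * (1 + ‖ξ‖)) ^ (n + 1) * ‖g ξ‖ := by gcongr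
    _ = (2 * Real.pi) ^ (n + 1) * ((1 + ‖ξ‖) ^ (n + 1) * ‖g ξ‖) := by
      rw [mul_pow]
      ring
    _ ≤ _ := by
      exact mul_le_mul_of_nonneg_left h (by positivity)

theorem memLp_comp_shellFreq [Fact (0 < m)] {s : ℝ} (hs : |s| = 1)
    (g : 𝓢(EuclideanSpace ℝ (Fin (n + 1)), ℂ)) :
    MemLp (fun p => g (shellFreq m s p)) 2 (shellMeasure n m) := by
  have hc : Continuous fun p => g (shellFreq m s p) := by
    refine (SchwartzMap.continuous _).comp ((PiLp.continuous_toLp 2 _).comp ?_)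
    have h2 : Continuous fun p : Fin n → ℝ => (metric n).mulVec (shellPoint m p) :=
      continuous_const.matrix_mulVec continuous_shellPoint
    exact h2.const_smul (-(s / (2 * Real.pi)))
  refine ((memLp_decay (n := n) (m := m)).const_mul _).mono' hc.aestronglyMeasurable
    (Eventually.of_forall fun p => norm_shellFreq_le hs g p)

/-- The restriction of a Schwartz function to the mass shell, as a vector of the one-particle
space. -/
def shellRestrict [Fact (0 < m)] {s : ℝ} (hs : |s| = 1) :
    𝓢(EuclideanSpace ℝ (Fin (n + 1)), ℂ) →L[ℂ] OneParticle n m :=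
  SchwartzMap.mkCLMtoNormedSpace (fun g => (memLp_comp_shellFreq hs g).toLp _)
    (fun f g => MemLp.toLp_add (memLp_comp_shellFreq hs f) (memLp_comp_shellFreq hs g))
    (fun c g => MemLp.toLp_const_smul c (memLp_comp_shellFreq hs g))
    ⟨Finset.Iic (n + 1, 0), (2 * Real.pi) ^ (n + 1) * 2 ^ (n + 1)
      * ‖(memLp_decay (n := n) (m := m)).toLp _‖, by positivity, fun g => by
      have h := Lp.norm_le_mul_norm_of_ae_le_mul (f := (memLp_comp_shellFreq (m := m) hs g).toLp _)
        (g := (memLp_decay (n := n) (m := m)).toLp _)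
        (c := ((2 * Real.pi) ^ (n + 1) * 2 ^ (n + 1)) * ((Finset.Iic (n + 1, 0)).sup
          (schwartzSeminormFamily ℂ (EuclideanSpace ℝ (Fin (n + 1))) ℂ)) g) (by
          filter_upwards [(memLp_comp_shellFreq (m := m) hs g).coeFn_toLp,
            (memLp_decay (n := n) (m := m)).coeFn_toLp] with p h1 h2
          rw [h1, h2, Real.norm_of_nonneg (by positivity)]
          exact norm_shellFreq_le hs g p)
      refine h.trans (le_of_eq ?_)
      ring⟩

theorem shellRestrict_fourier [Fact (0 < m)] {s : ℝ} (hs : |s| = 1) (f : 𝓢(Spacetime n, ℂ)) :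
    shellRestrict (m := m) hs (FourierTransform.fourier (toEuclidean f))
      = (memLp_shellTransform hs f).toLp _ :=
  MemLp.toLp_congr (memLp_comp_shellFreq hs _) _ (Eventually.of_forall fun p => (shellTransform_eq s f p).symm)

theorem exists_shellTransform_clm [Fact (0 < m)] {s : ℝ} (hs : |s| = 1) :
    ∃ T : 𝓢(Spacetime n, ℂ) →L[ℂ] OneParticle n m,
      ∀ f, T f = (memLp_shellTransform hs f).toLp _ :=
  ⟨(shellRestrict hs).comp ((FourierTransform.fourierCLM ℂ
    𝓢(EuclideanSpace ℝ (Fin (n + 1)), ℂ)).comp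
      (SchwartzMap.compCLMOfContinuousLinearEquiv ℂ (EuclideanSpace.equiv (Fin (n + 1)) ℝ))),
    shellRestrict_fourier hs⟩

end TestFunctionContinuity

/-! ### The deformed fields: domain, covariance, hermiticity, continuity. -/

section DeformedField

variable {n : ℕ} {m : ℝ} [Fact (0 < m)]

/-- The values of the deformed field on the vectors of finite particle number. -/
theorem exists_deformedField (V : OneParticle n m ≃ₗᵢ[ℂ] OneParticle n m)
    (θ : Matrix (Fin (n + 1)) (Fin (n + 1)) ℝ) :
    ∃ S S' : ∀ k, TensorPow (OneParticle n m) (k + 1) →L[ℂ] TensorPow (OneParticle n m) (k + 1),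
      (IsMinkSkew θ → ∀ k u v, ⟪S k u, v⟫_ℂ = ⟪u, S' k v⟫_ℂ) ∧
      ∀ f (Ψ : finiteParticle (OneParticle n m)),
        HasWarpedValue (deformOp V) θ (freeField f) Ψ
          (lowerOp (fun k => twistedAnnihilation k (S' k) (plusVec m (conjTest f))) Ψ
            + raiseOp (fun k => twistedCreation k (S k) (plusVec m f)) Ψ) := by
  obtain ⟨S, S', h1, h2⟩ := exists_twist (continuous_shellPoint (m := m)).measurable
    (isMultiplier_deformedTranslation₁ V) (isExponential_deformOp V) θ
  refine ⟨S, S', h1, fun f Ψ => ?_⟩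
  rw [freeField_eq]
  exact h2 _ _ Ψ

theorem deformedField_domain (V : OneParticle n m ≃ₗᵢ[ℂ] OneParticle n m)
    (θ : Matrix (Fin (n + 1)) (Fin (n + 1)) ℝ) (f : 𝓢(Spacetime n, ℂ)) :
    (deformedField (deformOp V) θ f).domain = finiteParticle (OneParticle n m) := by
  obtain ⟨S, S', -, h⟩ := exists_deformedField V θ
  refine le_antisymm ?_ fun Ψ hΨ => ⟨_, h f ⟨Ψ, hΨ⟩⟩
  rintro Ψ ⟨Φ, hΦ⟩
  exact hΦ.mem

/-- Common form of all covariance statements. Both domains are the finite particle vectors, so only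
the values need transport. -/
theorem conjugate_deformedField {σ : ℂ →+* ℂ} [UnitaryScalar σ] [RingHomInvPair σ σ]
    (V V' : OneParticle n m ≃ₗᵢ[ℂ] OneParticle n m) (T : OneParticle n m ≃ₛₗᵢ[σ] OneParticle n m)
    {θ θ' : Matrix (Fin (n + 1)) (Fin (n + 1)) ℝ} {f f' : 𝓢(Spacetime n, ℂ)}
    (hf : conjugate (secondQuant T) (freeField f) = freeField f')
    (L B : Spacetime n ≃L[ℝ] Spacetime n)
    (hB : ∀ y v, secondQuant T (expI (deformOp V) y v)
      = expI (deformOp V') (B y) (secondQuant T v))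
    (hθ : ∀ x, θ'.mulVec (L x) = B (θ.mulVec x))
    (hL : MeasurePreserving L) (hBm : MeasurePreserving B)
    (hphase : ∀ x y, σ (Complex.exp (-Complex.I * (mink x y : ℂ)))
      = Complex.exp (-Complex.I * (mink (L x) (B y) : ℂ))) :
    conjugate (secondQuant T) (deformedField (deformOp V) θ f)
      = deformedField (deformOp V') θ' f' := by
  have hdom : (conjugate (secondQuant T) (deformedField (deformOp V) θ f)).domain
      = (deformedField (deformOp V') θ' f').domain := by
    rw [deformedField_domain]
    refine Submodule.ext fun Ψ => ?_
    have h : Ψ ∈ (conjugate (secondQuant T) (deformedField (deformOp V) θ f)).domain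
        ↔ secondQuant T.symm Ψ ∈ (deformedField (deformOp V) θ f).domain := Iff.rfl
    rw [h, deformedField_domain]
    exact secondQuant_mem_iff T.symm
  refine LinearPMap.ext hdom fun Ψ h1 h2 => ?_
  obtain ⟨Φ, hΦ⟩ := id h1
  have ht := hΦ.transport (secondQuant T) L B hB hθ (hL.prod hBm) hphase
  rw [hf] at ht
  have e1 : secondQuant T ((secondQuant T).symm Ψ) = Ψ := (secondQuant T).apply_symm_apply Ψ
  have e2 : deformedField (deformOp V') θ' f' ⟨Ψ, h2⟩ = secondQuant T Φ :=
    warpedConvolution_apply (e1 ▸ ht) h2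
  have e3 : deformedField (deformOp V) θ f ⟨(secondQuant T).symm Ψ, h1⟩ = Φ :=
    warpedConvolution_apply hΦ h1
  rw [e2, ← e3]
  rfl

theorem phase_comp_refl (x y : Spacetime n) (L B : Spacetime n ≃L[ℝ] Spacetime n)
    (h : mink (L x) (B y) = mink x y) :
    RingHom.id ℂ (Complex.exp (-Complex.I * (mink x y : ℂ)))
      = Complex.exp (-Complex.I * (mink (L x) (B y) : ℂ)) := by
  rw [h, RingHom.id_apply]

/-- No change of variables: the conjugated translations are those of another admissible V. -/
theorem poincare_deformedField (V : OneParticle n m ≃ₗᵢ[ℂ] OneParticle n m)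
    (θ : Matrix (Fin (n + 1)) (Fin (n + 1)) ℝ) (x : Spacetime n) (Λ : ProperOrthochronous n)
    (f : 𝓢(Spacetime n, ℂ)) :
    conjugate (poincare m x Λ) (deformedField (deformOp V) θ f)
      = deformedField (fun μ => conjugate (poincare m x Λ) (deformOp V μ)) θ
          (poincareTest x Λ f) := by
  have h := (isExponential_expI_deformOp V).conjugate (poincare m x Λ)
  have hX : (fun μ => conjugate (poincare m x Λ) (deformOp V μ))
      = deformOp (((lorentz₁ m Λ).trans (translation₁ m x)).symm.trans V) :=
    funext fun μ => conjugate_secondQuant_deformOp V _ μ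
  rw [hX] at h ⊢
  refine conjugate_deformedField V _ ((lorentz₁ m Λ).trans (translation₁ m x))
    (conjugate_poincare_freeField x Λ f) (ContinuousLinearEquiv.refl ℝ _)
    (ContinuousLinearEquiv.refl ℝ _) (fun y v => ?_) (fun _ => rfl)
    (MeasurePreserving.id _) (MeasurePreserving.id _)
    (fun x y => phase_comp_refl x y _ _ rfl)
  rw [h.expI_eq]
  exact congrArg (fun w => poincare m x Λ (expI (deformOp V) y w))
    ((poincare m x Λ).symm_apply_apply v).symm

/-- Both variables are rotated by Λ, which leaves x·y invariant, and θ becomes ΛθΛᵀ because ΛᵀΛ = 1.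
Covariance is assumed only for the given (x, Λ), so that the Lorentz and the Poincaré case are both
instances. -/
theorem poincare_deformedField_of_covariant (V : OneParticle n m ≃ₗᵢ[ℂ] OneParticle n m)
    (θ : Matrix (Fin (n + 1)) (Fin (n + 1)) ℝ) (x : Spacetime n) (Λ : ProperOrthochronous n)
    (hX : ∀ y Ψ, poincare m x Λ (expI (deformOp V) y ((poincare m x Λ).symm Ψ))
      = expI (deformOp V) (Λ.mat.mulVec y) Ψ)
    (f : 𝓢(Spacetime n, ℂ)) :
    conjugate (poincare m x Λ) (deformedField (deformOp V) θ f)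
      = deformedField (deformOp V) (gammaMap Λ.mat θ) (poincareTest x Λ f) := by
  refine conjugate_deformedField V V ((lorentz₁ m Λ).trans (translation₁ m x))
    (conjugate_poincare_freeField x Λ f) (lorentzEquiv Λ) (lorentzEquiv Λ)
    (fun y v => ?_) (fun z => ?_)
    (measurePreserving_lorentzEquiv Λ) (measurePreserving_lorentzEquiv Λ)
    (fun y z => phase_comp_refl y z _ _ (Λ.isLorentz.mink_map y z))
  · have h := hX y (poincare m x Λ v)
    rw [LinearIsometryEquiv.symm_apply_apply] at h
    exact h
  · rw [gammaMap_mat, lorentzEquiv_apply, lorentzEquiv_apply, Matrix.mulVec_mulVec,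
      Matrix.mulVec_mulVec, mul_assoc, Λ.isLorentz.transpose_mul, mul_one]

/-- The antiunitary operator conjugates exp(-ix·y), which is undone by y → -y with x kept. Since the
argument θx of the representation also changes sign, θ must become -θ. -/
theorem reflection_deformedField_of_covariant (V : OneParticle n m ≃ₗᵢ[ℂ] OneParticle n m)
    (hX : IsReflectionCovariant (deformOp V))
    (θ : Matrix (Fin (n + 1)) (Fin (n + 1)) ℝ) (f : 𝓢(Spacetime n, ℂ)) :
    conjugate (reflection n m) (deformedField (deformOp V) θ f)
      = deformedField (deformOp V) (-θ) (reflectTest f) := by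
  refine conjugate_deformedField V V (reflection₁ n m)
    (conjugate_reflection_freeField f) (ContinuousLinearEquiv.refl ℝ _)
    (ContinuousLinearEquiv.neg ℝ) (fun y v => ?_) (fun z => Matrix.neg_mulVec _ _)
    (MeasurePreserving.id _) (Measure.measurePreserving_neg volume) (fun x y => ?_)
  · have h := hX y (reflection n m v)
    rw [LinearIsometryEquiv.symm_apply_apply] at h
    exact h
  · have e : mink ((ContinuousLinearEquiv.refl ℝ (Spacetime n)) x)
        ((ContinuousLinearEquiv.neg ℝ : Spacetime n ≃L[ℝ] Spacetime n) y) = -mink x y :=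
      mink_neg_right x y
    rw [e, ← Complex.exp_conj, map_mul, map_neg, Complex.conj_I, Complex.conj_ofReal,
      Complex.ofReal_neg, neg_neg, mul_neg, neg_mul, neg_neg]

theorem deformedField_mem (V : OneParticle n m ≃ₗᵢ[ℂ] OneParticle n m)
    (θ : Matrix (Fin (n + 1)) (Fin (n + 1)) ℝ) (f : 𝓢(Spacetime n, ℂ))
    (Ψ : (deformedField (deformOp V) θ f).domain) :
    deformedField (deformOp V) θ f Ψ ∈ finiteParticle (OneParticle n m) := by
  obtain ⟨S, S', -, h⟩ := exists_deformedField V θ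
  obtain ⟨Ψ, hΨ⟩ := Ψ
  have hΨ' := hΨ
  rw [deformedField_domain] at hΨ'
  have e : deformedField (deformOp V) θ f ⟨Ψ, hΨ⟩ = _ := warpedConvolution_apply (h f ⟨Ψ, hΨ'⟩) hΨ
  rw [e]
  exact Submodule.add_mem _ (lowerOp_mem _ _) (raiseOp_mem _ _)

theorem inner_lowerOp_add_raiseOp {H : Type*} [NormedAddCommGroup H] [InnerProductSpace ℂ H]
    (C D : ∀ k, symPow H k →L[ℂ] symPow H (k + 1)) (Φ Ψ : finiteParticle H) :
    ⟪(Φ : Fock H), lowerOp (fun k => ContinuousLinearMap.adjoint (D k)) Ψ + raiseOp C Ψ⟫_ℂ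
      = ⟪lowerOp (fun k => ContinuousLinearMap.adjoint (C k)) Φ + raiseOp D Φ, (Ψ : Fock H)⟫_ℂ := by
  rw [inner_add_right, inner_add_left, inner_raiseOp, inner_lowerOp, add_comm]

/-- Skewness of θ makes the annihilation part the adjoint of the creation part of the conjugate test
function, built from the same family C; exchanging f and its conjugate then exchanges the two. -/
theorem deformedField_apply_adjoint (V : OneParticle n m ≃ₗᵢ[ℂ] OneParticle n m)
    {θ : Matrix (Fin (n + 1)) (Fin (n + 1)) ℝ} (hθ : IsMinkSkew θ) :
    ∃ C : OneParticle n m → ∀ k, symPow (OneParticle n m) k →L[ℂ] symPow (OneParticle n m) (k + 1),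
      ∀ f (Ψ : finiteParticle (OneParticle n m))
        (h : (Ψ : FieldSpace n m) ∈ (deformedField (deformOp V) θ f).domain),
        deformedField (deformOp V) θ f ⟨Ψ, h⟩
          = lowerOp (fun k => ContinuousLinearMap.adjoint (C (plusVec m (conjTest f)) k)) Ψ
            + raiseOp (C (plusVec m f)) Ψ := by
  obtain ⟨S, S', hS, h⟩ := exists_deformedField V θ
  refine ⟨fun g k => twistedCreation k (S k) g, fun f Ψ hΨ => ?_⟩
  have ha : (fun k => twistedAnnihilation k (S' k) (plusVec m (conjTest f)))
      = fun k => ContinuousLinearMap.adjoint (twistedCreation k (S k) (plusVec m (conjTest f))) :=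
    funext fun k => twistedAnnihilation_eq_adjoint k (hS hθ k) _
  rw [← ha]
  exact warpedConvolution_apply (h f Ψ) hΨ

theorem deformedField_hermitian (V : OneParticle n m ≃ₗᵢ[ℂ] OneParticle n m)
    {θ : Matrix (Fin (n + 1)) (Fin (n + 1)) ℝ} (hθ : IsMinkSkew θ) (f : 𝓢(Spacetime n, ℂ))
    (Ψ : (deformedField (deformOp V) θ f).domain)
    (Φ : (deformedField (deformOp V) θ (conjTest f)).domain) :
    ⟪(Φ : FieldSpace n m), deformedField (deformOp V) θ f Ψ⟫_ℂ
      = ⟪deformedField (deformOp V) θ (conjTest f) Φ, (Ψ : FieldSpace n m)⟫_ℂ := by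
  obtain ⟨C, hC⟩ := deformedField_apply_adjoint V hθ
  have hΨ : (Ψ : FieldSpace n m) ∈ finiteParticle (OneParticle n m) :=
    (deformedField_domain V θ f).le Ψ.2
  have hΦ : (Φ : FieldSpace n m) ∈ finiteParticle (OneParticle n m) :=
    (deformedField_domain V θ (conjTest f)).le Φ.2
  have e1 := hC f ⟨Ψ, hΨ⟩ Ψ.2
  have e2 := hC (conjTest f) ⟨Φ, hΦ⟩ Φ.2
  rw [conjTest_conjTest] at e2
  rw [e1, e2]
  exact inner_lowerOp_add_raiseOp (C (plusVec m f)) (C (plusVec m (conjTest f))) ⟨Φ, hΦ⟩ ⟨Ψ, hΨ⟩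

theorem deformedField_tempered (V : OneParticle n m ≃ₗᵢ[ℂ] OneParticle n m)
    (θ : Matrix (Fin (n + 1)) (Fin (n + 1)) ℝ) {Ψ : FieldSpace n m}
    (hΨ : Ψ ∈ finiteParticle (OneParticle n m)) :
    ∃ T : 𝓢(Spacetime n, ℂ) →L[ℂ] FieldSpace n m,
      ∀ f, ∀ h : Ψ ∈ (deformedField (deformOp V) θ f).domain,
        T f = deformedField (deformOp V) θ f ⟨Ψ, h⟩ := by
  obtain ⟨S, S', -, h⟩ := exists_deformedField V θ
  obtain ⟨R, hR⟩ := exists_raiseOp_clm S hΨ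
  obtain ⟨R', hR'⟩ := exists_lowerOp_clm S' hΨ
  obtain ⟨P, hP⟩ := exists_shellTransform_clm (n := n) (m := m) (s := 1) (by simp)
  obtain ⟨Q, hQ⟩ := exists_shellTransform_clm (n := n) (m := m) (s := -1) (by simp)
  -- Two antilinear maps compose to a linear one in the annihilation part.
  let c : OneParticle n m →SL[starRingEnd ℂ] OneParticle n m :=
    (reflection₁ n m).toContinuousLinearEquiv.toContinuousLinearMap
  refine ⟨R'.comp (c.comp Q) + R.comp P, fun f hf => ?_⟩
  have e : deformedField (deformOp V) θ f ⟨Ψ, hf⟩ = _ := warpedConvolution_apply (h f ⟨Ψ, hΨ⟩) hf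
  have h1 : c (Q f) = plusVec m (conjTest f) := by
    rw [hQ, ← reflection₁_minusVec]
    rfl
  have h2 : P f = plusVec m f := hP f
  rw [e, add_apply, ContinuousLinearMap.comp_apply, ContinuousLinearMap.comp_apply,
    ContinuousLinearMap.comp_apply, h1, h2, hR, hR']

/-- The deformed fields of an admissible matrix are a wedge-covariant field. -/
theorem isWedgeCovariantField_wedgeField (hn : 1 ≤ n)
    (V : OneParticle n m ≃ₗᵢ[ℂ] OneParticle n m)
    (hX : IsPoincareCovariant (deformOp V)) (hX' : IsReflectionCovariant (deformOp V))
    {θ : Matrix (Fin (n + 1)) (Fin (n + 1)) ℝ} (hθ : IsAdmissible θ) :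
    IsWedgeCovariantField (wedgeField (deformOp V) θ) where
  dense_domain := dense_finiteParticle
  vacuum_mem := vacuum_mem_finiteParticle
  poincare_mem x Λ Ψ hΨ := secondQuant_mem _ hΨ
  reflection_mem Ψ hΨ := secondQuant_mem _ hΨ
  le_domain W hW f := (deformedField_domain V (wedgeMatrix θ W) f).ge
  map_mem W hW f Ψ hΨ := deformedField_mem V (wedgeMatrix θ W) f Ψ
  hermitian W hW f Ψ Φ _ _ := deformedField_hermitian V (wedgeMatrix_isMinkSkew hn hθ hW) f Ψ Φ
  tempered W hW Ψ hΨ := deformedField_tempered V (wedgeMatrix θ W) hΨ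
  poincare_covariant W hW x Λ f := by
    rw [wedgeField, wedgeField, wedgeMatrix_map hn hθ ⟨Λ, Or.inl rfl⟩ hW]
    exact poincare_deformedField_of_covariant V _ x Λ (hX x Λ) f
  reflection_covariant W hW f := by
    rw [wedgeField, wedgeField, wedgeMatrix_neg hn hθ hW]
    exact reflection_deformedField_of_covariant V hX' _ f

end DeformedField

end WarpedField
end

open WarpedField

theorem mainTheorem6 (n : ℕ) (hn : 1 ≤ n) (m : ℝ) [Fact (0 < m)]
    (V : OneParticle n m ≃ₗᵢ[ℂ] OneParticle n m) :
    -- the deformation is well defined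
    IsExponential (deformOp V)
      (expI (deformOp V)) ∧
    (∀ θ : Matrix (Fin (n + 1)) (Fin (n + 1)) ℝ, IsMinkSkew θ → ∀ f,
      (deformedField (deformOp V) θ f).domain
        = finiteParticle (OneParticle n m)) ∧
    -- transformation under the proper orthochronous Poincaré group
    (∀ θ : Matrix (Fin (n + 1)) (Fin (n + 1)) ℝ, IsMinkSkew θ → ∀ x Λ f,
      conjugate (poincare m x Λ)
          (deformedField (deformOp V) θ f)
        = deformedField
            (fun μ => conjugate (poincare m x Λ)
              (deformOp V μ))
            θ (poincareTest x Λ f)) ∧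
    -- covariance under the proper orthochronous Lorentz group
    (IsLorentzCovariant (deformOp V) →
      ∀ θ : Matrix (Fin (n + 1)) (Fin (n + 1)) ℝ, IsMinkSkew θ →
      ∀ (Λ : ProperOrthochronous n) f,
      conjugate (poincare m 0 Λ)
          (deformedField (deformOp V) θ f)
        = deformedField (deformOp V)
            (gammaMap Λ.mat θ) (poincareTest 0 Λ f)) ∧
    -- covariance under the Poincaré group and the reflections
    (IsPoincareCovariant (deformOp V) →
      IsReflectionCovariant (deformOp V) →
      ∀ θ : Matrix (Fin (n + 1)) (Fin (n + 1)) ℝ, IsAdmissible θ →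
      (∀ M, IsWedgeTransformation M →
        wedgeMatrix θ (M.mulVec '' rightWedge n) = gammaMap M θ) ∧
      IsWedgeCovariantField (wedgeField (deformOp V) θ)) := by
  refine ⟨isExponential_expI_deformOp V, fun θ _ f => deformedField_domain V θ f,
    fun θ _ x Λ f => poincare_deformedField V θ x Λ f, fun hX θ _ Λ f =>
      poincare_deformedField_of_covariant V θ 0 Λ (hX Λ) f, fun hX hX' θ hθ =>
      ⟨fun M hM => wedgeMatrix_image hn hθ hM,
        isWedgeCovariantField_wedgeField hn V hX hX' hθ⟩⟩
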